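/- **Proposition (semisimple Hopf algebras).** Let $k$ be a field and let $H$ be a Hopf algebra over $k$ with coproduct $h\mapsto h^{(0)}\otimes h^{(1)}$ (iterated: $h\mapsto h^{(0)}\otimes\dots\otimes h^{(m)}$), counit $\varepsilon$ and antipode $S$, which is semisimple as an algebra. *Notation.* An $H$-module algebra is a unital $k$-algebra $A$ with a left $H$-module structure such that $h\cdot(ab)=(h^{(0)}\cdot a)(h^{(1)}\cdot b)$ and $h\cdot 1=\varepsilon(h)1$. Its crossed product $A\rtimes H$ is $A\otimes H$ with the multiplication $(a\otimes g)(b\otimes h)=a(g^{(0)}\cdot b)\otimes g^{(1)}h$. For an algebra $R$, $C_\bullet(R)$ is the usual cyclic module with $C_n(R)=R^{\otimes(n+1)}$. For a left $H$-module $M$, the Hopf homology $H_\bullet(H,M)$ is the homology of the complex $C_p(H,M)=H^{\otimes p}\otimes M$ with the boundary $$\delta(g_1,\dots,g_p,m)=\varepsilon(g_1)(g_2,\dots,g_p,m)+\sum_{i=1}^{p-1}(-1)^i(g_1,\dots,g_ig_{i+1},\dots,g_p,m)+(-1)^p(g_1,\dots,g_{p-1},g_p\cdot m).$$ If $S$ is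 bijective, let $C^H_n(A)=H_0\bigl(H,H\otimes A^{\otimes(n+1)}\bigr)$ be the coinvariants (the quotient by the span of all $h\cdot x-\varepsilon(h)x$) of $H\otimes A^{\otimes (n+1)}$ under the action $$h\cdot(g\mid a_0,\dots,a_n)=(h^{(n+2)}\,g\,S(h^{(0)})\mid h^{(1)}\cdot a_0,\dots,h^{(n+1)}\cdot a_n),$$ with the operators $$\begin{aligned} \tau_n(g\mid a_0,\dots,a_n)&=(g^{(1)}\mid S^{-1}(g^{(0)})\cdot a_n,a_0,\dots,a_{n-1}),\\ \partial_i(g\mid a_0,\dots,a_n)&=(g\mid a_0,\dots,a_ia_{i+1},\dots,a_n)\quad(0\le i<n),\\ \partial_n(g\mid a_0,\dots,a_n)&=(g^{(1)}\mid (S^{-1}(g^{(0)})\cdot a_n)a_0,a_1,\dots,a_{n-1}),\\ \sigma_i(g\mid a_0,\dots,a_n)&=(g\mid a_0,\dots,a_i,1,a_{i+1},\dots,a_n)\quad(0\le i\le n). \end{aligned}$$ Let $W$ be a $\mathbb Z$-graded $k[u]$-module, where $u$ has degree $-2$. For a cyclic $k$-module $C$ put $b=\sum_{i=0}^n(-1)^i\partial_i$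 and $B=(1-(-1)^{n+1}\tau)\,\sigma N$, with $N=\sum_{i=0}^n(-1)^{in}\tau^i$ and the extra degeneracy $\sigma=\tau_{n+1}\sigma_n$ on $C_n$. Let $C[[u]]$ be the graded $k[u]$-module with $C[[u]]_n=\prod_{i\ge0}C_{n+2i}u^i$ (where $C_j=0$ for $j<0$). Then $HC_n(C;W)$, $n\in\mathbb Z$, is the degree $n$ homology of $C[[u]]\otimes_{k[u]}W$ (with its total grading) with the differential $(b+uB)\otimes 1$. We write $HC_n(A\rtimes H;W)$ for $HC_n(C_\bullet(A\rtimes H);W)$. *Conclusion.* 1. The antipode $S$ is bijective. 2. The higher Hopf homology vanishes: $H_q(H,M)=0$ for every left $H$-module $M$ and every $q>0$. 3. For every $H$-module algebra $A$ the operators above make $C^H_\bullet(A)$ a cyclic $k$-module. 4. There are $k$-linear isomorphisms $$HC_n(A\rtimes H;W)\;\cong\;HC_n(C^H_\bullet(A);W)\qquad(n\in\mathbb Z)$$ for all $H$-module algebras $A$ and all graded $k[u]$-modules $W$, natural in $A$ (for $H$-linear homomorphisms of $k$-algebras) and in $W$ (for $k[u]$-linear maps of degree $0$). -/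

import Mathlib

universe u v w x y

open scoped TensorProduct Polynomial

noncomputable section

namespace HopfCyclic

/-! ### Cyclic modules and cyclic homology with coefficients -/

/-- The operators of a cyclic `k`-module: a sequence of `k`-modules `X 0, X 1, …` with faces
`∂_i : X (n+1) → X n`, degeneracies `σ_i : X n → X (n+1)` and cyclic operators `τ_n`.
The relations between them are collected in `CyclicData.IsCyclicModule`. -/
structure CyclicData (k : Type u) [CommRing k] where
  X : ℕ → Type v
  [addCommGroup : ∀ n, AddCommGroup (X n)]
  [module : ∀ n, Module k (X n)]
  face : ∀ n, Fin (n + 2) → X (n + 1) →ₗ[k] X n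
  degen : ∀ n, Fin (n + 1) → X n →ₗ[k] X (n + 1)
  cyc : ∀ n, X n →ₗ[k] X n

namespace CyclicData

attribute [instance] CyclicData.addCommGroup CyclicData.module

variable {k : Type u} [CommRing k]

/-- The simplicial identities together with the cyclic identities. -/
structure IsCyclicModule (C : CyclicData.{u, v} k) : Prop where
  face_face : ∀ (n : ℕ) (i j : Fin (n + 2)), i ≤ j → ∀ c : C.X (n + 2),
    C.face n i (C.face (n + 1) j.succ c) = C.face n j (C.face (n + 1) i.castSucc c)
  degen_degen : ∀ (n : ℕ) (i j : Fin (n + 1)), i ≤ j → ∀ c : C.X n,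
    C.degen (n + 1) i.castSucc (C.degen n j c) = C.degen (n + 1) j.succ (C.degen n i c)
  face_degen_of_lt : ∀ (n : ℕ) (i : Fin (n + 2)) (j : Fin (n + 1)), i ≤ j.castSucc →
    ∀ c : C.X (n + 1),
    C.face (n + 1) i.castSucc (C.degen (n + 1) j.succ c) = C.degen n j (C.face n i c)
  face_degen_self : ∀ (n : ℕ) (i : Fin (n + 1)) (c : C.X n),
    C.face n i.castSucc (C.degen n i c) = c
  face_degen_succ : ∀ (n : ℕ) (i : Fin (n + 1)) (c : C.X n),
    C.face n i.succ (C.degen n i c) = c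
  face_degen_of_gt : ∀ (n : ℕ) (i : Fin (n + 2)) (j : Fin (n + 1)), j.castSucc < i →
    ∀ c : C.X (n + 1),
    C.face (n + 1) i.succ (C.degen (n + 1) j.castSucc c) = C.degen n j (C.face n i c)
  face_zero_cyc : ∀ (n : ℕ) (c : C.X (n + 1)),
    C.face n 0 (C.cyc (n + 1) c) = C.face n (Fin.last (n + 1)) c
  face_succ_cyc : ∀ (n : ℕ) (i : Fin (n + 1)) (c : C.X (n + 1)),
    C.face n i.succ (C.cyc (n + 1) c) = C.cyc n (C.face n i.castSucc c)
  degen_zero_cyc : ∀ (n : ℕ) (c : C.X n),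
    C.degen n 0 (C.cyc n c) = C.cyc (n + 1) (C.cyc (n + 1) (C.degen n (Fin.last n) c))
  degen_succ_cyc : ∀ (n : ℕ) (i : Fin n) (c : C.X n),
    C.degen n i.succ (C.cyc n c) = C.cyc (n + 1) (C.degen n i.castSucc c)
  cyc_pow : ∀ (n : ℕ) (c : C.X n), (C.cyc n ^ (n + 1)) c = c

/-- Morphisms: families of `k`-linear maps commuting with all operators. -/
structure Hom (C C' : CyclicData.{u, v} k) where
  app : ∀ n, C.X n →ₗ[k] C'.X n
  app_face : ∀ n i c, app n (C.face n i c) = C'.face n i (app (n + 1) c)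
  app_degen : ∀ n i c, app (n + 1) (C.degen n i c) = C'.degen n i (app n c)
  app_cyc : ∀ n c, app n (C.cyc n c) = C'.cyc n (app n c)

section MixedComplex

variable (C : CyclicData.{u, v} k)

/-- The Hochschild boundary `b = ∑ (-1)^i ∂_i`. -/
def b (n : ℕ) : C.X (n + 1) →ₗ[k] C.X n :=
  ∑ i : Fin (n + 2), (-1 : k) ^ (i : ℕ) • C.face n i

/-- The norm operator `N = ∑_{i=0}^n (-1)^{in} τ^i`. -/
def norm (n : ℕ) : C.X n →ₗ[k] C.X n :=
  ∑ i ∈ Finset.range (n + 1), (-1 : k) ^ (i * n) • C.cyc n ^ i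

/-- The extra degeneracy `σ = τ_{n+1} σ_n`; it satisfies `τ σ = σ_0 τ`. -/
def extraDegen (n : ℕ) : C.X n →ₗ[k] C.X (n + 1) :=
  C.cyc (n + 1) ∘ₗ C.degen n (Fin.last n)

/-- Connes' operator `B = (1 - (-1)^{n+1} τ) σ N`. -/
def B (n : ℕ) : C.X n →ₗ[k] C.X (n + 1) :=
  (LinearMap.id - (-1 : k) ^ (n + 1) • C.cyc (n + 1)) ∘ₗ C.extraDegen n ∘ₗ C.norm n

/-- The operator `b + B` on `∏_j X j`, `(c_j)_j ↦ (b c_{j+1} + B c_{j-1})_j`. It induces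
`b + uB` on power series, see `psDiff`. -/
def bB : (∀ j, C.X j) →ₗ[k] (∀ j, C.X j) :=
  LinearMap.pi fun j => C.b j ∘ₗ LinearMap.proj (j + 1) +
    match j with
    | 0 => 0
    | i + 1 => C.B i ∘ₗ LinearMap.proj i

/-- The homogeneous power series of degree `n ∈ ℤ`: `X[[u]]_n = ∏_{i ≥ 0} X_{n+2i} u^i`,
where `u` has degree `-2` and `X_j = 0` for `j < 0`. It is realised as the set of families
`(c_j)_{j ≥ 0}` supported on the `j` of the form `n + 2i`, `i ≥ 0` (the coefficient of `u^i` is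
`c_{n+2i}`). With this description multiplication by `u` is the inclusion
`X[[u]]_n ⊆ X[[u]]_{n-2}`. -/
def ps (n : ℤ) : Submodule k (∀ j, C.X j) where
  carrier := {c | ∀ j : ℕ, c j ≠ 0 → ∃ i : ℕ, (j : ℤ) = n + 2 * i}
  zero_mem' := fun j h => absurd rfl h
  add_mem' := by
    intro c d hc hd j h
    by_cases h0 : c j = 0
    · refine hd j fun h1 => h ?_
      rw [Pi.add_apply, h0, h1, add_zero]
    · exact hc j h0
  smul_mem' := by
    intro r c hc j h
    refine hc j fun h0 => h ?_
    rw [Pi.smul_apply, h0, smul_zero]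

theorem ps_le (n : ℤ) : C.ps n ≤ C.ps (n - 2) := by
  intro c hc j hj
  obtain ⟨i, hi⟩ := hc j hj
  exact ⟨i + 1, by push_cast; linarith⟩

theorem bB_mem (n : ℤ) : ∀ c ∈ C.ps n, C.bB c ∈ C.ps (n - 1) := by
  intro c hc j hj
  by_cases h : c (j + 1) = 0
  · cases j with
    | zero => exact absurd (by simp [bB, h]) hj
    | succ j =>
      by_cases h' : c j = 0
      · exact absurd (by simp [bB, h, h']) hj
      · obtain ⟨i, hi⟩ := hc _ h'
        exact ⟨i + 1, by push_cast; linarith⟩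
  · obtain ⟨i, hi⟩ := hc _ h
    exact ⟨i, by push_cast at hi; linarith⟩

/-- The underlying `k`-module `⨁_n X[[u]]_n` of the graded `k[u]`-module `X[[u]]`. -/
abbrev PSum : Type v := DirectSum ℤ fun n => C.ps n

/-- The inclusion of the homogeneous part of degree `n`. -/
abbrev psOf (n : ℤ) : C.ps n →ₗ[k] C.PSum := DirectSum.lof k ℤ (fun n => C.ps n) n

theorem psOf_congr {m n : ℤ} (h : m = n) (c : ∀ j, C.X j) (hm : c ∈ C.ps m) (hn : c ∈ C.ps n) :
    C.psOf m ⟨c, hm⟩ = C.psOf n ⟨c, hn⟩ := by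
  subst h; rfl

/-- Multiplication by `u`, of degree `-2`. -/
def psU : C.PSum →ₗ[k] C.PSum :=
  DirectSum.toModule k ℤ _ fun n => C.psOf (n - 2) ∘ₗ Submodule.inclusion (C.ps_le n)

/-- The differential `b + uB`, of degree `-1`. -/
def psDiff : C.PSum →ₗ[k] C.PSum :=
  DirectSum.toModule k ℤ _ fun n => C.psOf (n - 1) ∘ₗ C.bB.restrict (C.bB_mem n)

theorem psDiff_psU (c : C.PSum) : C.psDiff (C.psU c) = C.psU (C.psDiff c) := by
  suffices h : C.psDiff ∘ₗ C.psU = C.psU ∘ₗ C.psDiff from LinearMap.congr_fun h c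
  refine DirectSum.linearMap_ext _ fun n => LinearMap.ext fun c => ?_
  simp only [LinearMap.comp_apply, psDiff, psU, DirectSum.toModule_lof]
  exact C.psOf_congr (by ring) _ _ _

/-- `X[[u]]` as a module over `k[u]`: its elements are those of `⨁_n X[[u]]_n`, and the
variable of `k[u]` acts by `psU`. -/
def PS : Type v := C.PSum

instance : AddCommGroup C.PS := inferInstanceAs (AddCommGroup C.PSum)

instance : Module k C.PS := inferInstanceAs (Module k C.PSum)

/-- The identity map `⨁_n X[[u]]_n → X[[u]]`. -/
def toPS : C.PSum ≃ₗ[k] C.PS := LinearEquiv.refl k C.PSum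

instance : Module k[X] C.PS :=
  (Module.compHom C.PSum (Polynomial.aeval C.psU).toRingHom : Module k[X] C.PSum)

theorem smul_toPS (p : k[X]) (c : C.PSum) :
    p • C.toPS c = C.toPS (Polynomial.aeval C.psU p c) := rfl

theorem X_smul_toPS (c : C.PSum) : (Polynomial.X : k[X]) • C.toPS c = C.toPS (C.psU c) := by
  rw [smul_toPS, Polynomial.aeval_X]

instance : IsScalarTower k k[X] C.PS where
  smul_assoc r p c := by
    obtain ⟨c, rfl⟩ := C.toPS.surjective c
    rw [smul_toPS, smul_toPS, map_smul, LinearMap.smul_apply, map_smul]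

/-- A `k`-linear map commuting with the action of `u` is `k[u]`-linear. -/
def polyLinear {C C' : CyclicData.{u, v} k} (f : C.PSum →ₗ[k] C'.PSum)
    (hf : ∀ c, f (C.psU c) = C'.psU (f c)) : C.PS →ₗ[k[X]] C'.PS where
  toFun c := C'.toPS (f (C.toPS.symm c))
  map_add' c d := by rw [map_add, map_add, map_add]
  map_smul' p c := by
    obtain ⟨c, rfl⟩ := C.toPS.surjective c
    rw [smul_toPS, LinearEquiv.symm_apply_apply, LinearEquiv.symm_apply_apply, RingHom.id_apply,
      smul_toPS]
    congr 1
    induction p using Polynomial.induction_on generalizing c with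
    | C a => simp [Polynomial.aeval_C, Module.algebraMap_end_apply]
    | add p q hp hq => simp only [map_add, LinearMap.add_apply, hp, hq]
    | monomial n a h =>
      simp only [pow_succ, ← mul_assoc, map_mul, Polynomial.aeval_X,
        Module.End.mul_apply] at h ⊢
      rw [h, hf]

/-- `b + uB` as a `k[u]`-linear map. -/
def diff : C.PS →ₗ[k[X]] C.PS := polyLinear C.psDiff C.psDiff_psU

end MixedComplex

end CyclicData

/-- A graded `k[u]`-module, where `u` (the variable `X` of `k[X]`) has degree `-2`. -/
structure GradedUModule (k : Type u) [CommRing k] where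
  carrier : Type x
  [addCommGroup : AddCommGroup carrier]
  [module : Module k carrier]
  [polyModule : Module k[X] carrier]
  [isScalarTower : IsScalarTower k k[X] carrier]
  gr : ℤ → Submodule k carrier
  isInternal : DirectSum.IsInternal gr
  X_smul_mem : ∀ (n : ℤ), ∀ m ∈ gr n, (Polynomial.X : k[X]) • m ∈ gr (n - 2)

attribute [instance] GradedUModule.addCommGroup GradedUModule.module GradedUModule.polyModule
  GradedUModule.isScalarTower

/-- Morphisms of graded `k[u]`-modules: `k[u]`-linear maps of degree `0`. -/
structure GradedUModule.Hom {k : Type u} [CommRing k] (W W' : GradedUModule.{u, x} k) where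
  toLinearMap : W.carrier →ₗ[k[X]] W'.carrier
  map_mem : ∀ (n : ℤ), ∀ m ∈ W.gr n, toLinearMap m ∈ W'.gr n

namespace CyclicData

variable {k : Type u} [CommRing k]

section Homology

variable (C : CyclicData.{u, v} k) (W : GradedUModule.{u, x} k)

/-- `X ⊠ W = X[[u]] ⊗_{k[u]} W`. -/
abbrev Box : Type (max v x) := C.PS ⊗[k[X]] W.carrier

/-- The homogeneous part of degree `n` of `X ⊠ W`, spanned by the `c ⊗ m` with
`deg c + deg m = n`. -/
def boxGr (n : ℤ) : Submodule k (C.Box W) :=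
  Submodule.span k {z | ∃ (i j : ℤ) (c : C.ps i) (m : W.gr j), i + j = n ∧
    z = C.toPS (C.psOf i c) ⊗ₜ[k[X]] (m : W.carrier)}

/-- The differential `(b + uB) ⊗ 1` of `X ⊠ W`. -/
def boxDiff : C.Box W →ₗ[k] C.Box W :=
  (TensorProduct.map C.diff (LinearMap.id : W.carrier →ₗ[k[X]] W.carrier)).restrictScalars k

/-- The cycles of degree `n`. -/
def cycles (n : ℤ) : Submodule k (C.Box W) :=
  LinearMap.ker (C.boxDiff W) ⊓ C.boxGr W n

/-- The boundaries of degree `n`. -/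
def boundaries (n : ℤ) : Submodule k (C.Box W) :=
  (C.boxGr W (n + 1)).map (C.boxDiff W)

/-- The cyclic homology group `HC_n(X; W)`: the homology of `(X ⊠ W, b + uB)` in degree `n`. -/
abbrev HC (n : ℤ) : Type (max v x) :=
  ↥(C.cycles W n) ⧸ (C.boundaries W n).comap (C.cycles W n).subtype

end Homology

section Functoriality

variable {C C' : CyclicData.{u, v} k} (F : Hom C C')

namespace Hom

theorem app_cyc_pow (n i : ℕ) (c : C.X n) :
    F.app n ((C.cyc n ^ i) c) = (C'.cyc n ^ i) (F.app n c) := by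
  induction i generalizing c with
  | zero => rfl
  | succ i ih => rw [pow_succ, pow_succ, Module.End.mul_apply, Module.End.mul_apply, ih, F.app_cyc]

theorem app_b (n : ℕ) (c : C.X (n + 1)) : F.app n (C.b n c) = C'.b n (F.app (n + 1) c) := by
  simp only [b, LinearMap.sum_apply, LinearMap.smul_apply, map_sum, map_smul, F.app_face]

theorem app_B (n : ℕ) (c : C.X n) : F.app (n + 1) (C.B n c) = C'.B n (F.app n c) := by
  simp only [B, norm, extraDegen, LinearMap.comp_apply, LinearMap.sub_apply, LinearMap.id_apply,
    LinearMap.sum_apply, LinearMap.smul_apply, map_sum, map_smul, map_sub, F.app_cyc,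
    F.app_degen, F.app_cyc_pow]

/-- The induced map on families. -/
def pi : (∀ j, C.X j) →ₗ[k] (∀ j, C'.X j) :=
  LinearMap.pi fun j => F.app j ∘ₗ LinearMap.proj j

theorem pi_mem (n : ℤ) : ∀ c ∈ C.ps n, F.pi c ∈ C'.ps n := by
  intro c hc j hj
  refine hc j fun h => hj ?_
  change F.app j (c j) = 0
  rw [h, map_zero]

theorem pi_bB (c : ∀ j, C.X j) : F.pi (C.bB c) = C'.bB (F.pi c) := by
  funext j
  change F.app j (C.bB c j) = C'.bB (F.pi c) j
  cases j <;> simp [bB, F.app_b, F.app_B, pi]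

/-- The induced map on `⨁_n X[[u]]_n`. -/
def psum : C.PSum →ₗ[k] C'.PSum :=
  DirectSum.toModule k ℤ _ fun n => C'.psOf n ∘ₗ F.pi.restrict (F.pi_mem n)

theorem psum_psU (c : C.PSum) : F.psum (C.psU c) = C'.psU (F.psum c) := by
  suffices h : F.psum ∘ₗ C.psU = C'.psU ∘ₗ F.psum from LinearMap.congr_fun h c
  refine DirectSum.linearMap_ext _ fun n => LinearMap.ext fun c => ?_
  simp only [LinearMap.comp_apply, psum, psU, DirectSum.toModule_lof]
  rfl

theorem psum_psDiff (c : C.PSum) : F.psum (C.psDiff c) = C'.psDiff (F.psum c) := by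
  suffices h : F.psum ∘ₗ C.psDiff = C'.psDiff ∘ₗ F.psum from LinearMap.congr_fun h c
  refine DirectSum.linearMap_ext _ fun n => LinearMap.ext fun c => ?_
  simp only [LinearMap.comp_apply, psum, psDiff, DirectSum.toModule_lof]
  exact congrArg (C'.psOf (n - 1)) (Subtype.ext (F.pi_bB _))

/-- The induced `k[u]`-linear map `X[[u]] → X'[[u]]`. -/
def psMap : C.PS →ₗ[k[X]] C'.PS := polyLinear F.psum F.psum_psU

theorem psMap_diff (c : C.PS) : F.psMap (C.diff c) = C'.diff (F.psMap c) :=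
  congrArg C'.toPS (F.psum_psDiff (C.toPS.symm c))

variable {W W' : GradedUModule.{u, x} k} (f : GradedUModule.Hom W W')

/-- The induced map `X ⊠ W → X' ⊠ W'`. -/
def box : C.Box W →ₗ[k] C'.Box W' :=
  (TensorProduct.map F.psMap f.toLinearMap).restrictScalars k

theorem box_boxDiff (z : C.Box W) : F.box f (C.boxDiff W z) = C'.boxDiff W' (F.box f z) := by
  induction z using TensorProduct.induction_on with
  | zero => simp only [map_zero]
  | add z z' h h' => simp only [map_add, h, h']
  | tmul c m =>
    change F.psMap (C.diff c) ⊗ₜ[k[X]] f.toLinearMap m = C'.diff (F.psMap c) ⊗ₜ[k[X]] _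
    rw [psMap_diff]; rfl

theorem box_mem (n : ℤ) : ∀ z ∈ C.boxGr W n, F.box f z ∈ C'.boxGr W' n := by
  intro z hz
  refine Submodule.span_induction (p := fun z _ => F.box f z ∈ C'.boxGr W' n) ?_ ?_ ?_ ?_ hz
  · rintro _ ⟨i, j, c, m, h, rfl⟩
    refine Submodule.subset_span ⟨i, j, ⟨F.pi c, F.pi_mem i _ c.2⟩,
      ⟨f.toLinearMap m, f.map_mem j _ m.2⟩, h, ?_⟩
    change C'.toPS (F.psum (C.psOf i c)) ⊗ₜ[k[X]] f.toLinearMap m = _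
    rw [psum, DirectSum.toModule_lof]; rfl
  · rw [map_zero]; exact Submodule.zero_mem _
  · intro z z' _ _ h h'; rw [map_add]; exact Submodule.add_mem _ h h'
  · intro r z _ h; rw [map_smul]; exact Submodule.smul_mem _ r h

theorem box_mem_cycles (n : ℤ) : ∀ z ∈ C.cycles W n, F.box f z ∈ C'.cycles W' n := by
  rintro z ⟨h, h'⟩
  refine ⟨?_, F.box_mem f n z h'⟩
  change C'.boxDiff W' (F.box f z) = 0
  rw [← box_boxDiff, show C.boxDiff W z = 0 from h, map_zero]

/-- The induced map on cyclic homology. -/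
def HCMap (n : ℤ) : C.HC W n →ₗ[k] C'.HC W' n :=
  Submodule.mapQ _ _ ((F.box f).restrict (F.box_mem_cycles f n)) <| by
    rintro ⟨z, hz⟩ ⟨y, hy, hyz⟩
    exact ⟨F.box f y, F.box_mem f _ y hy, (F.box_boxDiff f y).symm.trans (congrArg _ hyz)⟩

end Hom

end Functoriality

end CyclicData


/-! ### Tensor powers and the cyclic module of an algebra -/

section TensorPowers

variable (k : Type u) [CommRing k] {R : Type v} [Ring R] [Algebra k R]
variable {R' : Type v} [Ring R'] [Algebra k R']

/-- `snoc (a_0, …, a_{n-1}) a = (a_0, …, a_{n-1}, a)` on tensor powers. -/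
def snoc (n : ℕ) : (⨂[k]^n R) →ₗ[k] R →ₗ[k] ⨂[k]^(n + 1) R :=
  PiTensorProduct.lift (PiTensorProduct.tprod k : MultilinearMap k (fun _ : Fin (n + 1) => R) _).curryRight

/-- `cons a (a_0, …, a_{n-1}) = (a, a_0, …, a_{n-1})` on tensor powers. -/
def cons (n : ℕ) : R →ₗ[k] (⨂[k]^n R) →ₗ[k] ⨂[k]^(n + 1) R :=
  PiTensorProduct.lift.toLinearMap ∘ₗ
    (PiTensorProduct.tprod k : MultilinearMap k (fun _ : Fin (n + 1) => R) _).curryLeft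

variable {k} in
theorem exists_contractNth_update {n : ℕ} (i : Fin n) [DecidableEq (Fin (n + 1))]
    (a : Fin (n + 1) → R) (j : Fin (n + 1)) :
    ∃ (p : Fin n) (L : R →ₗ[k] R), ∀ x,
      i.castSucc.contractNth (· * ·) (Function.update a j x) =
        Function.update (i.castSucc.contractNth (· * ·) a) p (L x) := by
  rcases lt_trichotomy (j : ℕ) i with h | h | h
  · refine ⟨⟨j, by omega⟩, LinearMap.id, fun x => funext fun m => ?_⟩
    simp only [Fin.contractNth, Function.update_apply, Fin.ext_iff, Fin.val_castSucc, Fin.val_succ,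
      LinearMap.id_apply]
    grind
  · refine ⟨i, LinearMap.mulRight k (a i.succ), fun x => funext fun m => ?_⟩
    simp only [Fin.contractNth, Function.update_apply, Fin.ext_iff, Fin.val_castSucc, Fin.val_succ,
      LinearMap.mulRight_apply]
    grind
  · by_cases h' : (j : ℕ) = i + 1
    · refine ⟨i, LinearMap.mulLeft k (a i.castSucc), fun x => funext fun m => ?_⟩
      simp only [Fin.contractNth, Function.update_apply, Fin.ext_iff, Fin.val_castSucc,
        Fin.val_succ, LinearMap.mulLeft_apply]
      grind
    · refine ⟨⟨j - 1, by omega⟩, LinearMap.id, fun x => funext fun m => ?_⟩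
      simp only [Fin.contractNth, Function.update_apply, Fin.ext_iff, Fin.val_castSucc,
        Fin.val_succ, LinearMap.id_apply]
      grind

/-- The multilinear map `(a_0, …, a_n) ↦ (a_0, …, a_i a_{i+1}, …, a_n)`. -/
def mulFaceMultilinear {n : ℕ} (i : Fin n) :
    MultilinearMap k (fun _ : Fin (n + 1) => R) (⨂[k]^n R) where
  toFun a := PiTensorProduct.tprod k (i.castSucc.contractNth (· * ·) a)
  map_update_add' a j x y := by
    obtain ⟨p, L, h⟩ := exists_contractNth_update (k := k) i a j
    rw [h, h, h, map_add, MultilinearMap.map_update_add]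
  map_update_smul' a j r x := by
    obtain ⟨p, L, h⟩ := exists_contractNth_update (k := k) i a j
    rw [h, h, map_smul, MultilinearMap.map_update_smul]

/-- `(a_0, …, a_n) ↦ (a_0, …, a_i a_{i+1}, …, a_n)`, for `0 ≤ i < n`. -/
def mulFace {n : ℕ} (i : Fin n) : (⨂[k]^(n + 1) R) →ₗ[k] ⨂[k]^n R :=
  PiTensorProduct.lift (mulFaceMultilinear k i)

/-- `(a_0, …, a_{n-1}) ↦ (a_0, …, a_{i-1}, 1, a_i, …, a_{n-1})`, for `0 ≤ i ≤ n`. -/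
def insertOne {n : ℕ} (i : Fin (n + 1)) : (⨂[k]^n R) →ₗ[k] ⨂[k]^(n + 1) R :=
  PiTensorProduct.lift
    ((PiTensorProduct.tprod k : MultilinearMap k (fun _ : Fin (n + 1) => R) _).curryMid i 1)

/-- `(a_0, …, a_{n-1}) ↦ (a_{n-1}, a_0, …, a_{n-2})`. -/
def rotate (n : ℕ) : (⨂[k]^n R) →ₗ[k] ⨂[k]^n R :=
  (PiTensorProduct.reindex k (fun _ => R) (finRotate n)).toLinearMap

variable {k}

theorem snoc_tprod (n : ℕ) (a : Fin n → R) (x : R) :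
    snoc k n (PiTensorProduct.tprod k a) x = PiTensorProduct.tprod k (Fin.snoc a x : Fin (n + 1) → R) := by
  rw [snoc, PiTensorProduct.lift.tprod]; rfl

theorem cons_tprod (n : ℕ) (a : Fin n → R) (x : R) :
    cons k n x (PiTensorProduct.tprod k a) = PiTensorProduct.tprod k (Fin.cons x a : Fin (n + 1) → R) := by
  simp only [cons, LinearMap.comp_apply]
  exact PiTensorProduct.lift.tprod _

@[simp] theorem mulFace_tprod {n : ℕ} (i : Fin n) (a : Fin (n + 1) → R) :
    mulFace k i (PiTensorProduct.tprod k a) =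
      PiTensorProduct.tprod k (i.castSucc.contractNth (· * ·) a) := by
  rw [mulFace, PiTensorProduct.lift.tprod]; rfl

@[simp] theorem insertOne_tprod {n : ℕ} (i : Fin (n + 1)) (a : Fin n → R) :
    insertOne k i (PiTensorProduct.tprod k a) =
      PiTensorProduct.tprod k (i.insertNth (α := fun _ => R) 1 a) := by
  rw [insertOne, PiTensorProduct.lift.tprod]; rfl

@[simp] theorem rotate_tprod (n : ℕ) (a : Fin n → R) :
    rotate k n (PiTensorProduct.tprod k a) =
      PiTensorProduct.tprod k (fun i => a ((finRotate n).symm i)) := by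
  simp only [rotate, LinearEquiv.coe_coe, PiTensorProduct.reindex_tprod]

/-- Linear maps on a nonempty tensor power are determined by their values on `snoc`. -/
theorem snoc_ext {n : ℕ} {M : Type w} [AddCommGroup M] [Module k M]
    {f g : (⨂[k]^(n + 1) R) →ₗ[k] M} (h : ∀ t a, f (snoc k n t a) = g (snoc k n t a)) : f = g := by
  refine PiTensorProduct.ext (MultilinearMap.ext fun a => ?_)
  have := h (PiTensorProduct.tprod k (Fin.init a)) (a (Fin.last n))
  rw [snoc_tprod, Fin.snoc_init_self] at this
  exact this

theorem rotate_snoc (n : ℕ) (t : ⨂[k]^n R) (a : R) :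
    rotate k (n + 1) (snoc k n t a) = cons k n a t := by
  suffices h : rotate k (n + 1) ∘ₗ (snoc k n).flip a = cons k n a from LinearMap.congr_fun h t
  refine PiTensorProduct.ext (MultilinearMap.ext fun x => ?_)
  simp only [LinearMap.compMultilinearMap_apply, LinearMap.comp_apply, LinearMap.flip_apply,
    snoc_tprod, rotate_tprod, cons_tprod]
  congr 1
  funext i
  refine Fin.cases ?_ (fun i => ?_) i
  · rw [← finRotate_last, Equiv.symm_apply_apply]; simp
  · have h : (finRotate (n + 1)).symm i.succ = i.castSucc := by
      rw [Equiv.symm_apply_eq, finRotate_apply, Fin.coeSucc_eq_succ]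
    rw [h, Fin.snoc_castSucc, Fin.cons_succ]

theorem mulFace_castSucc_snoc {n : ℕ} (i : Fin n) (t : ⨂[k]^(n + 1) R) (a : R) :
    mulFace k i.castSucc (snoc k (n + 1) t a) = snoc k n (mulFace k i t) a := by
  suffices h : mulFace k i.castSucc ∘ₗ (snoc k (n + 1)).flip a =
    (snoc k n).flip a ∘ₗ mulFace k i from LinearMap.congr_fun h t
  refine PiTensorProduct.ext (MultilinearMap.ext fun x => ?_)
  simp only [LinearMap.compMultilinearMap_apply, LinearMap.comp_apply, LinearMap.flip_apply,
    snoc_tprod, mulFace_tprod]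
  congr 1
  funext ⟨j, hj⟩
  simp only [Fin.contractNth, Fin.snoc, Fin.val_castSucc, Fin.castSucc_mk, Fin.succ_mk,
    Fin.castLT_mk, cast_eq]
  grind

theorem mulFace_last_snoc_snoc {n : ℕ} (t : ⨂[k]^n R) (a b : R) :
    mulFace k (Fin.last n) (snoc k (n + 1) (snoc k n t a) b) = snoc k n t (a * b) := by
  suffices h : mulFace k (Fin.last n) ∘ₗ (snoc k (n + 1)).flip b ∘ₗ (snoc k n).flip a =
    (snoc k n).flip (a * b) from LinearMap.congr_fun h t
  refine PiTensorProduct.ext (MultilinearMap.ext fun x => ?_)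
  simp only [LinearMap.compMultilinearMap_apply, LinearMap.comp_apply, LinearMap.flip_apply,
    snoc_tprod, mulFace_tprod]
  congr 1
  funext j
  simp only [Fin.contractNth, Fin.snoc, Fin.val_castSucc, Fin.val_succ, Fin.val_last]
  grind

theorem insertOne_last {n : ℕ} (t : ⨂[k]^n R) :
    insertOne k (Fin.last n) t = snoc k n t 1 := by
  suffices h : insertOne k (Fin.last n) = (snoc k n (R := R)).flip 1 from LinearMap.congr_fun h t
  refine PiTensorProduct.ext (MultilinearMap.ext fun x => ?_)
  simp only [LinearMap.compMultilinearMap_apply, LinearMap.flip_apply,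
    snoc_tprod, insertOne_tprod, Fin.insertNth_last]
  rfl

theorem insertOne_castSucc_snoc {n : ℕ} (i : Fin (n + 1)) (t : ⨂[k]^n R) (a : R) :
    insertOne k i.castSucc (snoc k n t a) = snoc k (n + 1) (insertOne k i t) a := by
  suffices h : insertOne k i.castSucc ∘ₗ (snoc k n).flip a =
    (snoc k (n + 1)).flip a ∘ₗ insertOne k i from LinearMap.congr_fun h t
  refine PiTensorProduct.ext (MultilinearMap.ext fun x => ?_)
  simp only [LinearMap.compMultilinearMap_apply, LinearMap.comp_apply, LinearMap.flip_apply,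
    snoc_tprod, insertOne_tprod]
  congr 1
  rw [Fin.insertNth_eq_iff]
  refine ⟨by simp, funext fun j => ?_⟩
  refine Fin.lastCases ?_ (fun j => ?_) j
  · simp [Fin.removeNth]
  · simp [Fin.removeNth, Fin.castSucc_succAbove_castSucc]

theorem cons_snoc (n : ℕ) (a b : R) (t : ⨂[k]^n R) :
    cons k (n + 1) a (snoc k n t b) = snoc k (n + 1) (cons k n a t) b := by
  suffices h : cons k (n + 1) a ∘ₗ (snoc k n).flip b =
    (snoc k (n + 1)).flip b ∘ₗ cons k n a from LinearMap.congr_fun h t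
  refine PiTensorProduct.ext (MultilinearMap.ext fun x => ?_)
  simp only [LinearMap.compMultilinearMap_apply, LinearMap.comp_apply, LinearMap.flip_apply,
    snoc_tprod, cons_tprod, Fin.cons_snoc_eq_snoc_cons]

/-- The map of tensor powers induced by a linear map. -/
abbrev powMap (n : ℕ) (f : R →ₗ[k] R') : (⨂[k]^n R) →ₗ[k] ⨂[k]^n R' :=
  PiTensorProduct.map fun _ => f

theorem powMap_mulFace {n : ℕ} (f : R →ₐ[k] R') (i : Fin n) (t : ⨂[k]^(n + 1) R) :
    powMap n f.toLinearMap (mulFace k i t) = mulFace k i (powMap (n + 1) f.toLinearMap t) := by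
  suffices h : powMap n f.toLinearMap ∘ₗ mulFace k i = mulFace k i ∘ₗ powMap (n + 1) f.toLinearMap
    from LinearMap.congr_fun h t
  refine PiTensorProduct.ext (MultilinearMap.ext fun x => ?_)
  simp only [LinearMap.compMultilinearMap_apply, LinearMap.comp_apply, mulFace_tprod,
    PiTensorProduct.map_tprod]
  congr 1
  funext j
  simp only [Fin.contractNth, AlgHom.toLinearMap_apply]
  split_ifs <;> simp

theorem powMap_insertOne {n : ℕ} (f : R →ₐ[k] R') (i : Fin (n + 1)) (t : ⨂[k]^n R) :
    powMap (n + 1) f.toLinearMap (insertOne k i t) = insertOne k i (powMap n f.toLinearMap t) := by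
  suffices h : powMap (n + 1) f.toLinearMap ∘ₗ insertOne k i = insertOne k i ∘ₗ powMap n f.toLinearMap
    from LinearMap.congr_fun h t
  refine PiTensorProduct.ext (MultilinearMap.ext fun x => ?_)
  simp only [LinearMap.compMultilinearMap_apply, LinearMap.comp_apply, insertOne_tprod,
    PiTensorProduct.map_tprod]
  congr 1
  rw [Fin.eq_insertNth_iff]
  refine ⟨by simp, funext fun j => ?_⟩
  simp [Fin.removeNth]

theorem powMap_rotate (n : ℕ) (f : R →ₗ[k] R') (t : ⨂[k]^n R) :
    powMap n f (rotate k n t) = rotate k n (powMap n f t) := by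
  suffices h : powMap n f ∘ₗ rotate k n = rotate k n ∘ₗ powMap n f
    from LinearMap.congr_fun h t
  refine PiTensorProduct.ext (MultilinearMap.ext fun x => ?_)
  simp only [LinearMap.compMultilinearMap_apply, LinearMap.comp_apply, rotate_tprod,
    PiTensorProduct.map_tprod]

end TensorPowers

section AlgebraCyclic

variable (k : Type u) [CommRing k] (R : Type v) [Ring R] [Algebra k R]

/-- The faces `∂_i (a_0, …, a_n) = (a_0, …, a_i a_{i+1}, …, a_n)` for `i < n` and
`∂_n (a_0, …, a_n) = (a_n a_0, a_1, …, a_{n-1})`; the index `n` below is `n - 1` here. -/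
def algebraFace (n : ℕ) : Fin (n + 2) → (⨂[k]^(n + 2) R) →ₗ[k] ⨂[k]^(n + 1) R :=
  Fin.lastCases (motive := fun _ => (⨂[k]^(n + 2) R) →ₗ[k] ⨂[k]^(n + 1) R)
    (mulFace k 0 ∘ₗ rotate k (n + 2)) (fun i => mulFace k i)

/-- The cyclic module `C_•(R)` of an algebra `R`: `C_n(R) = R^{⊗(n+1)}`,
`∂_i (a_0, …, a_n) = (a_0, …, a_i a_{i+1}, …, a_n)` for `i < n`,
`∂_n (a_0, …, a_n) = (a_n a_0, a_1, …, a_{n-1})`,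
`σ_i (a_0, …, a_n) = (a_0, …, a_i, 1, a_{i+1}, …, a_n)`,
`τ_n (a_0, …, a_n) = (a_n, a_0, …, a_{n-1})`. -/
def algebraCyclic : CyclicData.{u, max u v} k where
  X n := ⨂[k]^(n + 1) R
  face n := algebraFace k R n
  degen n i := insertOne k i.succ
  cyc n := rotate k (n + 1)

variable {k R} {R' : Type v} [Ring R'] [Algebra k R']

theorem powMap_algebraFace (f : R →ₐ[k] R') (n : ℕ) (i : Fin (n + 2)) (t : ⨂[k]^(n + 2) R) :
    powMap (n + 1) f.toLinearMap (algebraFace k R n i t) =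
      algebraFace k R' n i (powMap (n + 2) f.toLinearMap t) := by
  refine Fin.lastCases ?_ (fun i => ?_) i
  · simp only [algebraFace, Fin.lastCases_last, LinearMap.comp_apply]
    rw [powMap_mulFace, powMap_rotate]
  · simp only [algebraFace, Fin.lastCases_castSucc]
    rw [powMap_mulFace]

/-- The morphism of cyclic modules induced by a morphism of algebras. -/
def algebraCyclicMap (f : R →ₐ[k] R') : (algebraCyclic k R).Hom (algebraCyclic k R') where
  app n := powMap (n + 1) f.toLinearMap
  app_face n i c := powMap_algebraFace f n i c
  app_degen _ _ c := powMap_insertOne f _ c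
  app_cyc n c := powMap_rotate (n + 1) f.toLinearMap c

end AlgebraCyclic


/-! ### Module algebras and crossed products -/

section ModuleAlgebra

open Coalgebra

set_option linter.unusedSectionVars false

variable (k : Type u) [CommRing k] (H : Type v) [Ring H] [Bialgebra k H]

section Sweedler

variable {k H} {M : Type w} [AddCommMonoid M] [Module k M]

/-- Coassociativity in Sweedler notation: `f (h_{(0)(0)}, h_{(0)(1)}, h_{(1)}) =
f (h_{(0)}, h_{(1)(0)}, h_{(1)(1)})` for trilinear `f`. -/
theorem sweedler_coassoc (f : H →ₗ[k] H →ₗ[k] H →ₗ[k] M) (h : H) :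
    ∑ i ∈ (ℛ k h).index, ∑ j ∈ (ℛ k ((ℛ k h).left i)).index,
      f ((ℛ k ((ℛ k h).left i)).left j) ((ℛ k ((ℛ k h).left i)).right j) ((ℛ k h).right i) =
    ∑ i ∈ (ℛ k h).index, ∑ j ∈ (ℛ k ((ℛ k h).right i)).index,
      f ((ℛ k h).left i) ((ℛ k ((ℛ k h).right i)).left j) ((ℛ k ((ℛ k h).right i)).right j) := by
  have := congrArg (TensorProduct.lift (TensorProduct.uncurry (.id k) H H M ∘ₗ f))
    (sum_tmul_tmul_eq (ℛ k h) (fun i => ℛ k ((ℛ k h).left i)) (fun i => ℛ k ((ℛ k h).right i)))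
  simpa only [map_sum, TensorProduct.lift.tmul, LinearMap.comp_apply,
    TensorProduct.uncurry_apply] using this

/-- Sweedler notation: `f (h_{(0)}, h_{(1)})` for bilinear `f`. -/
def sweedler (f : H →ₗ[k] H →ₗ[k] M) : H →ₗ[k] M := TensorProduct.lift f ∘ₗ comul

theorem sweedler_apply (f : H →ₗ[k] H →ₗ[k] M) (h : H) :
    sweedler f h = ∑ i ∈ (ℛ k h).index, f ((ℛ k h).left i) ((ℛ k h).right i) := by
  rw [sweedler, LinearMap.comp_apply, ← (ℛ k h).eq, map_sum]
  rfl

/-- Sweedler notation with a linear parameter: `p, h ↦ γ (p, h_{(0)}, h_{(1)})`. -/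
def sweedlerParam {P : Type x} [AddCommMonoid P] [Module k P] (γ : P →ₗ[k] H →ₗ[k] H →ₗ[k] M) :
    P →ₗ[k] H →ₗ[k] M :=
  LinearMap.lcomp k M comul ∘ₗ TensorProduct.uncurry (.id k) H H M ∘ₗ γ

theorem sweedlerParam_apply {P : Type x} [AddCommMonoid P] [Module k P]
    (γ : P →ₗ[k] H →ₗ[k] H →ₗ[k] M) (p : P) (h : H) : sweedlerParam γ p h =
      ∑ i ∈ (ℛ k h).index, γ p ((ℛ k h).left i) ((ℛ k h).right i) :=
  sweedler_apply (γ p) h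

theorem sum_smul_counit (h : H) :
    ∑ i ∈ (ℛ k h).index, counit (R := k) ((ℛ k h).right i) • (ℛ k h).left i = h := by
  simpa only [map_sum, TensorProduct.rid_tmul, one_smul] using
    congrArg (TensorProduct.rid k H) (sum_tmul_counit_eq (ℛ k h))

end Sweedler

variable (A : Type w) [Ring A] [Algebra k A] [Module H A] [IsScalarTower k H A]

/-- The action `h, a ↦ h · a` as a `k`-bilinear map. -/
def actMap (A : Type w) [AddCommGroup A] [Module k A] [Module H A] [IsScalarTower k H A] :
    H →ₗ[k] A →ₗ[k] A := (Algebra.lsmul k k A).toLinearMap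

/-- `A` is a left `H`-module algebra: `h · (ab) = (h_{(0)} · a) (h_{(1)} · b)` and
`h · 1 = ε(h) 1`. -/
class HModuleAlgebra : Prop where
  smul_mul_eq : ∀ (h : H) (a b : A), h • (a * b) =
    TensorProduct.lift ((LinearMap.mul k A).compl₁₂ ((actMap k H A).flip a) ((actMap k H A).flip b))
      (comul (R := k) h)
  smul_one_eq : ∀ h : H, h • (1 : A) = algebraMap k A (counit h)

variable {k H A} in
theorem smul_mul_sum [HModuleAlgebra k H A] (h : H) (a b : A) : h • (a * b) =
    ∑ i ∈ (ℛ k h).index, ((ℛ k h).left i • a) * ((ℛ k h).right i • b) := by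
  rw [HModuleAlgebra.smul_mul_eq (k := k), ← (ℛ k h).eq, map_sum]
  rfl

namespace CrossedProduct

/-- Left multiplication by `a ⊗ 1`: `b ⊗ l ↦ ab ⊗ l`. -/
def leftMul : A →ₗ[k] Module.End k (A ⊗[k] H) :=
  (TensorProduct.mapBilinear (.id k) A H A H).flip LinearMap.id ∘ₗ LinearMap.mul k A

/-- Left multiplication by `1 ⊗ g`: `b ⊗ l ↦ g_{(0)} · b ⊗ g_{(1)} l`. -/
def rightMul : H →ₗ[k] Module.End k (A ⊗[k] H) :=
  sweedler ((TensorProduct.mapBilinear (.id k) A H A H).compl₁₂ (actMap k H A) (LinearMap.mul k H))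

/-- The multiplication `(a ⊗ g)(b ⊗ h) = a (g_{(0)} · b) ⊗ g_{(1)} h`. -/
def mulMap : (A ⊗[k] H) →ₗ[k] Module.End k (A ⊗[k] H) :=
  TensorProduct.lift
    ((LinearMap.mul k (Module.End k (A ⊗[k] H))).compl₁₂ (leftMul k H A) (rightMul k H A))

variable {k H A}

theorem rightMul_tmul (g l : H) (b : A) : rightMul k H A g (b ⊗ₜ l) =
    ∑ i ∈ (ℛ k g).index, ((ℛ k g).left i • b) ⊗ₜ[k] ((ℛ k g).right i * l) := by
  rw [rightMul, sweedler_apply, LinearMap.sum_apply]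
  rfl

theorem mulMap_tmul (a : A) (g : H) (x : A ⊗[k] H) :
    mulMap k H A (a ⊗ₜ g) x = leftMul k H A a (rightMul k H A g x) := rfl

theorem mulMap_tmul_tmul (a b : A) (g h : H) : mulMap k H A (a ⊗ₜ g) (b ⊗ₜ h) =
    ∑ i ∈ (ℛ k g).index, (a * ((ℛ k g).left i • b)) ⊗ₜ[k] ((ℛ k g).right i * h) := by
  rw [mulMap_tmul, rightMul_tmul, map_sum]
  rfl

theorem rightMul_mul (g h : H) (z : A ⊗[k] H) :
    rightMul k H A (g * h) z = rightMul k H A g (rightMul k H A h z) := by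
  have key : ∀ x y : H ⊗[k] H,
      TensorProduct.lift ((TensorProduct.mapBilinear (.id k) A H A H).compl₁₂ (actMap k H A)
        (LinearMap.mul k H)) (x * y) =
      TensorProduct.lift ((TensorProduct.mapBilinear (.id k) A H A H).compl₁₂ (actMap k H A)
        (LinearMap.mul k H)) x ∘ₗ
      TensorProduct.lift ((TensorProduct.mapBilinear (.id k) A H A H).compl₁₂ (actMap k H A)
        (LinearMap.mul k H)) y := by
    intro x y
    induction x using TensorProduct.induction_on with
    | zero => rw [zero_mul, map_zero, LinearMap.zero_comp]
    | add x x' h h' => rw [add_mul, map_add, map_add, LinearMap.add_comp, h, h']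
    | tmul x x' =>
      induction y using TensorProduct.induction_on with
      | zero => rw [mul_zero, map_zero, LinearMap.comp_zero]
      | add y y' h h' => rw [mul_add, map_add, map_add, LinearMap.comp_add, h, h']
      | tmul y y' =>
        refine TensorProduct.ext' fun a l => ?_
        rw [Algebra.TensorProduct.tmul_mul_tmul]
        change ((x * y) • a) ⊗ₜ[k] (x' * y' * l) = (x • y • a) ⊗ₜ[k] (x' * (y' * l))
        rw [mul_smul, mul_assoc]
  rw [rightMul, sweedler, LinearMap.comp_apply, LinearMap.comp_apply, LinearMap.comp_apply,
    Bialgebra.comul_mul, key, LinearMap.comp_apply]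

theorem rightMul_one (z : A ⊗[k] H) : rightMul k H A 1 z = z := by
  rw [rightMul, sweedler, LinearMap.comp_apply, Bialgebra.comul_one, Algebra.TensorProduct.one_def,
    TensorProduct.lift.tmul]
  induction z using TensorProduct.induction_on with
  | zero => rw [map_zero]
  | add x y h h' => rw [map_add, h, h']
  | tmul a l =>
    change ((1 : H) • a) ⊗ₜ[k] (1 * l) = a ⊗ₜ[k] l
    rw [one_smul, one_mul]

theorem leftMul_mul (a b : A) (z : A ⊗[k] H) :
    leftMul k H A (a * b) z = leftMul k H A a (leftMul k H A b z) := by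
  induction z using TensorProduct.induction_on with
  | zero => simp only [map_zero]
  | add x y h h' => simp only [map_add, h, h']
  | tmul c l =>
    change (a * b * c) ⊗ₜ[k] l = (a * (b * c)) ⊗ₜ[k] l
    rw [mul_assoc]

variable [HModuleAlgebra k H A]

theorem rightMul_leftMul (g : H) (b : A) (z : A ⊗[k] H) :
    rightMul k H A g (leftMul k H A b z) = ∑ i ∈ (ℛ k g).index,
      leftMul k H A ((ℛ k g).left i • b) (rightMul k H A ((ℛ k g).right i) z) := by
  induction z using TensorProduct.induction_on with
  | zero => simp only [map_zero, Finset.sum_const_zero]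
  | add x y h h' => simp only [map_add, h, h', Finset.sum_add_distrib]
  | tmul c l =>
    have := sweedler_coassoc
      (((LinearMap.mul k A).compl₁₂ ((actMap k H A).flip b) ((actMap k H A).flip c)).compr₂
        ((TensorProduct.mk k A H).compl₂ (LinearMap.mulRight k l))) g
    change rightMul k H A g ((b * c) ⊗ₜ[k] l) = _
    simp only [rightMul_tmul, smul_mul_sum (k := k), TensorProduct.sum_tmul, map_sum]
    exact this

theorem mulMap_assoc (x y z : A ⊗[k] H) :
    mulMap k H A (mulMap k H A x y) z = mulMap k H A x (mulMap k H A y z) := by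
  induction x using TensorProduct.induction_on with
  | zero => simp only [map_zero, LinearMap.zero_apply]
  | add x x' h h' => simp only [map_add, LinearMap.add_apply, h, h']
  | tmul a g =>
    induction y using TensorProduct.induction_on with
    | zero => simp only [map_zero, LinearMap.zero_apply]
    | add y y' h h' => simp only [map_add, LinearMap.add_apply, h, h']
    | tmul b h =>
      rw [mulMap_tmul_tmul, map_sum, LinearMap.sum_apply, mulMap_tmul, mulMap_tmul,
        rightMul_leftMul, map_sum]
      refine Finset.sum_congr rfl fun i _ => ?_
      rw [mulMap_tmul, leftMul_mul, rightMul_mul]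

theorem mulMap_one_left (x : A ⊗[k] H) : mulMap k H A (1 ⊗ₜ 1) x = x := by
  rw [mulMap_tmul, rightMul_one]
  induction x using TensorProduct.induction_on with
  | zero => rw [map_zero]
  | add x y h h' => rw [map_add, h, h']
  | tmul a l =>
    change (1 * a) ⊗ₜ[k] l = a ⊗ₜ[k] l
    rw [one_mul]

theorem mulMap_one_right (x : A ⊗[k] H) : mulMap k H A x (1 ⊗ₜ 1) = x := by
  induction x using TensorProduct.induction_on with
  | zero => rw [map_zero, LinearMap.zero_apply]
  | add x y h h' => rw [map_add, LinearMap.add_apply, h, h']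
  | tmul a g =>
    rw [mulMap_tmul_tmul]
    simp only [HModuleAlgebra.smul_one_eq (k := k) (A := A), mul_one, Algebra.algebraMap_eq_smul_one,
      mul_smul_comm, TensorProduct.smul_tmul, ← TensorProduct.tmul_sum, sum_counit_smul]

end CrossedProduct

/-- The crossed product `A ⋊ H`: the `k`-module `A ⊗ H` with multiplication
`(a ⊗ g)(b ⊗ h) = a (g_{(0)} · b) ⊗ g_{(1)} h`. -/
def CrossedProduct [HModuleAlgebra k H A] : Type (max v w) := A ⊗[k] H

namespace CrossedProduct

variable [HModuleAlgebra k H A]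

instance : AddCommGroup (CrossedProduct k H A) := inferInstanceAs (AddCommGroup (A ⊗[k] H))

instance : Module k (CrossedProduct k H A) := inferInstanceAs (Module k (A ⊗[k] H))

instance : Ring (CrossedProduct k H A) where
  __ := (inferInstance : AddCommGroup (CrossedProduct k H A))
  mul x y := mulMap k H A x y
  one := (1 : A) ⊗ₜ[k] (1 : H)
  mul_assoc x y z := mulMap_assoc x y z
  one_mul x := mulMap_one_left x
  mul_one x := mulMap_one_right x
  left_distrib x y z := (mulMap k H A x).map_add y z
  right_distrib x y z := LinearMap.map_add₂ (mulMap k H A) x y z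
  zero_mul x := LinearMap.map_zero₂ (mulMap k H A) x
  mul_zero x := (mulMap k H A x).map_zero

instance : Algebra k (CrossedProduct k H A) :=
  Algebra.ofModule (fun r x y => LinearMap.map_smul₂ (mulMap k H A) r x y)
    (fun r x y => (mulMap k H A x).map_smul r y)

variable {k H A} {A' : Type w} [Ring A'] [Algebra k A'] [Module H A'] [IsScalarTower k H A']
  [HModuleAlgebra k H A']

theorem map_mulMap (f : A →ₐ[k] A') (hf : ∀ (h : H) (a : A), f (h • a) = h • f a)
    (x y : A ⊗[k] H) : f.toLinearMap.rTensor H (mulMap k H A x y) =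
      mulMap k H A' (f.toLinearMap.rTensor H x) (f.toLinearMap.rTensor H y) := by
  induction x using TensorProduct.induction_on with
  | zero => simp only [map_zero, LinearMap.zero_apply]
  | add x x' h h' => simp only [map_add, LinearMap.add_apply, h, h']
  | tmul a g =>
    induction y using TensorProduct.induction_on with
    | zero => simp only [map_zero]
    | add y y' h h' => simp only [map_add, h, h']
    | tmul b h =>
      simp only [mulMap_tmul_tmul, map_sum, LinearMap.rTensor_tmul, AlgHom.toLinearMap_apply,
        map_mul, hf]

/-- The algebra map `A ⋊ H → A' ⋊ H` induced by a morphism `A → A'` of `H`-module algebras. -/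
def map (f : A →ₐ[k] A') (hf : ∀ (h : H) (a : A), f (h • a) = h • f a) :
    CrossedProduct k H A →ₐ[k] CrossedProduct k H A' :=
  AlgHom.ofLinearMap (f.toLinearMap.rTensor H : (A ⊗[k] H) →ₗ[k] (A' ⊗[k] H))
    (by
      change f.toLinearMap.rTensor H ((1 : A) ⊗ₜ[k] (1 : H)) = (1 : A') ⊗ₜ[k] (1 : H)
      rw [LinearMap.rTensor_tmul, AlgHom.toLinearMap_apply, map_one])
    (map_mulMap f hf)

end CrossedProduct

end ModuleAlgebra

/-! ### The cyclic module of equivariant chains -/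

section EquivariantChains

set_option linter.unusedSectionVars false

open Coalgebra HopfAlgebra

variable (k : Type u) [CommRing k] (H : Type v) [Ring H]

/-- The iterated coproduct `H → H^{⊗n}`, `h ↦ h_{(0)} ⊗ ⋯ ⊗ h_{(n-1)}` (the counit for `n = 0`). -/
def iterComul [Bialgebra k H] : ∀ n : ℕ, H →ₗ[k] ⨂[k]^n H
  | 0 => LinearMap.toSpanSingleton k (⨂[k]^0 H) (PiTensorProduct.tprod k Fin.elim0) ∘ₗ counit
  | n + 1 => sweedler (snoc k n ∘ₗ iterComul n)

variable (A : Type w) [Ring A] [Algebra k A]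

/-- The diagonal action of `H` on `A^{⊗n}`:
`h · (a_0, …, a_{n-1}) = (h_{(0)} · a_0, …, h_{(n-1)} · a_{n-1})`. -/
def diagAct [Bialgebra k H] [Module H A] [IsScalarTower k H A] (n : ℕ) :
    H →ₗ[k] Module.End k (⨂[k]^n A) :=
  PiTensorProduct.map₂ (fun _ => actMap k H A) ∘ₗ iterComul k H n

/-- The action on the first factor: `h, (a_0, …, a_n) ↦ (h · a_0, a_1, …, a_n)`. -/
def firstAct [Bialgebra k H] [Module H A] [IsScalarTower k H A] (n : ℕ) :
    H →ₗ[k] Module.End k (⨂[k]^(n + 1) A) :=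
  (PiTensorProduct.mapMultilinear k (fun _ : Fin (n + 1) => A) (fun _ => A)).toLinearMap
    (fun _ => LinearMap.id) 0 ∘ₗ actMap k H A

section Lemmas

variable {k H A}

section Bialg
variable [Bialgebra k H] [Module H A] [IsScalarTower k H A]

theorem map₂_snoc (n : ℕ) (s : ⨂[k]^n H) (x : H) (t : ⨂[k]^n A) (a : A) :
    PiTensorProduct.map₂ (fun _ => actMap k H A) (snoc k n s x) (snoc k n t a) =
      snoc k n (PiTensorProduct.map₂ (fun _ => actMap k H A) s t) (x • a) := by
  suffices h : (PiTensorProduct.map₂ (fun _ : Fin (n + 1) => actMap k H A)).compl₁₂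
      ((snoc k n).flip x) ((snoc k n).flip a) =
      (PiTensorProduct.map₂ (fun _ : Fin n => actMap k H A)).compr₂ ((snoc k n).flip (x • a)) from
    LinearMap.congr_fun (LinearMap.congr_fun h s) t
  refine PiTensorProduct.ext (MultilinearMap.ext fun y => PiTensorProduct.ext
    (MultilinearMap.ext fun b => ?_))
  simp only [LinearMap.compMultilinearMap_apply, LinearMap.compl₁₂_apply, LinearMap.flip_apply,
    LinearMap.compr₂_apply, snoc_tprod, PiTensorProduct.map₂_tprod_tprod]
  congr 1
  funext i
  refine Fin.lastCases ?_ (fun i => ?_) i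
  · simp only [Fin.snoc_last]; rfl
  · simp only [Fin.snoc_castSucc]

theorem diagAct_snoc (n : ℕ) (h : H) (t : ⨂[k]^n A) (a : A) :
    diagAct k H A (n + 1) h (snoc k n t a) = ∑ i ∈ (ℛ k h).index,
      snoc k n (diagAct k H A n ((ℛ k h).left i) t) ((ℛ k h).right i • a) := by
  rw [diagAct, iterComul, LinearMap.comp_apply, sweedler_apply, map_sum, LinearMap.sum_apply]
  refine Finset.sum_congr rfl fun i _ => ?_
  rw [LinearMap.comp_apply, map₂_snoc]
  rfl

theorem diagAct_zero (h : H) (t : ⨂[k]^0 A) :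
    diagAct k H A 0 h t = counit (R := k) h • t := by
  suffices h : diagAct k H A 0 h = counit (R := k) h • LinearMap.id from LinearMap.congr_fun h t
  refine PiTensorProduct.ext (MultilinearMap.ext fun a => ?_)
  simp only [LinearMap.compMultilinearMap_apply, diagAct, iterComul, LinearMap.comp_apply,
    LinearMap.toSpanSingleton_apply, map_smul, LinearMap.smul_apply,
    PiTensorProduct.map₂_tprod_tprod, LinearMap.id_apply]
  congr 2
  exact Subsingleton.elim _ _

theorem diagAct_cons (n : ℕ) (h : H) (t : ⨂[k]^n A) (a : A) :
    diagAct k H A (n + 1) h (cons k n a t) = ∑ i ∈ (ℛ k h).index,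
      cons k n ((ℛ k h).left i • a) (diagAct k H A n ((ℛ k h).right i) t) := by
  induction n generalizing h with
  | zero =>
    have key : ∀ (x : A) (s : ⨂[k]^0 A), cons k 0 x s = snoc k 0 s x := by
      intro x s
      suffices e : cons k 0 x = (snoc k 0).flip x from LinearMap.congr_fun e s
      refine PiTensorProduct.ext (MultilinearMap.ext fun b => ?_)
      simp only [LinearMap.compMultilinearMap_apply, LinearMap.flip_apply, cons_tprod, snoc_tprod]
      congr 1
      funext i
      rw [show i = 0 from Fin.ext (by omega)]
      rfl
    simp only [key, diagAct_snoc, diagAct_zero, map_smul, LinearMap.smul_apply]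
    have h1 := congrArg (snoc k 0 t) (congrArg (fun x => x • a) (sum_counit_smul (ℛ k h)))
    have h2 := congrArg (snoc k 0 t) (congrArg (fun x => x • a) (sum_smul_counit (k := k) h))
    simp only [Finset.sum_smul, map_sum, smul_assoc, map_smul] at h1 h2
    rw [h1, h2]
  | succ n ih =>
    suffices e : diagAct k H A (n + 2) h ∘ₗ cons k (n + 1) a = ∑ i ∈ (ℛ k h).index,
        cons k (n + 1) ((ℛ k h).left i • a) ∘ₗ diagAct k H A (n + 1) ((ℛ k h).right i) by
      have := LinearMap.congr_fun e t
      rwa [LinearMap.sum_apply] at this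
    refine snoc_ext fun t b => ?_
    have := sweedler_coassoc (((cons k n).compl₁₂ ((actMap k H A).flip a)
      ((diagAct k H A n).flip t)).compr₂ ((snoc k (n + 1)).compl₂ ((actMap k H A).flip b))) h
    simp only [LinearMap.sum_apply, LinearMap.comp_apply, cons_snoc, diagAct_snoc, ih, map_sum]
    exact this

theorem firstAct_cons (n : ℕ) (h : H) (t : ⨂[k]^n A) (a : A) :
    firstAct k H A n h (cons k n a t) = cons k n (h • a) t := by
  suffices e : firstAct k H A n h ∘ₗ cons k n a = cons k n (h • a) from LinearMap.congr_fun e t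
  refine PiTensorProduct.ext (MultilinearMap.ext fun b => ?_)
  simp only [LinearMap.compMultilinearMap_apply, LinearMap.comp_apply, cons_tprod, firstAct,
    MultilinearMap.toLinearMap_apply, PiTensorProduct.mapMultilinear_apply,
    PiTensorProduct.map_tprod]
  congr 1
  funext i
  refine Fin.cases ?_ (fun i => ?_) i
  · simp; rfl
  · simp

variable [HModuleAlgebra k H A]

theorem diagAct_mulFace {n : ℕ} (i : Fin n) (h : H) (t : ⨂[k]^(n + 1) A) :
    mulFace k i (diagAct k H A (n + 1) h t) = diagAct k H A n h (mulFace k i t) := by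
  induction n generalizing h with
  | zero => exact i.elim0
  | succ n ih =>
    suffices e : mulFace k i ∘ₗ diagAct k H A (n + 2) h = diagAct k H A (n + 1) h ∘ₗ mulFace k i
      from LinearMap.congr_fun e t
    refine Fin.lastCases ?_ (fun i => ?_) i
    · refine snoc_ext fun t b => ?_
      suffices e : mulFace k (Fin.last n) ∘ₗ diagAct k H A (n + 2) h ∘ₗ (snoc k (n + 1)).flip b =
          diagAct k H A (n + 1) h ∘ₗ mulFace k (Fin.last n) ∘ₗ (snoc k (n + 1)).flip b
        from LinearMap.congr_fun e t
      refine snoc_ext fun t a => ?_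
      have := sweedler_coassoc (LinearMap.lcomp k _
        ((LinearMap.mul k A).compl₁₂ ((actMap k H A).flip a) ((actMap k H A).flip b)) ∘ₗ
        LinearMap.llcomp k H A (⨂[k]^(n + 1) A) ∘ₗ snoc k n ∘ₗ (diagAct k H A n).flip t) h
      simp only [LinearMap.comp_apply, LinearMap.flip_apply, mulFace_last_snoc_snoc, diagAct_snoc,
        map_sum, LinearMap.sum_apply, smul_mul_sum (k := k)]
      exact this
    · refine snoc_ext fun t b => ?_
      simp only [LinearMap.comp_apply, diagAct_snoc, mulFace_castSucc_snoc, map_sum, ih]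

theorem diagAct_insertOne {n : ℕ} (i : Fin (n + 1)) (h : H) (t : ⨂[k]^n A) :
    insertOne k i (diagAct k H A n h t) = diagAct k H A (n + 1) h (insertOne k i t) := by
  have last : ∀ (n : ℕ) (h : H) (t : ⨂[k]^n A), insertOne k (Fin.last n) (diagAct k H A n h t) =
      diagAct k H A (n + 1) h (insertOne k (Fin.last n) t) := by
    intro n h t
    have := congrArg (fun x => snoc k n (diagAct k H A n x t) (1 : A)) (sum_smul_counit (k := k) h)
    simp only [map_sum, map_smul, LinearMap.sum_apply, LinearMap.smul_apply] at this
    simp only [insertOne_last, diagAct_snoc, HModuleAlgebra.smul_one_eq (k := k) (A := A),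
      Algebra.algebraMap_eq_smul_one, map_smul, this]
  induction n generalizing h with
  | zero =>
    rw [show i = Fin.last 0 from Fin.ext (by simp)]
    exact last 0 h t
  | succ n ih =>
    refine Fin.lastCases (last _ h t) (fun i => ?_) i
    suffices e : insertOne k i.castSucc ∘ₗ diagAct k H A (n + 1) h =
        diagAct k H A (n + 2) h ∘ₗ insertOne k i.castSucc from LinearMap.congr_fun e t
    refine snoc_ext fun t b => ?_
    simp only [LinearMap.comp_apply, diagAct_snoc, insertOne_castSucc_snoc, map_sum, ih]

end Bialg

end Lemmas

variable [HopfAlgebra k H] [Module H A] [IsScalarTower k H A]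

/-- The action of `H` on `H ⊗ A^{⊗n}`:
`h · (g | a_0, …, a_{n-1}) = (h_{(2)} g S(h_{(0)}) | h_{(1)} · (a_0, …, a_{n-1}))`, where `H` acts
diagonally on `A^{⊗n}`; that is
`(h_{(n+1)} g S(h_{(0)}) | h_{(1)} · a_0, …, h_{(n)} · a_{n-1})`. -/
def adAct (n : ℕ) : H →ₗ[k] Module.End k (H ⊗[k] ⨂[k]^n A) :=
  let L : H →ₗ[k] H →ₗ[k] Module.End k H :=
    ((LinearMap.mul k (Module.End k H)).compl₁₂ (LinearMap.mul k H)
      ((LinearMap.mul k H).flip ∘ₗ antipode k)).flip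
  let F : H →ₗ[k] H →ₗ[k] H →ₗ[k] Module.End k (H ⊗[k] ⨂[k]^n A) :=
    (LinearMap.llcomp k H (Module.End k H) (Module.End k (H ⊗[k] ⨂[k]^n A)) ∘ₗ
      (TensorProduct.mapBilinear (.id k) H (⨂[k]^n A) H (⨂[k]^n A)).flip ∘ₗ
        diagAct k H A n).flip ∘ₗ L
  TensorProduct.lift (TensorProduct.uncurry (.id k) H H _ ∘ₗ F) ∘ₗ comul.lTensor H ∘ₗ comul

variable {k H A} in
theorem adAct_tmul (n : ℕ) (h g : H) (t : ⨂[k]^n A) : adAct k H A n h (g ⊗ₜ t) =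
    ∑ i ∈ (ℛ k h).index, ∑ j ∈ (ℛ k ((ℛ k h).right i)).index,
      ((ℛ k ((ℛ k h).right i)).right j * (g * antipode k ((ℛ k h).left i))) ⊗ₜ[k]
        diagAct k H A n ((ℛ k ((ℛ k h).right i)).left j) t := by
  rw [adAct]
  simp only [LinearMap.comp_apply]
  conv_lhs => rw [← (ℛ k h).eq]
  rw [map_sum, map_sum, LinearMap.sum_apply]
  refine Finset.sum_congr rfl fun i _ => ?_
  rw [LinearMap.lTensor_tmul]
  conv_lhs => rw [← (ℛ k ((ℛ k h).right i)).eq]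
  rw [TensorProduct.tmul_sum, map_sum, LinearMap.sum_apply]
  rfl

/-- The span of all `h · x - ε(h) x`. -/
def coinvRel (n : ℕ) : Submodule k (H ⊗[k] ⨂[k]^n A) :=
  Submodule.span k {z | ∃ (h : H) (x : H ⊗[k] ⨂[k]^n A),
    z = adAct k H A n h x - counit (R := k) h • x}

variable {k H A}

theorem coinvRel_swap (n : ℕ) (g h : H) (t : ⨂[k]^n A) :
    (g * h) ⊗ₜ[k] t - ∑ i ∈ (ℛ k h).index,
      ((ℛ k h).right i * g) ⊗ₜ[k] diagAct k H A n ((ℛ k h).left i) t ∈ coinvRel k H A n := by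
  let γ : H →ₗ[k] H →ₗ[k] H →ₗ[k] H ⊗[k] ⨂[k]^n A :=
    LinearMap.lcomp k _ ((diagAct k H A n).flip t) ∘ₗ LinearMap.lflip.toLinearMap ∘ₗ
      (LinearMap.mul k H).flip.compr₂ (TensorProduct.mk k H (⨂[k]^n A))
  have hγ : ∀ p u : H, sweedlerParam γ p u = ∑ i ∈ (ℛ k u).index,
      ((ℛ k u).right i * p) ⊗ₜ[k] diagAct k H A n ((ℛ k u).left i) t :=
    fun p u => sweedlerParam_apply γ p u
  have h1 : (g * h) ⊗ₜ[k] t = ∑ i ∈ (ℛ k h).index,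
      counit (R := k) ((ℛ k h).right i) • ((g * (ℛ k h).left i) ⊗ₜ[k] t) := by
    conv_lhs => rw [← sum_smul_counit (k := k) h]
    simp only [Finset.mul_sum, TensorProduct.sum_tmul, mul_smul_comm, TensorProduct.smul_tmul']
  have h2 : sweedlerParam γ g h = ∑ i ∈ (ℛ k h).index,
      adAct k H A n ((ℛ k h).right i) ((g * (ℛ k h).left i) ⊗ₜ[k] t) := by
    have := sweedler_coassoc (((LinearMap.mul k H).compl₂ (antipode k)).compr₂
      (sweedlerParam γ ∘ₗ LinearMap.mulLeft k g)) h
    have e : ∀ i ∈ (ℛ k h).index, adAct k H A n ((ℛ k h).right i) ((g * (ℛ k h).left i) ⊗ₜ[k] t) =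
        ∑ j ∈ (ℛ k ((ℛ k h).right i)).index, sweedlerParam γ
          (g * ((ℛ k h).left i * antipode k ((ℛ k ((ℛ k h).right i)).left j)))
          ((ℛ k ((ℛ k h).right i)).right j) := by
      intro i _
      rw [adAct_tmul]
      simp only [hγ, mul_assoc]
    rw [Finset.sum_congr rfl e]
    refine Eq.trans ?_ this
    simp only [LinearMap.compr₂_apply, LinearMap.compl₂_apply, LinearMap.comp_apply,
      LinearMap.mul_apply', LinearMap.mulLeft_apply]
    simp only [← LinearMap.sum_apply, ← map_sum, ← Finset.mul_sum, sum_mul_antipode_eq_smul]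
    simp only [mul_smul_comm, mul_one, map_smul, LinearMap.smul_apply]
    simp only [← map_smul, ← map_sum, sum_counit_smul]
  rw [← hγ, h1, h2, ← Finset.sum_sub_distrib]
  refine Submodule.sum_mem _ fun i _ => ?_
  rw [← neg_sub]
  exact Submodule.neg_mem _ (Submodule.subset_span ⟨_, _, rfl⟩)

theorem coinvRel_le (n : ℕ) (p : Submodule k (H ⊗[k] ⨂[k]^n A))
    (hp : ∀ (g h : H) (t : ⨂[k]^n A), (g * h) ⊗ₜ[k] t - ∑ i ∈ (ℛ k h).index,
      ((ℛ k h).right i * g) ⊗ₜ[k] diagAct k H A n ((ℛ k h).left i) t ∈ p) :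
    coinvRel k H A n ≤ p := by
  refine Submodule.span_le.2 ?_
  rintro _ ⟨h, x, rfl⟩
  induction x using TensorProduct.induction_on with
  | zero => simp only [map_zero, smul_zero, sub_zero]; exact p.zero_mem
  | add x y hx hy =>
    have := p.add_mem hx hy
    rwa [sub_add_sub_comm, ← map_add, ← smul_add] at this
  | tmul g t =>
    have e : ∑ i ∈ (ℛ k h).index, ((g * antipode k ((ℛ k h).left i)) * (ℛ k h).right i) ⊗ₜ[k] t =
        counit (R := k) h • (g ⊗ₜ[k] t) := by
      simp only [mul_assoc]
      rw [← TensorProduct.sum_tmul, ← Finset.mul_sum, sum_antipode_mul_eq_smul, mul_smul_comm,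
        mul_one, TensorProduct.smul_tmul']
    rw [SetLike.mem_coe, adAct_tmul, ← e, ← Finset.sum_sub_distrib]
    refine p.sum_mem fun i _ => ?_
    have := p.neg_mem (hp (g * antipode k ((ℛ k h).left i)) ((ℛ k h).right i) t)
    rwa [neg_sub] at this

/-- The inverse of the antipode. -/
def antipodeInv (hS : Function.Bijective (antipode k (A := H))) : H →ₗ[k] H :=
  (LinearEquiv.ofBijective (antipode k (A := H)) hS).symm.toLinearMap

variable (hS : Function.Bijective (antipode k (A := H)))

variable (A) in
/-- `(g | a_0, …, a_n) ↦ (g_{(1)} | S⁻¹(g_{(0)}) · a_n, a_0, …, a_{n-1})`. -/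
def twist (n : ℕ) : (H ⊗[k] ⨂[k]^(n + 1) A) →ₗ[k] H ⊗[k] ⨂[k]^(n + 1) A :=
  let E : H →ₗ[k] Module.End k (⨂[k]^(n + 1) A) :=
    LinearMap.mulRight k (rotate k (n + 1) : Module.End k (⨂[k]^(n + 1) A)) ∘ₗ
      firstAct k H A n ∘ₗ antipodeInv hS
  TensorProduct.lift (sweedler
    ((LinearMap.llcomp k (⨂[k]^(n + 1) A) (⨂[k]^(n + 1) A) (H ⊗[k] ⨂[k]^(n + 1) A) ∘ₗ
      TensorProduct.mk k H (⨂[k]^(n + 1) A)).compl₂ E).flip)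

theorem twist_tmul (n : ℕ) (g : H) (t : ⨂[k]^(n + 1) A) : twist A hS n (g ⊗ₜ t) =
    ∑ i ∈ (ℛ k g).index, (ℛ k g).right i ⊗ₜ[k]
      firstAct k H A n (antipodeInv hS ((ℛ k g).left i)) (rotate k (n + 1) t) := by
  rw [twist, TensorProduct.lift.tmul, sweedler_apply, LinearMap.sum_apply]
  rfl

theorem antipode_antipodeInv (h : H) : antipode k (antipodeInv hS h) = h :=
  (LinearEquiv.ofBijective (antipode k (A := H)) hS).apply_symm_apply h

theorem antipodeInv_mul (g h : H) :
    antipodeInv hS (g * h) = antipodeInv hS h * antipodeInv hS g := by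
  apply hS.1
  rw [antipode_mul_antidistrib, antipode_antipodeInv, antipode_antipodeInv, antipode_antipodeInv]

theorem sum_antipodeInv_right_mul (h : H) :
    ∑ i ∈ (ℛ k h).index, antipodeInv hS ((ℛ k h).right i) * (ℛ k h).left i =
      counit (R := k) h • 1 := by
  apply hS.1
  simp only [map_sum, antipode_mul_antidistrib, antipode_antipodeInv, map_smul, antipode_one,
    sum_antipode_mul_eq_smul]

theorem sum_right_mul_antipodeInv (h : H) :
    ∑ i ∈ (ℛ k h).index, (ℛ k h).right i * antipodeInv hS ((ℛ k h).left i) =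
      counit (R := k) h • 1 := by
  apply hS.1
  simp only [map_sum, antipode_mul_antidistrib, antipode_antipodeInv, map_smul, antipode_one,
    sum_mul_antipode_eq_smul]

theorem twist_snoc (n : ℕ) (g : H) (t : ⨂[k]^n A) (a : A) :
    twist A hS n (g ⊗ₜ snoc k n t a) = ∑ i ∈ (ℛ k g).index,
      (ℛ k g).right i ⊗ₜ[k] cons k n (antipodeInv hS ((ℛ k g).left i) • a) t := by
  simp only [twist_tmul, rotate_snoc, firstAct_cons]

theorem sweedler_mul {M : Type y} [AddCommMonoid M] [Module k M] (f : H →ₗ[k] H →ₗ[k] M)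
    (g h : H) : sweedler f (g * h) = ∑ i ∈ (ℛ k g).index, ∑ j ∈ (ℛ k h).index,
      f ((ℛ k g).left i * (ℛ k h).left j) ((ℛ k g).right i * (ℛ k h).right j) := by
  rw [sweedler, LinearMap.comp_apply, Bialgebra.comul_mul, ← (ℛ k g).eq, ← (ℛ k h).eq,
    Finset.sum_mul_sum]
  simp only [map_sum, Algebra.TensorProduct.tmul_mul_tmul, TensorProduct.lift.tmul]

theorem twist_aux_left (n : ℕ) (r h : H) (c : A) (t : ⨂[k]^n A) :
    ∑ j ∈ (ℛ k h).index, ∑ m ∈ (ℛ k ((ℛ k h).right j)).index,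
      ((ℛ k ((ℛ k h).right j)).right m * r) ⊗ₜ[k] diagAct k H A (n + 1)
        ((ℛ k ((ℛ k h).right j)).left m) (cons k n (antipodeInv hS ((ℛ k h).left j) • c) t) =
    ∑ j ∈ (ℛ k h).index,
      ((ℛ k h).right j * r) ⊗ₜ[k] cons k n c (diagAct k H A n ((ℛ k h).left j) t) := by
  let γ : A →ₗ[k] H →ₗ[k] H →ₗ[k] H ⊗[k] ⨂[k]^(n + 1) A :=
    ((cons k n).compl₂ ((diagAct k H A n).flip t)).compr₂
      (TensorProduct.mk k H (⨂[k]^(n + 1) A) ∘ₗ LinearMap.mulRight k r).flip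
  have hγ : ∀ b x v, γ b x v = (v * r) ⊗ₜ[k] cons k n b (diagAct k H A n x t) := fun _ _ _ => rfl
  have h1 : ∀ j ∈ (ℛ k h).index, ∑ m ∈ (ℛ k ((ℛ k h).right j)).index,
      ((ℛ k ((ℛ k h).right j)).right m * r) ⊗ₜ[k] diagAct k H A (n + 1)
        ((ℛ k ((ℛ k h).right j)).left m) (cons k n (antipodeInv hS ((ℛ k h).left j) • c) t) =
      ∑ m ∈ (ℛ k ((ℛ k h).right j)).index, sweedlerParam γ
        (((ℛ k ((ℛ k h).right j)).left m * antipodeInv hS ((ℛ k h).left j)) • c)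
        ((ℛ k ((ℛ k h).right j)).right m) := by
    intro j _
    have := sweedler_coassoc
      (γ ∘ₗ (actMap k H A).flip (antipodeInv hS ((ℛ k h).left j) • c)) ((ℛ k h).right j)
    simp only [sweedlerParam_apply, diagAct_cons, TensorProduct.tmul_sum, mul_smul]
    exact this
  rw [Finset.sum_congr rfl h1]
  refine (sweedler_coassoc (((LinearMap.mul k H).flip ∘ₗ antipodeInv hS).compr₂
    (sweedlerParam γ ∘ₗ (actMap k H A).flip c)) h).symm.trans ?_
  simp only [LinearMap.compr₂_apply, LinearMap.comp_apply, LinearMap.flip_apply,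
    LinearMap.mul_apply']
  simp only [← LinearMap.sum_apply, ← map_sum, sum_right_mul_antipodeInv]
  simp only [map_smul, LinearMap.smul_apply, ← hγ]
  rw [← sweedlerParam_apply]
  simp only [← map_smul, ← map_sum, sum_counit_smul]
  congr 1
  exact congrArg _ (one_smul H c)

theorem twist_aux_right (n : ℕ) (r h d : H) (a : A) (t : ⨂[k]^n A) :
    ∑ j ∈ (ℛ k h).index, ∑ m ∈ (ℛ k ((ℛ k h).left j)).index,
      ∑ p ∈ (ℛ k ((ℛ k h).right j)).index,
        ((ℛ k ((ℛ k h).right j)).right p * r) ⊗ₜ[k] cons k n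
          (d • (antipodeInv hS ((ℛ k ((ℛ k h).right j)).left p) *
            (ℛ k ((ℛ k h).left j)).right m) • a)
          (diagAct k H A n ((ℛ k ((ℛ k h).left j)).left m) t) =
    ∑ j ∈ (ℛ k h).index,
      ((ℛ k h).right j * r) ⊗ₜ[k] cons k n (d • a) (diagAct k H A n ((ℛ k h).left j) t) := by
  let γ : A →ₗ[k] H →ₗ[k] H →ₗ[k] H ⊗[k] ⨂[k]^(n + 1) A :=
    ((cons k n).compl₂ ((diagAct k H A n).flip t)).compr₂
      (TensorProduct.mk k H (⨂[k]^(n + 1) A) ∘ₗ LinearMap.mulRight k r).flip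
  let μ : H →ₗ[k] H →ₗ[k] H →ₗ[k] H ⊗[k] H :=
    ((LinearMap.mul k H).flip.compl₂ (antipodeInv hS)).compr₂ (TensorProduct.mk k H H)
  let G : H →ₗ[k] (H ⊗[k] H) →ₗ[k] H ⊗[k] ⨂[k]^(n + 1) A :=
    TensorProduct.uncurry (.id k) H H _ ∘ₗ (γ ∘ₗ actMap k H A d ∘ₗ (actMap k H A).flip a).flip
  have hG : ∀ x e v, G x (e ⊗ₜ v) =
      (v * r) ⊗ₜ[k] cons k n (d • e • a) (diagAct k H A n x t) := fun _ _ _ => rfl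
  have hμ : ∀ u : H, ∑ m ∈ (ℛ k u).index,
      sweedlerParam μ ((ℛ k u).left m) ((ℛ k u).right m) = 1 ⊗ₜ[k] u := by
    intro u
    simp only [sweedlerParam_apply]
    rw [← sweedler_coassoc μ u]
    simp only [μ, LinearMap.compr₂_apply, LinearMap.compl₂_apply, LinearMap.flip_apply,
      LinearMap.mul_apply', TensorProduct.mk_apply]
    simp only [← TensorProduct.sum_tmul, sum_antipodeInv_right_mul, TensorProduct.smul_tmul,
      ← TensorProduct.tmul_sum, sum_counit_smul]
  have := sweedler_coassoc (LinearMap.lcomp k _ (sweedlerParam μ) ∘ₗ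
    LinearMap.llcomp k H (H ⊗[k] H) (H ⊗[k] ⨂[k]^(n + 1) A) ∘ₗ G) h
  simp only [LinearMap.comp_apply, LinearMap.lcomp_apply, LinearMap.llcomp_apply] at this
  simp only [← map_sum, hμ] at this
  simp only [hG, one_smul, map_sum, sweedlerParam_apply] at this
  exact this

theorem coinvRel_le_twist (n : ℕ) :
    coinvRel k H A (n + 1) ≤ (coinvRel k H A (n + 1)).comap (twist A hS n) := by
  refine coinvRel_le _ _ fun g h t => ?_
  let q := (coinvRel k H A (n + 1)).mkQ
  have hq : ∀ (r s : H) (z : ⨂[k]^(n + 1) A), q ((r * s) ⊗ₜ z) = ∑ i ∈ (ℛ k s).index,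
      q (((ℛ k s).right i * r) ⊗ₜ[k] diagAct k H A (n + 1) ((ℛ k s).left i) z) := by
    intro r s z
    rw [← map_sum]
    exact (Submodule.Quotient.eq _).2 (coinvRel_swap (n + 1) r s z)
  have tw : ∀ (x : H) (t : ⨂[k]^n A) (a : A), twist A hS n (x ⊗ₜ snoc k n t a) =
      sweedler ((TensorProduct.mk k H (⨂[k]^(n + 1) A)).flip ∘ₗ (cons k n).flip t ∘ₗ
        (actMap k H A).flip a ∘ₗ antipodeInv hS) x := by
    intro x t a
    rw [twist_snoc, sweedler_apply]
    rfl
  suffices e : q ∘ₗ twist A hS n ∘ₗ TensorProduct.mk k H (⨂[k]^(n + 1) A) (g * h) =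
      ∑ i ∈ (ℛ k h).index, q ∘ₗ twist A hS n ∘ₗ
        TensorProduct.mk k H (⨂[k]^(n + 1) A) ((ℛ k h).right i * g) ∘ₗ
          diagAct k H A (n + 1) ((ℛ k h).left i) by
    have := LinearMap.congr_fun e t
    rw [LinearMap.sum_apply] at this
    rw [Submodule.mem_comap, ← Submodule.Quotient.mk_eq_zero]
    change q (twist A hS n _) = 0
    rw [map_sub, map_sub, map_sum, map_sum, sub_eq_zero]
    exact this
  refine snoc_ext fun t a => ?_
  have left : q (twist A hS n ((g * h) ⊗ₜ snoc k n t a)) = ∑ i ∈ (ℛ k g).index,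
      ∑ j ∈ (ℛ k h).index, q (((ℛ k h).right j * (ℛ k g).right i) ⊗ₜ[k]
        cons k n (antipodeInv hS ((ℛ k g).left i) • a) (diagAct k H A n ((ℛ k h).left j) t)) := by
    rw [tw, sweedler_mul, map_sum]
    refine Finset.sum_congr rfl fun i _ => ?_
    rw [← map_sum q, ← twist_aux_left hS, map_sum, map_sum]
    refine Finset.sum_congr rfl fun j _ => ?_
    rw [map_sum, ← hq, ← mul_smul, ← antipodeInv_mul]
    rfl
  have right : ∑ j ∈ (ℛ k h).index, q (twist A hS n (((ℛ k h).right j * g) ⊗ₜ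
      diagAct k H A (n + 1) ((ℛ k h).left j) (snoc k n t a))) = ∑ i ∈ (ℛ k g).index,
      ∑ j ∈ (ℛ k h).index, q (((ℛ k h).right j * (ℛ k g).right i) ⊗ₜ[k]
        cons k n (antipodeInv hS ((ℛ k g).left i) • a) (diagAct k H A n ((ℛ k h).left j) t)) := by
    have e : ∀ j ∈ (ℛ k h).index, q (twist A hS n (((ℛ k h).right j * g) ⊗ₜ
        diagAct k H A (n + 1) ((ℛ k h).left j) (snoc k n t a))) =
        ∑ i ∈ (ℛ k g).index, q (∑ m ∈ (ℛ k ((ℛ k h).left j)).index,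
          ∑ p ∈ (ℛ k ((ℛ k h).right j)).index,
          ((ℛ k ((ℛ k h).right j)).right p * (ℛ k g).right i) ⊗ₜ[k] cons k n
            (antipodeInv hS ((ℛ k g).left i) • (antipodeInv hS ((ℛ k ((ℛ k h).right j)).left p) *
              (ℛ k ((ℛ k h).left j)).right m) • a)
            (diagAct k H A n ((ℛ k ((ℛ k h).left j)).left m) t)) := by
      intro j _
      rw [← map_sum q, Finset.sum_comm, diagAct_snoc, TensorProduct.tmul_sum, map_sum]
      congr 1
      refine Finset.sum_congr rfl fun m _ => ?_
      rw [tw, sweedler_mul, Finset.sum_comm]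
      refine Finset.sum_congr rfl fun i _ => Finset.sum_congr rfl fun p _ => ?_
      rw [← mul_smul, ← mul_assoc, ← antipodeInv_mul, mul_smul]
      rfl
    rw [Finset.sum_congr rfl e, Finset.sum_comm]
    refine Finset.sum_congr rfl fun i _ => ?_
    rw [← map_sum q, ← map_sum q, twist_aux_right]
  rw [LinearMap.sum_apply]
  exact left.trans right.symm

theorem coinvRel_le_lTensor (m n : ℕ) (f : (⨂[k]^m A) →ₗ[k] ⨂[k]^n A)
    (hf : ∀ h t, f (diagAct k H A m h t) = diagAct k H A n h (f t)) :
    coinvRel k H A m ≤ (coinvRel k H A n).comap (f.lTensor H) := by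
  refine coinvRel_le _ _ fun g h t => ?_
  rw [Submodule.mem_comap, map_sub, map_sum]
  simp only [LinearMap.lTensor_tmul, hf]
  exact coinvRel_swap n g h (f t)

variable (k A)

/-- `C^H_n(A)`: the coinvariants of `H` acting on `H ⊗ A^{⊗(n+1)}`, i.e. the quotient by the span of
all `h · x - ε(h) x`. -/
abbrev EquivariantChains (n : ℕ) : Type (max v (max u w)) :=
  (H ⊗[k] ⨂[k]^(n + 1) A) ⧸ coinvRel k H A (n + 1)

variable [HModuleAlgebra k H A]

/-- The faces `∂_i (g | a_0, …, a_n) = (g | a_0, …, a_i a_{i+1}, …, a_n)` for `i < n` and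
`∂_n (g | a_0, …, a_n) = (g_{(1)} | (S⁻¹(g_{(0)}) · a_n) a_0, a_1, …, a_{n-1})`; the index `n`
below is `n - 1` here. -/
def equivariantFace (n : ℕ) :
    Fin (n + 2) → EquivariantChains k (H := H) A (n + 1) →ₗ[k] EquivariantChains k (H := H) A n :=
  Fin.lastCases
    (motive := fun _ =>
      EquivariantChains k (H := H) A (n + 1) →ₗ[k] EquivariantChains k (H := H) A n)
    (Submodule.mapQ _ _ ((mulFace k 0).lTensor H ∘ₗ twist A hS (n + 1))
      ((coinvRel_le_twist hS (n + 1)).trans (Submodule.comap_mono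
        (coinvRel_le_lTensor _ _ (mulFace k 0) fun h t => diagAct_mulFace 0 h t))))
    (fun i => Submodule.mapQ _ _ ((mulFace k i).lTensor H)
      (coinvRel_le_lTensor _ _ _ fun h t => diagAct_mulFace i h t))

/-- The cyclic module `C^H_•(A)` of equivariant chains, with
`σ_i (g | a_0, …, a_n) = (g | a_0, …, a_i, 1, a_{i+1}, …, a_n)` and
`τ_n (g | a_0, …, a_n) = (g_{(1)} | S⁻¹(g_{(0)}) · a_n, a_0, …, a_{n-1})`. -/
def equivariantCyclic : CyclicData.{u, max v (max u w)} k where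
  X n := EquivariantChains k (H := H) A n
  face n := equivariantFace k A hS n
  degen _ i := Submodule.mapQ _ _ ((insertOne k i.succ).lTensor H)
    (coinvRel_le_lTensor _ _ _ fun h t => diagAct_insertOne i.succ h t)
  cyc n := Submodule.mapQ _ _ (twist A hS n) (coinvRel_le_twist hS n)

variable {k A} {A' : Type w} [Ring A'] [Algebra k A'] [Module H A'] [IsScalarTower k H A']

theorem powMap_snoc (n : ℕ) (f : A →ₗ[k] A') (t : ⨂[k]^n A) (a : A) :
    powMap (n + 1) f (snoc k n t a) = snoc k n (powMap n f t) (f a) := by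
  suffices h : powMap (n + 1) f ∘ₗ (snoc k n).flip a = (snoc k n).flip (f a) ∘ₗ powMap n f from
    LinearMap.congr_fun h t
  refine PiTensorProduct.ext (MultilinearMap.ext fun x => ?_)
  simp only [LinearMap.compMultilinearMap_apply, LinearMap.comp_apply, LinearMap.flip_apply,
    snoc_tprod, PiTensorProduct.map_tprod]
  congr 1
  funext i
  refine Fin.lastCases ?_ (fun i => ?_) i
  · simp only [Fin.snoc_last]
  · simp only [Fin.snoc_castSucc]

theorem powMap_cons (n : ℕ) (f : A →ₗ[k] A') (t : ⨂[k]^n A) (a : A) :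
    powMap (n + 1) f (cons k n a t) = cons k n (f a) (powMap n f t) := by
  rw [← rotate_snoc, powMap_rotate, powMap_snoc, rotate_snoc]

theorem powMap_diagAct (f : A →ₐ[k] A') (hf : ∀ (h : H) (a : A), f (h • a) = h • f a) (n : ℕ)
    (h : H) (t : ⨂[k]^n A) : powMap n f.toLinearMap (diagAct k H A n h t) =
      diagAct k H A' n h (powMap n f.toLinearMap t) := by
  induction n generalizing h with
  | zero => rw [diagAct_zero, diagAct_zero, map_smul]
  | succ n ih =>
    suffices e : powMap (n + 1) f.toLinearMap ∘ₗ diagAct k H A (n + 1) h =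
        diagAct k H A' (n + 1) h ∘ₗ powMap (n + 1) f.toLinearMap from LinearMap.congr_fun e t
    refine snoc_ext fun t a => ?_
    simp only [LinearMap.comp_apply, diagAct_snoc, map_sum, powMap_snoc, ih,
      AlgHom.toLinearMap_apply, hf]

theorem powMap_twist (f : A →ₐ[k] A') (hf : ∀ (h : H) (a : A), f (h • a) = h • f a) (n : ℕ)
    (z : H ⊗[k] ⨂[k]^(n + 1) A) :
    (powMap (n + 1) f.toLinearMap).lTensor H (twist A hS n z) =
      twist A' hS n ((powMap (n + 1) f.toLinearMap).lTensor H z) := by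
  induction z using TensorProduct.induction_on with
  | zero => simp only [map_zero]
  | add x y hx hy => simp only [map_add, hx, hy]
  | tmul g t =>
    suffices e : (powMap (n + 1) f.toLinearMap).lTensor H ∘ₗ twist A hS n ∘ₗ
        TensorProduct.mk k H (⨂[k]^(n + 1) A) g = twist A' hS n ∘ₗ
          TensorProduct.mk k H (⨂[k]^(n + 1) A') g ∘ₗ powMap (n + 1) f.toLinearMap from
      LinearMap.congr_fun e t
    refine snoc_ext fun t a => ?_
    simp only [LinearMap.comp_apply, TensorProduct.mk_apply, powMap_snoc, twist_snoc, map_sum,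
      LinearMap.lTensor_tmul, powMap_cons, AlgHom.toLinearMap_apply, hf]

theorem coinvRel_le_powMap (f : A →ₐ[k] A') (hf : ∀ (h : H) (a : A), f (h • a) = h • f a) (n : ℕ) :
    coinvRel k H A n ≤ (coinvRel k H A' n).comap ((powMap n f.toLinearMap).lTensor H) := by
  refine coinvRel_le _ _ fun g h t => ?_
  rw [Submodule.mem_comap, map_sub, map_sum]
  simp only [LinearMap.lTensor_tmul, powMap_diagAct f hf]
  exact coinvRel_swap n g h _

variable [HModuleAlgebra k H A']

/-- The morphism `C^H_•(A) → C^H_•(A')` induced by a morphism `A → A'` of `H`-module algebras. -/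
def equivariantCyclicMap (f : A →ₐ[k] A') (hf : ∀ (h : H) (a : A), f (h • a) = h • f a) :
    (equivariantCyclic k A hS).Hom (equivariantCyclic k A' hS) where
  app n := Submodule.mapQ _ _ ((powMap (n + 1) f.toLinearMap).lTensor H)
    (coinvRel_le_powMap f hf (n + 1))
  app_face n i c := by
    have key : ∀ (j : Fin (n + 1)) (z : H ⊗[k] ⨂[k]^(n + 2) A),
        (powMap (n + 1) f.toLinearMap).lTensor H ((mulFace k j).lTensor H z) =
          (mulFace k j).lTensor H ((powMap (n + 2) f.toLinearMap).lTensor H z) := by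
      intro j z
      rw [← LinearMap.lTensor_comp_apply, ← LinearMap.lTensor_comp_apply]
      congr 2
      exact LinearMap.ext fun t => powMap_mulFace f j t
    obtain ⟨z, rfl⟩ := Submodule.mkQ_surjective _ c
    refine Fin.lastCases ?_ (fun i => ?_) i
    · simp only [equivariantCyclic, equivariantFace, Fin.lastCases_last]
      refine congrArg (Submodule.mkQ _) ?_
      change (powMap (n + 1) f.toLinearMap).lTensor H
        ((mulFace k 0).lTensor H (twist A hS (n + 1) z)) =
        (mulFace k 0).lTensor H (twist A' hS (n + 1) _)
      rw [key, powMap_twist hS f hf]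
    · simp only [equivariantCyclic, equivariantFace, Fin.lastCases_castSucc]
      exact congrArg (Submodule.mkQ _) (key i z)
  app_degen n i c := by
    obtain ⟨z, rfl⟩ := Submodule.mkQ_surjective _ c
    refine congrArg (Submodule.mkQ _) ?_
    rw [← LinearMap.lTensor_comp_apply, ← LinearMap.lTensor_comp_apply]
    congr 2
    exact LinearMap.ext fun t => powMap_insertOne f i.succ t
  app_cyc n c := by
    obtain ⟨z, rfl⟩ := Submodule.mkQ_surjective _ c
    exact congrArg (Submodule.mkQ _) (powMap_twist hS f hf n z)

end EquivariantChains

/-! ### Hopf homology -/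

section HopfHomology

open Coalgebra

variable (k : Type u) [CommRing k] (H : Type v) [Ring H] [Bialgebra k H]

/-- `(g_1, …, g_{p+1}) ↦ ε(g_1) (g_2, …, g_{p+1})`. -/
def counitFirst (p : ℕ) : (⨂[k]^(p + 1) H) →ₗ[k] ⨂[k]^p H :=
  PiTensorProduct.lift (LinearMap.uncurryLeft
    ((LinearMap.lsmul k (MultilinearMap k (fun _ : Fin p => H) (⨂[k]^p H))).flip
      (PiTensorProduct.tprod k) ∘ₗ counit))

variable (M : Type y) [AddCommGroup M] [Module k M] [Module H M] [IsScalarTower k H M]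

/-- `(g_1, …, g_{p+1} | m) ↦ (g_1, …, g_p | g_{p+1} · m)`. -/
def actLast (p : ℕ) : ((⨂[k]^(p + 1) H) ⊗[k] M) →ₗ[k] (⨂[k]^p H) ⊗[k] M :=
  TensorProduct.lift (PiTensorProduct.lift (MultilinearMap.uncurryRight
    (((LinearMap.llcomp k M M ((⨂[k]^p H) ⊗[k] M) ∘ₗ TensorProduct.mk k (⨂[k]^p H) M).compl₂
      (actMap k H M)).compMultilinearMap (PiTensorProduct.tprod k))))

theorem counitFirst_tprod (p : ℕ) (g : Fin (p + 1) → H) :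
    counitFirst k H p (PiTensorProduct.tprod k g) =
      counit (R := k) (g 0) • PiTensorProduct.tprod k (Fin.tail g) :=
  PiTensorProduct.lift.tprod _

theorem actLast_tprod_tmul (p : ℕ) (g : Fin (p + 1) → H) (m : M) :
    actLast k H M p (PiTensorProduct.tprod k g ⊗ₜ m) =
      PiTensorProduct.tprod k (Fin.init g) ⊗ₜ[k] (g (Fin.last p) • m) := by
  rw [actLast, TensorProduct.lift.tmul, PiTensorProduct.lift.tprod]
  rfl

/-- The boundary `δ : C_{p+1}(H, M) → C_p(H, M)` of the complex `C_p(H, M) = H^{⊗p} ⊗ M`: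
`δ (g_1, …, g_{p+1} | m) = ε(g_1) (g_2, …, g_{p+1} | m) +
∑_{i=1}^{p} (-1)^i (g_1, …, g_i g_{i+1}, …, g_{p+1} | m) + (-1)^{p+1} (g_1, …, g_p | g_{p+1} · m)`;
the summation index below is `i - 1`. The homology of this complex is the Hopf homology
`H_•(H, M)`. -/
def hopfBoundary (p : ℕ) : ((⨂[k]^(p + 1) H) ⊗[k] M) →ₗ[k] (⨂[k]^p H) ⊗[k] M :=
  (counitFirst k H p).rTensor M +
    ∑ i : Fin p, (-1 : k) ^ ((i : ℕ) + 1) • (mulFace k i).rTensor M +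
    (-1 : k) ^ (p + 1) • actLast k H M p

end HopfHomology

end HopfCyclic

end

/-! Semisimplicity enters through a single element. The augmentation ideal ker ε has a complementary
left ideal, and the component l of 1 in it satisfies ε(l) = 1 and h l = ε(h) l. Semisimple rings are
semiprime, which forces l h = ε(h) l as well (`exists_integral`). Then ∑ l_(0) ⊗ S(l_(1)) is a
separability idempotent ∑ x ⊗ y of H: ∑ x y = 1 and ∑ h x ⊗ y = ∑ x ⊗ y h (`exists_separability`).

Antipode. Separability makes H finite-dimensional, so injectivity of S suffices. Its kernel is a
two-sided ideal, generated by a central idempotent e, and (1 ⊗ e) Δ(l) = (S(e) ⊗ 1) Δ(l) = 0 gives e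
= 0.

Hopf homology. The boundary has the form δ(g, z) = ε(g) z - g·z for a left action of H on H^{⊗p} ⊗
M. The integral satisfies l·z = (l, δ z) in positive degrees, so prepending l is a contracting
homotopy there (`hopfBoundary_exact`).

Cyclic modules. Put R = A ⋊ H. The map `collect` moves all elements of H to the right. It models the
passage from R^{⊗n} to the tensor power of R over H, which is H ⊗ A^{⊗n}. Taking coinvariants
identifies right multiplication by h with its left action, that is, it closes the tensor power over
H into a circle. So C^H(A) is the cyclic module of R relative to the subalgebra H, and `collectHom`
is the surjection F from the absolute to the relative one. The cyclic identities of C^H(A) are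
inherited from C(R) along it.

Separability of H means that nothing is lost. Inserting ∑ x ⊗ y into all gaps of a chain gives an
operator T (`splitAll`), and P, the last face of T (`splitProj`), satisfies F P = F and vanishes on
ker F. Inserting it only into initial gaps gives a homotopy h with bh + hb = 1 - P
(`hochschild_splitHomotopy`). Hence (1 - P)h contracts ker F for the Hochschild boundary b.

Coefficients. Let now h be that contraction and D = b + uB. On ker F one has Dh + hD = 1 + u(Bh +
hB). This is invertible because X[[u]]_n is a product, and h(1 + u(Bh + hB))⁻¹ contracts ker F for
D. This operator is k[u]-linear and F splits degreewise over k, so the argument survives tensoring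
with any W (`IsKernelContraction.HCMap_bijective`). The isomorphism is induced by F, which is
natural in A. -/

noncomputable section
namespace HopfCyclic

/-! ### Ideals of semisimple rings. -/

section SemisimpleRing

variable {R : Type v} [Ring R] [IsSemisimpleRing R]

/-- A left ideal of a semisimple ring is generated by an idempotent. -/
theorem exists_right_identity (I : Submodule R R) : ∃ e ∈ I, ∀ r ∈ I, r * e = r := by
  obtain ⟨J, hJ⟩ := exists_isCompl I
  obtain ⟨e, he, f, hf, hef⟩ := Submodule.mem_sup.1
    (hJ.sup_eq_top ▸ Submodule.mem_top : (1 : R) ∈ I ⊔ J)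
  refine ⟨e, he, fun r hr => ?_⟩
  have h1 : r * e + r * f = r := by rw [← mul_add, hef, mul_one]
  -- For r in I the element rf = r - re lies both in I and in J, so it vanishes.
  have h2 : r * f = r - r * e := eq_sub_of_add_eq' h1
  have h3 : r * f ∈ I ⊓ J :=
    ⟨h2 ▸ I.sub_mem hr (I.smul_mem r he), J.smul_mem r hf⟩
  rw [hJ.inf_eq_bot, Submodule.mem_bot] at h3
  rwa [h3, add_zero] at h1

/-- Semisimple rings are semiprime. -/
theorem eq_zero_of_mul_mul_eq_zero (r : R) (h : ∀ a, r * a * r = 0) : r = 0 := by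
  -- Writing the right identity of the left ideal generated by r as e = a r gives r = r e = r a r.
  obtain ⟨e, he, h'⟩ := exists_right_identity (Submodule.span R {r})
  obtain ⟨a, rfl⟩ := Submodule.mem_span_singleton.1 he
  rw [← h' r (Submodule.mem_span_singleton_self r), smul_eq_mul, ← mul_assoc, h]

/-- A two-sided ideal of a semisimple ring is generated by a central idempotent. -/
theorem exists_central_identity (I : Submodule R R) (hI : ∀ a ∈ I, ∀ r, a * r ∈ I) :
    ∃ e ∈ I, (∀ r, e * r = r * e) ∧ ∀ r ∈ I, r * e = r := by
  obtain ⟨e, he, h⟩ := exists_right_identity I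
  refine ⟨e, he, fun a => ?_, h⟩
  have h1 : ∀ b, e * b * e = e * b := fun b => h _ (hI e he b)
  have h2 : a * e - e * (a * e) = 0 := by
    refine eq_zero_of_mul_mul_eq_zero _ fun b => ?_
    have : ∀ c, e * (c - e * c) = 0 := fun c => by
      rw [mul_sub, ← mul_assoc, h e he, sub_self]
    have h3 : a * e - e * (a * e) = (a - e * a) * e := by noncomm_ring
    -- With d = (a - ea)e, the product d b d contains e b (a - ea) = e b e (a - ea), and e(a - ea) =
    -- 0.
    rw [h3, mul_assoc _ e b, ← h1 b, mul_assoc (a - e * a), mul_assoc (e * b), ← mul_assoc e,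
      this, zero_mul, mul_zero, mul_zero]
  rw [← h1 a, mul_assoc, ← sub_eq_zero.1 h2]

end SemisimpleRing

/-! ### Integrals, separability, and bijectivity of the antipode. -/

section Integrals

open Coalgebra HopfAlgebra

variable {k : Type u} [Field k] {H : Type v} [Ring H]

/-- A left ideal J complementary to ker ε is one-dimensional in effect: hl - ε(h)l lies in J and in
ker ε, hence is zero. The right-hand identity then follows from semiprimeness. -/
theorem exists_integral (k : Type u) [Field k] (H : Type v) [Ring H] [Bialgebra k H]
    [IsSemisimpleRing H] : ∃ l : H, counit (R := k) l = 1 ∧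
      (∀ h, h * l = counit (R := k) h • l) ∧ ∀ h, l * h = counit (R := k) h • l := by
  let I : Submodule H H := RingHom.ker (Bialgebra.counitAlgHom k H)
  have hI : ∀ a : H, a ∈ I ↔ counit (R := k) a = 0 := fun a => RingHom.mem_ker
  obtain ⟨J, hJ⟩ := exists_isCompl I
  obtain ⟨e, he, l, hl, hel⟩ := Submodule.mem_sup.1
    (hJ.sup_eq_top ▸ Submodule.mem_top : (1 : H) ∈ I ⊔ J)
  have h1 : counit (R := k) l = 1 := by
    have := congrArg (counit (R := k)) hel
    rwa [map_add, (hI e).1 he, zero_add, Bialgebra.counit_one] at this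
  have h2 : ∀ h, h * l = counit (R := k) h • l := by
    intro h
    have h3 : h * l - counit (R := k) h • l ∈ I ⊓ J := by
      refine ⟨(hI _).2 ?_, J.sub_mem (J.smul_mem h hl) ?_⟩
      · rw [map_sub, Bialgebra.counit_mul, map_smul, smul_eq_mul, sub_self]
      · rw [← one_mul l, ← smul_mul_assoc]
        exact J.smul_mem _ hl
    rw [hJ.inf_eq_bot, Submodule.mem_bot] at h3
    exact sub_eq_zero.1 h3
  refine ⟨l, h1, h2, fun h => ?_⟩
  have h4 : l * (h - counit (R := k) h • 1) = 0 := by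
    -- For r = l(h - ε(h)) the product r a r contains (h - ε(h)) a l, which is 0 because l is a left
    -- integral.
    refine eq_zero_of_mul_mul_eq_zero _ fun a => ?_
    have : (h - counit (R := k) h • (1 : H)) * a * l = 0 := by
      rw [h2, Bialgebra.counit_mul, map_sub, map_smul, Bialgebra.counit_one, smul_eq_mul, mul_one,
        sub_self, zero_mul, zero_smul]
    rw [mul_assoc, mul_assoc, ← mul_assoc a, ← mul_assoc _ (a * l), ← mul_assoc _ a, this, zero_mul,
      mul_zero]
  rw [mul_sub, mul_smul_comm, mul_one] at h4
  exact sub_eq_zero.1 h4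

variable [HopfAlgebra k H]

/-- 1 ⊗ h = ∑ S(h_(0)) h_(1) ⊗ h_(2) = ∑ (S(h_(0)) ⊗ 1) Δ(h_(1)), and Δ(h_(1)) Δ(l) = Δ(h_(1) l) =
ε(h_(1)) Δ(l). -/
theorem integral_tmul_mul {l : H} (hl : ∀ h, h * l = counit (R := k) h • l) (h : H) :
    (1 : H) ⊗ₜ[k] h * comul l = antipode k h ⊗ₜ[k] (1 : H) * comul l := by
  have := sweedler_coassoc ((LinearMap.mul k H ∘ₗ antipode k).compr₂ (TensorProduct.mk k H H)) h
  simp only [LinearMap.compr₂_apply, LinearMap.comp_apply, LinearMap.mul_apply',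
    TensorProduct.mk_apply] at this
  simp only [← TensorProduct.sum_tmul, sum_antipode_mul_eq_smul, TensorProduct.smul_tmul,
    ← TensorProduct.tmul_sum, sum_counit_smul] at this
  rw [this, Finset.sum_mul]
  conv_rhs => rw [← sum_smul_counit (k := k) h]
  rw [map_sum, TensorProduct.sum_tmul, Finset.sum_mul]
  refine Finset.sum_congr rfl fun i _ => ?_
  have e : ∑ j ∈ (ℛ k ((ℛ k h).right i)).index,
      (antipode k ((ℛ k h).left i) * (ℛ k ((ℛ k h).right i)).left j) ⊗ₜ[k]
        (ℛ k ((ℛ k h).right i)).right j =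
      antipode k ((ℛ k h).left i) ⊗ₜ[k] (1 : H) * comul ((ℛ k h).right i) := by
    conv_rhs => rw [← (ℛ k ((ℛ k h).right i)).eq]
    rw [Finset.mul_sum]
    simp only [Algebra.TensorProduct.tmul_mul_tmul, one_mul]
  rw [e, mul_assoc, ← Bialgebra.comul_mul, hl, map_smul, mul_smul_comm, map_smul,
    ← TensorProduct.smul_tmul', smul_mul_assoc]

/-- The centrality half of separability. Insert S(h_(1)) h_(2) after S(l_(1)): then ∑ h_(0) l_(0) ⊗
S(l_(1)) S(h_(1)) h_(2) is (id ⊗ S) Δ(h_(0) l) multiplied on the right by 1 ⊗ h_(1), and h_(0) l =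
ε(h_(0)) l. -/
theorem integral_mul_tmul {l : H} (hl : ∀ h, h * l = counit (R := k) h • l) (h : H) :
    ∑ i ∈ (ℛ k l).index, (h * (ℛ k l).left i) ⊗ₜ[k] antipode k ((ℛ k l).right i) =
      ∑ i ∈ (ℛ k l).index, (ℛ k l).left i ⊗ₜ[k] (antipode k ((ℛ k l).right i) * h) := by
  have key := congrArg (fun z => ∑ m ∈ (ℛ k l).index,
    TensorProduct.map (LinearMap.mulRight k ((ℛ k l).left m))
      (LinearMap.mulLeft k (antipode k ((ℛ k l).right m)) ∘ₗ LinearMap.mul' k H ∘ₗ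
        (antipode k).rTensor H) z)
    (sum_tmul_tmul_eq (ℛ k h) (fun i => ℛ k ((ℛ k h).left i)) (fun i => ℛ k ((ℛ k h).right i)))
  simp only [map_sum, TensorProduct.map_tmul, LinearMap.comp_apply,
    LinearMap.rTensor_tmul, LinearMap.mul'_apply, LinearMap.mulLeft_apply,
    LinearMap.mulRight_apply] at key
  -- One bracketing of the threefold coproduct of h collapses by S(h_(1)) h_(2) = ε; the other,
  -- `hleft`, by the integral property.
  have hr : ∀ m ∈ (ℛ k l).index, ∑ i ∈ (ℛ k h).index, ∑ j ∈ (ℛ k ((ℛ k h).right i)).index,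
      ((ℛ k h).left i * (ℛ k l).left m) ⊗ₜ[k] (antipode k ((ℛ k l).right m) *
        (antipode k ((ℛ k ((ℛ k h).right i)).left j) * (ℛ k ((ℛ k h).right i)).right j)) =
      (h * (ℛ k l).left m) ⊗ₜ[k] antipode k ((ℛ k l).right m) := by
    intro m _
    simp only [← TensorProduct.tmul_sum, ← Finset.mul_sum, sum_antipode_mul_eq_smul]
    simp only [mul_smul_comm, mul_one, ← TensorProduct.smul_tmul, ← TensorProduct.sum_tmul,
      ← smul_mul_assoc, ← Finset.sum_mul, sum_smul_counit]
  have hleft : ∀ i ∈ (ℛ k h).index, ∑ m ∈ (ℛ k l).index, ∑ j ∈ (ℛ k ((ℛ k h).left i)).index,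
      ((ℛ k ((ℛ k h).left i)).left j * (ℛ k l).left m) ⊗ₜ[k] (antipode k ((ℛ k l).right m) *
        (antipode k ((ℛ k ((ℛ k h).left i)).right j) * (ℛ k h).right i)) =
      ∑ m ∈ (ℛ k l).index, (ℛ k l).left m ⊗ₜ[k] (antipode k ((ℛ k l).right m) *
        (counit (R := k) ((ℛ k h).left i) • (ℛ k h).right i)) := by
    intro i _
    have := congrArg (TensorProduct.map LinearMap.id
      (LinearMap.mulRight k ((ℛ k h).right i) ∘ₗ antipode k))
      (Bialgebra.comul_mul (R := k) ((ℛ k h).left i) l)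
    rw [hl, map_smul, ← (ℛ k l).eq, ← (ℛ k ((ℛ k h).left i)).eq, Finset.sum_mul_sum] at this
    simp only [map_sum, map_smul, Algebra.TensorProduct.tmul_mul_tmul, TensorProduct.map_tmul,
      LinearMap.id_apply, LinearMap.comp_apply, LinearMap.mulRight_apply,
      antipode_mul_antidistrib, mul_assoc] at this
    rw [Finset.sum_comm, ← this, Finset.smul_sum]
    simp only [mul_smul_comm, TensorProduct.tmul_smul]
  rw [← Finset.sum_congr rfl hr, ← key, Finset.sum_comm, Finset.sum_congr rfl hleft,
    Finset.sum_comm]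
  simp only [← TensorProduct.tmul_sum, ← Finset.mul_sum, sum_counit_smul]

/-- A separability idempotent `∑ x ⊗ y` of a semisimple Hopf algebra. -/
theorem exists_separability (k : Type u) [Field k] (H : Type v) [Ring H] [HopfAlgebra k H]
    [IsSemisimpleRing H] : ∃ (ι : Type v) (s : Finset ι) (x y : ι → H),
      ∑ i ∈ s, x i * y i = 1 ∧
      ∀ h, ∑ i ∈ s, (h * x i) ⊗ₜ[k] y i = ∑ i ∈ s, x i ⊗ₜ[k] (y i * h) := by
  obtain ⟨l, h1, h2, -⟩ := exists_integral k H
  refine ⟨_, (ℛ k l).index, (ℛ k l).left, fun i => antipode k ((ℛ k l).right i), ?_, ?_⟩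
  · rw [sum_mul_antipode_eq_smul, h1, one_smul]
  · exact integral_mul_tmul h2

/-- Semisimple Hopf algebras are finite-dimensional. -/
theorem finite_of_semisimple (k : Type u) [Field k] (H : Type v) [Ring H] [HopfAlgebra k H]
    [IsSemisimpleRing H] : Module.Finite k H := by
  obtain ⟨ι, s, x, y, h1, h2⟩ := exists_separability k H
  let V : Submodule k H := Submodule.span k (y '' s)
  have : Module.Finite k V := Module.Finite.span_of_finite k (s.finite_toSet.image y)
  obtain ⟨p, hp⟩ := V.subtype.exists_leftInverse_of_injective (Submodule.ker_subtype V)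
  have hpy : ∀ i ∈ s, (p (y i) : H) = y i := fun i hi => congrArg Subtype.val
    (LinearMap.congr_fun hp ⟨y i, Submodule.subset_span ⟨i, hi, rfl⟩⟩)
  -- Apply m(1 ⊗ p) to ∑ h x ⊗ y = ∑ x ⊗ y h, where p projects onto the span V of the y. Since p
  -- fixes every y, the left side is h ∑ x y = h. Thus H is the sum of the finitely many
  -- finite-dimensional spaces x V.
  have h3 : ∀ h : H, ∑ i ∈ s, x i * (p (y i * h) : H) = h := by
    intro h
    have := congrArg (LinearMap.mul' k H ∘ₗ (V.subtype ∘ₗ p).lTensor H) (h2 h)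
    simp only [map_sum, LinearMap.comp_apply, LinearMap.lTensor_tmul, LinearMap.mul'_apply,
      Submodule.subtype_apply] at this
    rw [← this]
    calc _ = ∑ i ∈ s, h * (x i * y i) := Finset.sum_congr rfl fun i hi => by
            rw [hpy i hi, mul_assoc]
      _ = h := by rw [← Finset.mul_sum, h1, mul_one]
  refine Module.Finite.of_surjective (∑ i : s, LinearMap.mulLeft k (x i) ∘ₗ V.subtype ∘ₗ
    LinearMap.proj i : (s → V) →ₗ[k] H) fun h => ⟨fun i => p (y i * h), ?_⟩
  rw [LinearMap.sum_apply]
  exact (Finset.sum_coe_sort s fun i => x i * (p (y i * h) : H)).trans (h3 h)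

/-- S reverses products, so its kernel is a two-sided ideal and has a central generator e; the
integral shows e = 0. -/
theorem antipode_injective (k : Type u) [Field k] (H : Type v) [Ring H] [HopfAlgebra k H]
    [IsSemisimpleRing H] : Function.Injective (antipode k (A := H)) := by
  obtain ⟨l, h1, h2, -⟩ := exists_integral k H
  let I : Submodule H H :=
    { carrier := {a | antipode k a = 0}
      zero_mem' := map_zero _
      add_mem' := fun {a b} ha hb => by
        exact (map_add _ a b).trans (by rw [show antipode k a = 0 from ha, hb, add_zero])
      smul_mem' := fun r a ha => by
        exact (antipode_mul_antidistrib r a).trans (by rw [show antipode k a = 0 from ha, zero_mul]) }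
  obtain ⟨e, he, hc, hI⟩ := exists_central_identity I fun a ha r => by
    change antipode k (a * r) = 0
    rw [antipode_mul_antidistrib, show antipode k a = 0 from ha, mul_zero]
  have h3 : e = 0 := by
    have := integral_tmul_mul h2 e
    rw [show antipode k e = 0 from he, TensorProduct.zero_tmul, zero_mul, ← (ℛ k l).eq,
      Finset.mul_sum] at this
    -- Applying m(S ⊗ id) to (1 ⊗ e) Δ(l) = 0 gives ∑ S(l_(0)) e l_(1) = 0; as e is central, the sum
    -- is ε(l) e = e.
    have := congrArg (LinearMap.mul' k H ∘ₗ (antipode k).rTensor H) this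
    simp only [map_sum, LinearMap.comp_apply, LinearMap.rTensor_tmul, LinearMap.mul'_apply,
      Algebra.TensorProduct.tmul_mul_tmul, one_mul, map_zero, hc] at this
    simp only [← mul_assoc, ← Finset.sum_mul] at this
    rwa [sum_antipode_mul_eq_smul, h1, one_smul, one_mul] at this
  rw [injective_iff_map_eq_zero]
  intro a ha
  rw [← hI a ha, h3, mul_zero]

theorem antipode_bijective (k : Type u) [Field k] (H : Type v) [Ring H] [HopfAlgebra k H]
    [IsSemisimpleRing H] : Function.Bijective (antipode k (A := H)) :=
  have := finite_of_semisimple k H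
  ⟨antipode_injective k H, LinearMap.injective_iff_surjective.1 (antipode_injective k H)⟩

end Integrals

/-! ### Faces of tensor powers in terms of the first factor. -/

section Tensor

variable {k : Type u} [CommRing k] {R : Type v} [Ring R] [Algebra k R]

theorem cons_ext {n : ℕ} {M : Type w} [AddCommGroup M] [Module k M]
    {f g : (⨂[k]^(n + 1) R) →ₗ[k] M} (h : ∀ a t, f (cons k n a t) = g (cons k n a t)) : f = g := by
  refine PiTensorProduct.ext (MultilinearMap.ext fun a => ?_)
  have := h (a 0) (PiTensorProduct.tprod k (Fin.tail a))
  rw [cons_tprod, Fin.cons_self_tail] at this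
  exact this

theorem mulFace_succ_cons {n : ℕ} (i : Fin n) (a : R) (t : ⨂[k]^(n + 1) R) :
    mulFace k i.succ (cons k (n + 1) a t) = cons k n a (mulFace k i t) := by
  suffices h : mulFace k i.succ ∘ₗ cons k (n + 1) a = cons k n a ∘ₗ mulFace k i from
    LinearMap.congr_fun h t
  refine PiTensorProduct.ext (MultilinearMap.ext fun x => ?_)
  simp only [LinearMap.compMultilinearMap_apply, LinearMap.comp_apply, cons_tprod, mulFace_tprod]
  congr 1
  funext j
  refine Fin.cases ?_ (fun j => ?_) j
  · simp [Fin.contractNth]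
  · simp [Fin.contractNth]

theorem mulFace_zero_cons_cons {n : ℕ} (a b : R) (t : ⨂[k]^n R) :
    mulFace k 0 (cons k (n + 1) a (cons k n b t)) = cons k n (a * b) t := by
  suffices h : mulFace k 0 ∘ₗ cons k (n + 1) a ∘ₗ cons k n b = cons k n (a * b) from
    LinearMap.congr_fun h t
  refine PiTensorProduct.ext (MultilinearMap.ext fun x => ?_)
  simp only [LinearMap.compMultilinearMap_apply, LinearMap.comp_apply, cons_tprod, mulFace_tprod]
  congr 1
  funext j
  refine Fin.cases ?_ (fun j => ?_) j
  · simp [Fin.contractNth]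
  · simp [Fin.contractNth]

theorem cons_eq_snoc_zero (a : R) (t : ⨂[k]^0 R) : cons k 0 a t = snoc k 0 t a := by
  suffices e : cons k 0 a = (snoc k 0).flip a from LinearMap.congr_fun e t
  refine PiTensorProduct.ext (MultilinearMap.ext fun b => ?_)
  simp only [LinearMap.compMultilinearMap_apply, LinearMap.flip_apply, cons_tprod, snoc_tprod]
  congr 1
  funext i
  rw [show i = 0 from Fin.ext (by omega)]
  rfl

end Tensor

/-! ### Vanishing of Hopf homology. -/

section HopfHomology

open Coalgebra

variable {k : Type u} [CommRing k] {H : Type v} [Ring H] [Bialgebra k H]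
variable {M : Type y} [AddCommGroup M] [Module k M]

theorem tensor_cons_ext {p : ℕ} {N : Type w} [AddCommGroup N] [Module k N]
    {f g : ((⨂[k]^(p + 1) H) ⊗[k] M) →ₗ[k] N}
    (h : ∀ a z, f ((cons k p a).rTensor M z) = g ((cons k p a).rTensor M z)) : f = g := by
  refine TensorProduct.ext' fun t m => ?_
  suffices e : f ∘ₗ (TensorProduct.mk k (⨂[k]^(p + 1) H) M).flip m =
      g ∘ₗ (TensorProduct.mk k (⨂[k]^(p + 1) H) M).flip m from LinearMap.congr_fun e t
  exact cons_ext fun a t => h a (t ⊗ₜ m)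

variable [Module H M] [IsScalarTower k H M]

theorem counitFirst_cons (p : ℕ) (g : H) (t : ⨂[k]^p H) :
    counitFirst k H p (cons k p g t) = counit (R := k) g • t := by
  suffices h : counitFirst k H p ∘ₗ cons k p g = counit (R := k) g • LinearMap.id from
    LinearMap.congr_fun h t
  refine PiTensorProduct.ext (MultilinearMap.ext fun x => ?_)
  simp only [LinearMap.compMultilinearMap_apply, LinearMap.comp_apply, cons_tprod,
    counitFirst_tprod, Fin.cons_zero, Fin.tail_cons, LinearMap.smul_apply, LinearMap.id_apply]

theorem actLast_cons (p : ℕ) (g : H) (z : (⨂[k]^(p + 1) H) ⊗[k] M) :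
    actLast k H M (p + 1) ((cons k (p + 1) g).rTensor M z) =
      (cons k p g).rTensor M (actLast k H M p z) := by
  suffices h : actLast k H M (p + 1) ∘ₗ (cons k (p + 1) g).rTensor M =
      (cons k p g).rTensor M ∘ₗ actLast k H M p from LinearMap.congr_fun h z
  refine TensorProduct.ext' fun t m => ?_
  suffices h : actLast k H M (p + 1) ∘ₗ (TensorProduct.mk k _ M).flip m ∘ₗ cons k (p + 1) g =
      (cons k p g).rTensor M ∘ₗ actLast k H M p ∘ₗ (TensorProduct.mk k _ M).flip m from
    LinearMap.congr_fun h t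
  refine PiTensorProduct.ext (MultilinearMap.ext fun x => ?_)
  simp only [LinearMap.compMultilinearMap_apply, LinearMap.comp_apply, cons_tprod,
    LinearMap.flip_apply, TensorProduct.mk_apply, actLast_tprod_tmul, LinearMap.rTensor_tmul]
  congr 2
  funext j
  refine Fin.cases ?_ (fun j => ?_) j
  · rfl
  · rfl

theorem actLast_cons_zero (g : H) (t : ⨂[k]^0 H) (m : M) :
    actLast k H M 0 (cons k 0 g t ⊗ₜ m) = t ⊗ₜ[k] (g • m) := by
  suffices h : actLast k H M 0 ∘ₗ (TensorProduct.mk k _ M).flip m ∘ₗ cons k 0 g =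
      (TensorProduct.mk k _ M).flip (g • m) from LinearMap.congr_fun h t
  refine PiTensorProduct.ext (MultilinearMap.ext fun x => ?_)
  simp only [LinearMap.compMultilinearMap_apply, LinearMap.comp_apply, cons_tprod,
    LinearMap.flip_apply, TensorProduct.mk_apply, actLast_tprod_tmul]
  congr 2
  exact Subsingleton.elim _ _

variable (M) in
/-- `g, z ↦ ε(g) z - δ (g, z)`: the bar boundary of `z` with its first face
replaced by the product with `g`. -/
def barMul (p : ℕ) (g : H) : ((⨂[k]^p H) ⊗[k] M) →ₗ[k] (⨂[k]^p H) ⊗[k] M :=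
  counit (R := k) g • LinearMap.id - hopfBoundary k H M p ∘ₗ (cons k p g).rTensor M

theorem hopfBoundary_cons (p : ℕ) (g : H) (z : (⨂[k]^p H) ⊗[k] M) :
    hopfBoundary k H M p ((cons k p g).rTensor M z) =
      counit (R := k) g • z - barMul M p g z := by
  simp [barMul]

theorem barMul_zero (g : H) (t : ⨂[k]^0 H) (m : M) :
    barMul M 0 g (t ⊗ₜ m) = t ⊗ₜ[k] (g • m) := by
  simp [barMul, hopfBoundary, counitFirst_cons, actLast_cons_zero, TensorProduct.smul_tmul']

/-- The recursion g·(h, z) = (gh, z) - (g, h·z). With the value on M it determines `barMul`, and it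
replaces all further manipulation of faces and signs. -/
theorem barMul_cons (p : ℕ) (g h : H) (z : (⨂[k]^p H) ⊗[k] M) :
    barMul M (p + 1) g ((cons k p h).rTensor M z) =
      (cons k p (g * h)).rTensor M z - (cons k p g).rTensor M (barMul M p h z) := by
  have hc : ∀ (q : ℕ) (z : (⨂[k]^q H) ⊗[k] M) (g : H),
      (counitFirst k H q).rTensor M ((cons k q g).rTensor M z) = counit (R := k) g • z := by
    intro q z g
    induction z using TensorProduct.induction_on with
    | zero => simp
    | add x y hx hy => simp only [map_add, hx, hy, smul_add]
    | tmul t m =>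
      rw [LinearMap.rTensor_tmul, LinearMap.rTensor_tmul, counitFirst_cons,
        TensorProduct.smul_tmul']
  have h0 : (mulFace k (0 : Fin (p + 1))).rTensor M
      ((cons k (p + 1) g).rTensor M ((cons k p h).rTensor M z)) =
      (cons k p (g * h)).rTensor M z := by
    rw [← LinearMap.rTensor_comp_apply, ← LinearMap.rTensor_comp_apply]
    congr 2
    exact LinearMap.ext fun t => mulFace_zero_cons_cons g h t
  have hs : ∀ i : Fin p, (mulFace k i.succ).rTensor M
      ((cons k (p + 1) g).rTensor M ((cons k p h).rTensor M z)) =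
      (cons k p g).rTensor M ((mulFace k i).rTensor M ((cons k p h).rTensor M z)) := by
    intro i
    have e : mulFace k i.succ ∘ₗ cons k (p + 1) g = cons k p g ∘ₗ mulFace k i :=
      LinearMap.ext fun t => mulFace_succ_cons i g t
    simpa only [LinearMap.rTensor_comp_apply] using
      congrArg (fun f => f.rTensor M ((cons k p h).rTensor M z)) e
  -- The term ε(g) z cancels the counit face of δ(g, z); what remains are the other faces with
  -- reversed signs.
  have hb : ∀ (q : ℕ) (g : H) (z : (⨂[k]^(q + 1) H) ⊗[k] M), barMul M (q + 1) g z =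
      (mulFace k (0 : Fin (q + 1))).rTensor M ((cons k (q + 1) g).rTensor M z) +
      ∑ i : Fin q, (-1 : k) ^ ((i : ℕ) + 1) •
        (mulFace k i.succ).rTensor M ((cons k (q + 1) g).rTensor M z) +
      (-1 : k) ^ (q + 1) • (cons k q g).rTensor M (actLast k H M q z) := by
    intro q g z
    simp only [barMul, hopfBoundary, LinearMap.sub_apply, LinearMap.smul_apply, LinearMap.id_apply,
      LinearMap.comp_apply, LinearMap.add_apply, hc, LinearMap.sum_apply, Fin.sum_univ_succ,
      actLast_cons, Fin.val_zero, Fin.val_succ]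
    rw [pow_succ (-1 : k) (q + 1), mul_neg_one, neg_smul]
    have : ∀ i : Fin q, (-1 : k) ^ ((i : ℕ) + 1 + 1) = -(-1 : k) ^ ((i : ℕ) + 1) := fun i => by
      rw [pow_succ _ ((i : ℕ) + 1), mul_neg_one]
    simp only [this, neg_smul, Finset.sum_neg_distrib, zero_add, pow_one, one_smul]
    abel
  rw [hb, h0]
  simp only [hs]
  simp only [barMul, hopfBoundary, LinearMap.sub_apply, LinearMap.smul_apply, LinearMap.id_apply,
    LinearMap.comp_apply, LinearMap.add_apply, hc, LinearMap.sum_apply, map_sub, map_add, map_sum,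
    map_smul]
  abel

/-- So `barMul` is an action of H. In the recursion both sides of the inductive step reduce to (ghl,
z) - (gh, l·z), the mixed terms (g, hl·z) cancelling. -/
theorem barMul_mul (p : ℕ) (g h : H) (z : (⨂[k]^p H) ⊗[k] M) :
    barMul M p (g * h) z = barMul M p g (barMul M p h z) := by
  suffices e : barMul (k := k) M p (g * h) = barMul M p g ∘ₗ barMul M p h from
    LinearMap.congr_fun e z
  clear z
  induction p generalizing g h with
  | zero =>
    refine TensorProduct.ext' fun t m => ?_
    simp only [LinearMap.comp_apply, barMul_zero, mul_smul]
  | succ p ih =>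
    refine tensor_cons_ext fun l z => ?_
    simp only [LinearMap.comp_apply, barMul_cons, map_sub, mul_assoc, ih h l]
    abel

/-- Once δ(g, z) = ε(g) z - g·z with an action, δδ(g, (h, z)) = 0 is a formal expansion using ε(gh)
= ε(g) ε(h). -/
theorem hopfBoundary_comp (p : ℕ) (z : (⨂[k]^(p + 2) H) ⊗[k] M) :
    hopfBoundary k H M p (hopfBoundary k H M (p + 1) z) = 0 := by
  suffices e : hopfBoundary k H M p ∘ₗ hopfBoundary k H M (p + 1) = 0 from LinearMap.congr_fun e z
  refine tensor_cons_ext fun g z => ?_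
  suffices e : hopfBoundary k H M p ∘ₗ hopfBoundary k H M (p + 1) ∘ₗ
      (cons k (p + 1) g).rTensor M = 0 from LinearMap.congr_fun e z
  refine tensor_cons_ext fun h z => ?_
  simp only [LinearMap.comp_apply, hopfBoundary_cons, barMul_cons, map_sub, map_smul, barMul_mul,
    Bialgebra.counit_mul, LinearMap.zero_apply, smul_sub, smul_smul]
  abel

/-- Since δ(l, z) = z - l·z, the map z ↦ (l, z) bounds any cycle on which l acts by zero. In
positive degree this holds because l·(g, z) = (lg, z) - (l, g·z) = (l, δ(g, z)), by lg = ε(g) l. -/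
theorem hopfBoundary_exact {l : H} (h1 : counit (R := k) l = 1)
    (h2 : ∀ h, l * h = counit (R := k) h • l) (q : ℕ) :
    Function.Exact (hopfBoundary k H M (q + 1)) (hopfBoundary k H M q) := by
  have key : ∀ z : (⨂[k]^(q + 1) H) ⊗[k] M, barMul M (q + 1) l z =
      (cons k q l).rTensor M (hopfBoundary k H M q z) := by
    intro z
    suffices e : barMul M (q + 1) l = (cons k q l).rTensor M ∘ₗ hopfBoundary k H M q from
      LinearMap.congr_fun e z
    refine tensor_cons_ext fun g z => ?_
    simp only [LinearMap.comp_apply, barMul_cons, hopfBoundary_cons, map_sub, map_smul, h2]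
    simp only [LinearMap.rTensor_smul, LinearMap.smul_apply]
  intro z
  constructor
  · intro hz
    refine ⟨(cons k (q + 1) l).rTensor M z, ?_⟩
    rw [hopfBoundary_cons, key, hz, map_zero, sub_zero, h1, one_smul]
  · rintro ⟨z, rfl⟩
    exact hopfBoundary_comp q z

end HopfHomology

/-! ### Simplicial and cyclic identities on tensor powers. -/

section Tensor

variable {k : Type u} [CommRing k] {R : Type v} [Ring R] [Algebra k R]

theorem insertOne_zero {n : ℕ} (t : ⨂[k]^n R) : insertOne k 0 t = cons k n 1 t := by
  suffices h : insertOne k 0 = cons k n (1 : R) from LinearMap.congr_fun h t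
  refine PiTensorProduct.ext (MultilinearMap.ext fun x => ?_)
  simp only [LinearMap.compMultilinearMap_apply, cons_tprod, insertOne_tprod, Fin.insertNth_zero]
  rfl

theorem insertOne_succ_cons {n : ℕ} (i : Fin (n + 1)) (a : R) (t : ⨂[k]^n R) :
    insertOne k i.succ (cons k n a t) = cons k (n + 1) a (insertOne k i t) := by
  suffices h : insertOne k i.succ ∘ₗ cons k n a = cons k (n + 1) a ∘ₗ insertOne k i from
    LinearMap.congr_fun h t
  refine PiTensorProduct.ext (MultilinearMap.ext fun x => ?_)
  simp only [LinearMap.compMultilinearMap_apply, LinearMap.comp_apply, cons_tprod, insertOne_tprod]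
  congr 1
  rw [Fin.insertNth_eq_iff]
  refine ⟨by simp, funext fun j => ?_⟩
  refine Fin.cases ?_ (fun j => ?_) j
  · simp [Fin.removeNth]
  · simp [Fin.removeNth]

theorem comp_cons_ext {n : ℕ} {M : Type w} [AddCommGroup M] [Module k M]
    {f g : (⨂[k]^(n + 1) R) →ₗ[k] M} (h : ∀ a, f ∘ₗ cons k n a = g ∘ₗ cons k n a) : f = g :=
  cons_ext fun a t => LinearMap.congr_fun (h a) t

/-- Faces with positive index pass through the first factor, so induction leaves two base cases: i =
j = 0, which is associativity, and i = 0 < j, where the two products involve disjoint parts. -/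
theorem mulFace_mulFace {n : ℕ} (i j : Fin n) (hij : i ≤ j) :
    mulFace k i ∘ₗ mulFace k j.succ (R := R) = mulFace k j ∘ₗ mulFace k i.castSucc := by
  induction n with
  | zero => exact i.elim0
  | succ n ih =>
    refine comp_cons_ext fun a => comp_cons_ext fun b => ?_
    refine Fin.cases (fun _ => ?_) (fun i hij => ?_) i hij
    · refine Fin.cases ?_ (fun j => ?_) j
      · refine comp_cons_ext fun c => LinearMap.ext fun t => ?_
        simp only [LinearMap.comp_apply, Fin.castSucc_zero, mulFace_succ_cons,
          mulFace_zero_cons_cons, mul_assoc]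
      · refine LinearMap.ext fun t => ?_
        simp only [LinearMap.comp_apply, Fin.castSucc_zero, mulFace_succ_cons,
          mulFace_zero_cons_cons]
    · obtain ⟨j, rfl⟩ := Fin.exists_succ_eq.2 (Fin.pos_iff_ne_zero.1 ((Fin.succ_pos i).trans_le hij))
      refine LinearMap.ext fun t => ?_
      have := LinearMap.congr_fun (ih i j (Fin.succ_le_succ_iff.1 hij)) (cons k (n + 1) b t)
      simp only [LinearMap.comp_apply] at this
      simp only [LinearMap.comp_apply, Fin.castSucc_succ, mulFace_succ_cons, ← this]

theorem insertOne_insertOne {n : ℕ} (i j : Fin (n + 1)) (hij : i ≤ j) :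
    insertOne k i.castSucc ∘ₗ insertOne k j (R := R) = insertOne k j.succ ∘ₗ insertOne k i := by
  induction n with
  | zero =>
    obtain rfl : i = 0 := Fin.ext (by omega)
    obtain rfl : j = 0 := Fin.ext (by omega)
    refine LinearMap.ext fun t => ?_
    simp only [LinearMap.comp_apply, Fin.castSucc_zero, insertOne_zero, insertOne_succ_cons]
  | succ n ih =>
    refine Fin.cases (fun _ => ?_) (fun i hij => ?_) i hij
    · refine LinearMap.ext fun t => ?_
      simp only [LinearMap.comp_apply, Fin.castSucc_zero, insertOne_zero, insertOne_succ_cons]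
    · obtain ⟨j, rfl⟩ := Fin.exists_succ_eq.2 (Fin.pos_iff_ne_zero.1 ((Fin.succ_pos i).trans_le hij))
      refine cons_ext fun a t => ?_
      have := LinearMap.congr_fun (ih i j (Fin.succ_le_succ_iff.1 hij)) t
      simp only [LinearMap.comp_apply] at this
      simp only [LinearMap.comp_apply, Fin.castSucc_succ, insertOne_succ_cons, this]

theorem mulFace_insertOne_of_lt {n : ℕ} (i : Fin n) (j : Fin (n + 1)) (hij : i.castSucc < j) :
    mulFace k i.castSucc ∘ₗ insertOne k j.succ (R := R) = insertOne k j ∘ₗ mulFace k i := by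
  induction n with
  | zero => exact i.elim0
  | succ n ih =>
    obtain ⟨j, rfl⟩ := Fin.exists_succ_eq.2 (Fin.pos_iff_ne_zero.1 ((Fin.zero_le _).trans_lt hij))
    refine comp_cons_ext fun a => ?_
    refine Fin.cases (fun _ => ?_) (fun i hij => ?_) i hij
    · refine cons_ext fun b t => ?_
      simp only [LinearMap.comp_apply, Fin.castSucc_zero, insertOne_succ_cons,
        mulFace_zero_cons_cons]
    · refine LinearMap.ext fun t => ?_
      rw [Fin.castSucc_succ, Fin.succ_lt_succ_iff] at hij
      have := LinearMap.congr_fun (ih i j hij) t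
      simp only [LinearMap.comp_apply] at this
      simp only [LinearMap.comp_apply, Fin.castSucc_succ, insertOne_succ_cons, mulFace_succ_cons,
        this]

theorem mulFace_insertOne_succ {n : ℕ} (i : Fin n) :
    mulFace k i ∘ₗ insertOne k i.succ (R := R) = LinearMap.id := by
  induction n with
  | zero => exact i.elim0
  | succ n ih =>
    refine cons_ext fun a t => ?_
    refine Fin.cases ?_ (fun i => ?_) i
    · simp only [LinearMap.comp_apply, insertOne_succ_cons, insertOne_zero,
        mulFace_zero_cons_cons, mul_one, LinearMap.id_apply]
    · have := LinearMap.congr_fun (ih i) t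
      simp only [LinearMap.comp_apply] at this
      simp only [LinearMap.comp_apply, insertOne_succ_cons, mulFace_succ_cons, this,
        LinearMap.id_apply]

theorem mulFace_insertOne_castSucc {n : ℕ} (i : Fin n) :
    mulFace k i ∘ₗ insertOne k i.castSucc (R := R) = LinearMap.id := by
  induction n with
  | zero => exact i.elim0
  | succ n ih =>
    refine cons_ext fun a t => ?_
    refine Fin.cases ?_ (fun i => ?_) i
    · simp only [LinearMap.comp_apply, Fin.castSucc_zero, insertOne_zero,
        mulFace_zero_cons_cons, one_mul, LinearMap.id_apply]
    · have := LinearMap.congr_fun (ih i) t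
      simp only [LinearMap.comp_apply] at this
      simp only [LinearMap.comp_apply, Fin.castSucc_succ, insertOne_succ_cons, mulFace_succ_cons,
        this, LinearMap.id_apply]

theorem mulFace_insertOne_of_gt {n : ℕ} (i : Fin n) (j : Fin (n + 1)) (hij : j ≤ i.castSucc) :
    mulFace k i.succ ∘ₗ insertOne k j.castSucc (R := R) = insertOne k j ∘ₗ mulFace k i := by
  induction n with
  | zero => exact i.elim0
  | succ n ih =>
    refine Fin.cases (fun _ => ?_) (fun j hij => ?_) j hij
    · refine LinearMap.ext fun t => ?_
      simp only [LinearMap.comp_apply, Fin.castSucc_zero, insertOne_zero, mulFace_succ_cons]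
    · obtain ⟨i, rfl⟩ := Fin.exists_succ_eq.2 (show i ≠ 0 by
        rintro rfl; exact absurd hij (by simp))
      refine cons_ext fun a t => ?_
      rw [Fin.castSucc_succ, Fin.succ_le_succ_iff] at hij
      have := LinearMap.congr_fun (ih i j hij) t
      simp only [LinearMap.comp_apply] at this
      simp only [LinearMap.comp_apply, Fin.castSucc_succ, insertOne_succ_cons, mulFace_succ_cons,
        this]

theorem mulFace_succ_rotate {n : ℕ} (i : Fin n) (t : ⨂[k]^(n + 2) R) :
    mulFace k i.succ (rotate k (n + 2) t) = rotate k (n + 1) (mulFace k i.castSucc t) := by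
  suffices h : mulFace k i.succ ∘ₗ rotate k (n + 2) (R := R) =
    rotate k (n + 1) ∘ₗ mulFace k i.castSucc from LinearMap.congr_fun h t
  refine snoc_ext fun t a => ?_
  simp only [LinearMap.comp_apply, rotate_snoc, mulFace_castSucc_snoc, mulFace_succ_cons]

/-- The case of ∂_{i+1} τ = τ ∂_i in which the face on the left is the wrap-around one: after two
rotations the last two factors stand in front. -/
theorem mulFace_zero_rotate_rotate {n : ℕ} (t : ⨂[k]^(n + 2) R) :
    mulFace k 0 (rotate k (n + 2) (rotate k (n + 2) t)) =
      rotate k (n + 1) (mulFace k (Fin.last n) t) := by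
  suffices h : mulFace k 0 ∘ₗ rotate k (n + 2) (R := R) ∘ₗ rotate k (n + 2) =
    rotate k (n + 1) ∘ₗ mulFace k (Fin.last n) from LinearMap.congr_fun h t
  refine snoc_ext fun t b => ?_
  suffices h : mulFace k 0 ∘ₗ rotate k (n + 2) (R := R) ∘ₗ rotate k (n + 2) ∘ₗ
    (snoc k (n + 1)).flip b =
    rotate k (n + 1) ∘ₗ mulFace k (Fin.last n) ∘ₗ (snoc k (n + 1)).flip b from LinearMap.congr_fun h t
  refine snoc_ext fun t a => ?_
  simp only [LinearMap.comp_apply, LinearMap.flip_apply, rotate_snoc, cons_snoc,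
    mulFace_last_snoc_snoc, mulFace_zero_cons_cons]

theorem insertOne_succ_rotate {n : ℕ} (i : Fin n) (t : ⨂[k]^n R) :
    insertOne k i.succ (rotate k n t) = rotate k (n + 1) (insertOne k i.castSucc t) := by
  cases n with
  | zero => exact i.elim0
  | succ n =>
    suffices h : insertOne k i.succ ∘ₗ rotate k (n + 1) (R := R) =
      rotate k (n + 2) ∘ₗ insertOne k i.castSucc from LinearMap.congr_fun h t
    refine snoc_ext fun t a => ?_
    simp only [LinearMap.comp_apply, rotate_snoc, insertOne_castSucc_snoc, insertOne_succ_cons]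

theorem rotate_insertOne_last {n : ℕ} (t : ⨂[k]^n R) :
    rotate k (n + 1) (insertOne k (Fin.last n) t) = insertOne k 0 t := by
  rw [insertOne_last, rotate_snoc, insertOne_zero]

theorem rotate_pow (n : ℕ) (t : ⨂[k]^(n + 1) R) : (rotate k (n + 1) ^ (n + 1)) t = t := by
  suffices h : rotate k (n + 1) (R := R) ^ (n + 1) = LinearMap.id from LinearMap.congr_fun h t
  refine PiTensorProduct.ext (MultilinearMap.ext fun x => ?_)
  have h : ∀ m : ℕ, (rotate k (n + 1) ^ m) (PiTensorProduct.tprod k x) =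
      PiTensorProduct.tprod k (fun i => x (i - m • (1 : Fin (n + 1)))) := by
    intro m
    induction m with
    | zero => simp
    | succ m ih =>
      rw [pow_succ', Module.End.mul_apply, ih, rotate_tprod]
      congr 1
      funext i
      congr 1
      have : (finRotate (n + 1)).symm i = i - 1 := by
        rw [Equiv.symm_apply_eq, finRotate_apply, sub_add_cancel]
      rw [this, succ_nsmul', sub_sub]
  have h0 : (n + 1) • (1 : Fin (n + 1)) = 0 := by
    simpa only [Fintype.card_fin] using card_nsmul_eq_zero (x := (1 : Fin (n + 1)))
  simp only [LinearMap.compMultilinearMap_apply, h, h0, sub_zero, LinearMap.id_apply]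

end Tensor

/-! ### The cyclic identities for the chains of an algebra. -/

section AlgebraCyclic

variable {k : Type u} [CommRing k] {R : Type v} [Ring R] [Algebra k R]

theorem algebraFace_castSucc (n : ℕ) (i : Fin (n + 1)) :
    algebraFace k R n i.castSucc = mulFace k i := by
  simp only [algebraFace, Fin.lastCases_castSucc]

theorem algebraFace_last (n : ℕ) :
    algebraFace k R n (Fin.last (n + 1)) = mulFace k 0 ∘ₗ rotate k (n + 2) := by
  simp only [algebraFace, Fin.lastCases_last]

theorem algebraFace_zero (n : ℕ) : algebraFace k R n 0 = mulFace k 0 :=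
  algebraFace_castSucc n 0

theorem algebraFace_zero_rotate (n : ℕ) (t : ⨂[k]^(n + 2) R) :
    algebraFace k R n 0 (rotate k (n + 2) t) = algebraFace k R n (Fin.last (n + 1)) t := by
  rw [algebraFace_zero, algebraFace_last, LinearMap.comp_apply]

theorem algebraFace_succ_rotate (n : ℕ) (i : Fin (n + 1)) (t : ⨂[k]^(n + 2) R) :
    algebraFace k R n i.succ (rotate k (n + 2) t) =
      rotate k (n + 1) (algebraFace k R n i.castSucc t) := by
  refine Fin.lastCases ?_ (fun i => ?_) i
  · rw [Fin.succ_last, algebraFace_last, algebraFace_castSucc, LinearMap.comp_apply,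
      mulFace_zero_rotate_rotate]
  · rw [Fin.succ_castSucc, algebraFace_castSucc, algebraFace_castSucc, mulFace_succ_rotate]

/-- The identities between inner faces are associativity. Those involving the wrap-around face
reduce to them through ∂_last = ∂_0 τ and ∂_{i+1} τ = τ ∂_i. -/
theorem algebraFace_algebraFace (n : ℕ) (i j : Fin (n + 2)) (hij : i ≤ j) (t : ⨂[k]^(n + 3) R) :
    algebraFace k R n i (algebraFace k R (n + 1) j.succ t) =
      algebraFace k R n j (algebraFace k R (n + 1) i.castSucc t) := by
  have key : ∀ (i j : Fin (n + 1)), i ≤ j → ∀ t : ⨂[k]^(n + 3) R,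
      algebraFace k R n i.castSucc (algebraFace k R (n + 1) j.castSucc.succ t) =
      algebraFace k R n j.castSucc (algebraFace k R (n + 1) i.castSucc.castSucc t) := by
    intro i j hij t
    rw [Fin.succ_castSucc]
    simp only [algebraFace_castSucc]
    exact LinearMap.congr_fun (mulFace_mulFace i j hij) t
  have last : ∀ (i : Fin (n + 1)) (t : ⨂[k]^(n + 3) R),
      algebraFace k R n i.castSucc (algebraFace k R (n + 1) (Fin.last (n + 2)) t) =
      algebraFace k R n (Fin.last (n + 1)) (algebraFace k R (n + 1) i.castSucc.castSucc t) := by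
    intro i t
    rw [← algebraFace_zero_rotate, ← algebraFace_zero_rotate, ← algebraFace_succ_rotate]
    exact (key 0 i (Fin.zero_le _) _).symm
  revert hij
  refine Fin.lastCases (fun hij => ?_) (fun j hij => ?_) j
  · refine Fin.lastCases ?_ (fun i => ?_) i
    -- Both faces wrap around: the identity becomes the one for the pair (0, 0), evaluated on t
    -- rotated twice.
    · rw [Fin.succ_last, ← algebraFace_zero_rotate (n + 1) t, ← algebraFace_zero_rotate n,
        ← algebraFace_zero_rotate n, ← algebraFace_succ_rotate, Fin.succ_last,
        ← algebraFace_zero_rotate (n + 1) (rotate k _ t)]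
      exact (congrArg _ (algebraFace_succ_rotate (n + 1) 0 _).symm).trans
        (key 0 0 le_rfl (rotate k _ (rotate k _ t)))
    · exact last i t
  · obtain ⟨i, rfl⟩ := Fin.exists_castSucc_eq.2
      (Fin.ne_last_of_lt (hij.trans_lt (Fin.castSucc_lt_last j)))
    exact key i j (Fin.castSucc_le_castSucc_iff.1 hij) t

theorem algebraCyclic_isCyclicModule : (algebraCyclic k R).IsCyclicModule where
  face_face n i j hij c := algebraFace_algebraFace n i j hij c
  degen_degen n i j hij c :=
    LinearMap.congr_fun (insertOne_insertOne i.succ j.succ (Fin.succ_le_succ_iff.2 hij)) c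
  face_degen_of_lt n i j hij c := by
    obtain ⟨i, rfl⟩ := Fin.exists_castSucc_eq.2
      (Fin.ne_last_of_lt (hij.trans_lt (Fin.castSucc_lt_last j)))
    change algebraFace k R (n + 1) i.castSucc.castSucc (insertOne k j.succ.succ _) =
      insertOne k j.succ (algebraFace k R n i.castSucc _)
    rw [algebraFace_castSucc, algebraFace_castSucc]
    exact LinearMap.congr_fun (mulFace_insertOne_of_lt i j.succ
      (Fin.castSucc_lt_succ_iff.2 (Fin.castSucc_le_castSucc_iff.1 hij))) c
  face_degen_self n i c := by
    change algebraFace k R n i.castSucc (insertOne k i.succ _) = _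
    rw [algebraFace_castSucc]
    exact LinearMap.congr_fun (mulFace_insertOne_succ i) c
  face_degen_succ n i c := by
    revert c
    change ∀ c : ⨂[k]^(n + 1) R, algebraFace k R n i.succ (insertOne k i.succ c) = c
    intro c
    refine Fin.lastCases ?_ (fun i => ?_) i
    · rw [Fin.succ_last, algebraFace_last, LinearMap.comp_apply, rotate_insertOne_last]
      exact LinearMap.congr_fun (mulFace_insertOne_castSucc (k := k) (R := R) (0 : Fin (n + 1))) c
    · rw [Fin.succ_castSucc, algebraFace_castSucc]
      exact LinearMap.congr_fun (mulFace_insertOne_castSucc i.succ) c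
  face_degen_of_gt n i j hij c := by
    revert c
    change ∀ c : ⨂[k]^(n + 2) R, algebraFace k R (n + 1) i.succ (insertOne k j.castSucc.succ c) =
      insertOne k j.succ (algebraFace k R n i c)
    intro c
    revert hij
    refine Fin.lastCases (fun hij => ?_) (fun i hij => ?_) i
    · rw [Fin.succ_last, ← algebraFace_zero_rotate, ← algebraFace_zero_rotate]
      rw [Fin.succ_castSucc, ← insertOne_succ_rotate, algebraFace_zero, algebraFace_zero]
      exact LinearMap.congr_fun (mulFace_insertOne_of_lt (0 : Fin (n + 1)) j.succ
        (Fin.castSucc_lt_succ_iff.2 (Fin.zero_le _))) (rotate k (n + 2) c)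
    · rw [Fin.succ_castSucc, algebraFace_castSucc, algebraFace_castSucc]
      exact LinearMap.congr_fun (mulFace_insertOne_of_gt i j.succ
        (by rw [← Fin.castSucc_lt_iff_succ_le]; exact hij)) c
  face_zero_cyc n c := algebraFace_zero_rotate n c
  face_succ_cyc n i c := algebraFace_succ_rotate n i c
  degen_zero_cyc n c := by
    revert c
    change ∀ c : ⨂[k]^(n + 1) R, insertOne k (Fin.succ 0) (rotate k (n + 1) c) =
      rotate k (n + 2) (rotate k (n + 2) (insertOne k (Fin.last n).succ c))
    intro c
    rw [Fin.succ_last, rotate_insertOne_last, insertOne_succ_rotate, Fin.castSucc_zero]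
  degen_succ_cyc n i c := insertOne_succ_rotate i.succ c
  cyc_pow n c := rotate_pow n c

end AlgebraCyclic

/-! ### The mixed complex of a cyclic module: b² = 0, bB + Bb = 0, B² = 0. -/

theorem sum_face_face_eq_zero {k : Type u} [CommRing k] {L : Type v} {M : Type w} {N : Type x}
    [AddCommGroup L] [Module k L] [AddCommGroup M] [Module k M] [AddCommGroup N] [Module k N]
    {n : ℕ} (d : Fin (n + 3) → L →ₗ[k] M) (d' : Fin (n + 2) → M →ₗ[k] N)
    (h : ∀ i j : Fin (n + 2), i ≤ j → ∀ c, d' i (d j.succ c) = d' j (d i.castSucc c)) (c : L) :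
    ∑ i : Fin (n + 2), (-1 : k) ^ (i : ℕ) • d' i
      (∑ j : Fin (n + 3), (-1 : k) ^ (j : ℕ) • d j c) = 0 := by
  simp only [map_sum, map_smul, Finset.smul_sum, ← Finset.sum_product']
  let P := Fin (n + 2) × Fin (n + 3)
  let S : Finset P := {ij : P | (ij.2 : ℕ) ≤ (ij.1 : ℕ)}
  rw [Finset.univ_product_univ, ← Finset.sum_add_sum_compl S, ← eq_neg_iff_add_eq_zero,
    ← Finset.sum_neg_distrib]
  -- A pair (i, j), with j the face applied first, is matched for j ≤ i with (j, i + 1): the same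
  -- composite, with opposite sign.
  let φ : ∀ ij : P, ij ∈ S → P := fun ij hij =>
    (Fin.castLT ij.2 (lt_of_le_of_lt (Finset.mem_filter.mp hij).right (Fin.is_lt ij.1)), ij.1.succ)
  apply Finset.sum_bij φ
  · intro ij hij
    simp_rw [S, φ, Finset.compl_filter, Finset.mem_filter_univ, Fin.val_succ,
      Fin.val_castLT] at hij ⊢
    lia
  · rintro ⟨i, j⟩ hij ⟨i', j'⟩ hij' h
    rw [Prod.mk_inj]
    exact ⟨by simpa [φ] using! congr_arg Prod.snd h,
      by simpa [φ, Fin.castSucc_castLT] using! congr_arg Fin.castSucc (congr_arg Prod.fst h)⟩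
  · rintro ⟨i', j'⟩ hij'
    simp_rw [S, Finset.compl_filter, Finset.mem_filter_univ, not_le] at hij'
    refine ⟨(j'.pred <| ?_, Fin.castSucc i'), ?_, ?_⟩
    · rintro rfl
      simp only [Fin.val_zero, not_lt_zero] at hij'
    · simpa [S] using! Nat.le_sub_one_of_lt hij'
    · simp only [φ, Fin.castLT_castSucc, Fin.succ_pred]
  · rintro ⟨i, j⟩ hij
    have hij' : (j : ℕ) ≤ i := by simpa [S] using! hij
    have := h (j.castLT (lt_of_le_of_lt hij' i.is_lt)) i hij' c
    simp only [φ, Fin.val_succ, Fin.val_castLT, this, Fin.castSucc_castLT, smul_smul, ← neg_smul]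
    congr 1
    ring

namespace CyclicData

variable {k : Type u} [CommRing k] (C : CyclicData.{u, v} k)

/-- The signed cyclic operator `t = (-1)^n τ_n`. -/
def signedCyc (n : ℕ) : Module.End k (C.X n) := (-1 : k) ^ n • C.cyc n

/-- The boundary `b' = ∑_{i=0}^n (-1)^i ∂_i`, without the last face. -/
def bPrime (n : ℕ) : C.X (n + 1) →ₗ[k] C.X n :=
  ∑ i : Fin (n + 1), (-1 : k) ^ (i : ℕ) • C.face n i.castSucc

theorem b_apply (n : ℕ) (c : C.X (n + 1)) :
    C.b n c = ∑ i : Fin (n + 2), (-1 : k) ^ (i : ℕ) • C.face n i c := by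
  simp only [b, LinearMap.sum_apply, LinearMap.smul_apply]

theorem bPrime_apply (n : ℕ) (c : C.X (n + 1)) :
    C.bPrime n c = ∑ i : Fin (n + 1), (-1 : k) ^ (i : ℕ) • C.face n i.castSucc c := by
  simp only [bPrime, LinearMap.sum_apply, LinearMap.smul_apply]

theorem b_eq_bPrime_add (n : ℕ) (c : C.X (n + 1)) :
    C.b n c = C.bPrime n c + (-1 : k) ^ (n + 1) • C.face n (Fin.last (n + 1)) c := by
  rw [b_apply, bPrime_apply, Fin.sum_univ_castSucc]
  rfl

theorem norm_eq (n : ℕ) : C.norm n = ∑ i ∈ Finset.range (n + 1), C.signedCyc n ^ i := by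
  refine Finset.sum_congr rfl fun i _ => ?_
  rw [signedCyc, smul_pow, ← pow_mul, mul_comm n]

theorem B_apply (n : ℕ) (c : C.X n) : C.B n c =
    C.extraDegen n (C.norm n c) - C.signedCyc (n + 1) (C.extraDegen n (C.norm n c)) := rfl

namespace IsCyclicModule

variable {C} (hC : C.IsCyclicModule)
include hC

theorem b_b (n : ℕ) (c : C.X (n + 2)) : C.b n (C.b (n + 1) c) = 0 := by
  rw [b_apply, b_apply]
  exact sum_face_face_eq_zero (C.face (n + 1)) (C.face n) (hC.face_face n) c

theorem signedCyc_pow (n : ℕ) : C.signedCyc n ^ (n + 1) = 1 := by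
  rw [signedCyc, smul_pow, ← pow_mul, (Nat.even_mul_succ_self n).neg_one_pow, one_smul]
  exact LinearMap.ext (hC.cyc_pow n)

theorem signedCyc_norm (n : ℕ) (c : C.X n) : C.signedCyc n (C.norm n c) = C.norm n c := by
  have := mul_neg_geom_sum (C.signedCyc n) (n + 1)
  rw [hC.signedCyc_pow, sub_self, ← norm_eq] at this
  have := LinearMap.congr_fun this c
  simp only [Module.End.mul_apply, LinearMap.sub_apply, Module.End.one_apply,
    LinearMap.zero_apply] at this
  exact (sub_eq_zero.1 this).symm

theorem norm_signedCyc (n : ℕ) (c : C.X n) : C.norm n (C.signedCyc n c) = C.norm n c := by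
  have := geom_sum_mul_neg (C.signedCyc n) (n + 1)
  rw [hC.signedCyc_pow, sub_self, ← norm_eq] at this
  have := LinearMap.congr_fun this c
  simp only [Module.End.mul_apply, LinearMap.sub_apply, Module.End.one_apply, map_sub,
    LinearMap.zero_apply] at this
  exact (sub_eq_zero.1 this).symm

theorem face_zero_signedCyc (n : ℕ) (c : C.X (n + 1)) :
    C.face n 0 (C.signedCyc (n + 1) c) =
      (-1 : k) ^ (n + 1) • C.face n (Fin.last (n + 1)) c := by
  rw [signedCyc, LinearMap.smul_apply, map_smul, hC.face_zero_cyc]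

theorem face_succ_signedCyc (n : ℕ) (i : Fin (n + 1)) (c : C.X (n + 1)) :
    C.face n i.succ (C.signedCyc (n + 1) c) =
      -C.signedCyc n (C.face n i.castSucc c) := by
  rw [signedCyc, LinearMap.smul_apply, map_smul, hC.face_succ_cyc, signedCyc,
    LinearMap.smul_apply, pow_succ, mul_neg_one, neg_smul]

/-- The relation b(1 - t) = (1 - t)b'. The term ∂_0 t of bt is the signed last face, which b has in
addition to b', and ∂_{i+1} t = -t ∂_i turns the other terms of bt into t b'. -/
theorem b_signedCyc (n : ℕ) (c : C.X (n + 1)) :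
    C.b n c - C.b n (C.signedCyc (n + 1) c) =
      C.bPrime n c - C.signedCyc n (C.bPrime n c) := by
  rw [b_eq_bPrime_add, b_apply, Fin.sum_univ_succ, hC.face_zero_signedCyc, bPrime_apply, map_sum]
  simp only [hC.face_succ_signedCyc, Fin.val_succ, pow_succ, mul_neg_one, neg_smul, smul_neg,
    neg_neg, map_smul, Fin.val_zero, pow_zero, one_smul]
  abel

theorem bPrime_extraDegen_zero (c : C.X 0) : C.bPrime 0 (C.extraDegen 0 c) = c := by
  rw [bPrime_apply, Fin.sum_univ_one, Fin.val_zero, pow_zero, one_smul, Fin.castSucc_zero,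
    extraDegen, LinearMap.comp_apply, hC.face_zero_cyc]
  exact hC.face_degen_succ 0 (Fin.last 0) c

/-- The extra degeneracy contracts b', since ∂_0 σ = 1 and ∂_{i+1} σ = σ ∂_i for the faces occurring
in b'. -/
theorem bPrime_extraDegen (n : ℕ) (c : C.X (n + 1)) :
    C.bPrime (n + 1) (C.extraDegen (n + 1) c) = c - C.extraDegen n (C.bPrime n c) := by
  have h : ∀ i : Fin (n + 1), C.face (n + 1) i.succ.castSucc (C.extraDegen (n + 1) c) =
      C.extraDegen n (C.face n i.castSucc c) := by
    intro i
    rw [extraDegen, LinearMap.comp_apply, ← Fin.succ_castSucc, hC.face_succ_cyc, ← Fin.succ_last,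
      hC.face_degen_of_lt n i.castSucc (Fin.last n)
        (Fin.castSucc_le_castSucc_iff.2 (Fin.le_last i))]
    rfl
  have h0 : C.face (n + 1) 0 (C.extraDegen (n + 1) c) = c := by
    rw [extraDegen, LinearMap.comp_apply, hC.face_zero_cyc]
    exact hC.face_degen_succ (n + 1) (Fin.last (n + 1)) c
  rw [bPrime_apply, Fin.sum_univ_succ, Fin.castSucc_zero, h0, bPrime_apply, map_sum]
  simp only [h, Fin.val_succ, pow_succ, mul_neg_one, neg_smul, map_smul, Fin.val_zero, pow_zero,
    one_smul, Finset.sum_neg_distrib, sub_eq_add_neg]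

/-- Both sides equal N ∂_0 N. The signed faces d_i = (-1)^i ∂_i satisfy d_{i+1} t = t d_i, while tN
= N = Nt, so every d_i next to N can be moved to d_0 at the cost of powers of t; summed up, these
powers form the other N. -/
theorem bPrime_norm (n : ℕ) (c : C.X (n + 1)) :
    C.bPrime n (C.norm (n + 1) c) = C.norm n (C.b n c) := by
  have hs : ∀ (i : Fin (n + 1)) (c : C.X (n + 1)),
      (-1 : k) ^ (i.succ : ℕ) • C.face n i.succ (C.signedCyc (n + 1) c) =
        C.signedCyc n ((-1 : k) ^ (i : ℕ) • C.face n i.castSucc c) := by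
    intro i c
    rw [hC.face_succ_signedCyc, Fin.val_succ, pow_succ, mul_neg_one, neg_smul, smul_neg, neg_neg,
      map_smul]
  -- d_{i+1} N = d_{i+1} t N = t d_i N.
  have h1 : ∀ i : Fin (n + 2), (-1 : k) ^ (i : ℕ) • C.face n i (C.norm (n + 1) c) =
      (C.signedCyc n ^ (i : ℕ)) (C.face n 0 (C.norm (n + 1) c)) := by
    intro i
    induction i using Fin.induction with
    | zero => simp
    | succ i ih =>
      conv_lhs => rw [← hC.signedCyc_norm, hs]
      rw [Fin.val_succ, pow_succ', Module.End.mul_apply]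
      exact congrArg _ ih
  have h2 : ∀ (i : Fin (n + 2)) (c : C.X (n + 1)),
      C.norm n ((-1 : k) ^ (i : ℕ) • C.face n i ((C.signedCyc (n + 1) ^ (i : ℕ)) c)) =
        C.norm n (C.face n 0 c) := by
    intro i
    induction i using Fin.induction with
    | zero => simp
    | succ i ih =>
      intro c
      rw [Fin.val_succ, pow_succ' (C.signedCyc (n + 1)), Module.End.mul_apply, ← Fin.val_succ, hs,
        hC.norm_signedCyc]
      exact ih c
  -- N d_i t^i = N d_0 is solved for N d_i by means of t^{n+2} = 1 in degree n + 1.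
  have h3 : ∀ i : Fin (n + 2), C.norm n ((-1 : k) ^ (i : ℕ) • C.face n i c) =
      C.norm n (C.face n 0 ((C.signedCyc (n + 1) ^ (n + 2 - (i : ℕ))) c)) := by
    intro i
    rw [← h2 i, ← Module.End.mul_apply, ← pow_add, Nat.add_sub_cancel' i.is_lt.le,
      hC.signedCyc_pow (n + 1), Module.End.one_apply]
  have h4 : ∑ i : Fin (n + 2), (C.signedCyc (n + 1) ^ (n + 2 - (i : ℕ))) c =
      C.norm (n + 1) c := by
    rw [Fin.sum_univ_eq_sum_range (fun i => (C.signedCyc (n + 1) ^ (n + 2 - i)) c),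
      ← hC.signedCyc_norm (n + 1) c, norm_eq, LinearMap.sum_apply, map_sum,
      ← Finset.sum_range_reflect]
    refine Finset.sum_congr rfl fun i hi => ?_
    have hi := Finset.mem_range.1 hi
    rw [← Module.End.mul_apply, ← pow_succ']
    congr 2
    omega
  rw [b_apply, map_sum, Finset.sum_congr rfl fun i _ => h3 i, ← map_sum, ← map_sum, h4,
    bPrime_apply, norm_eq C n, LinearMap.sum_apply, ← Fin.sum_univ_eq_sum_range
      (fun i => (C.signedCyc n ^ i) (C.face n 0 (C.norm (n + 1) c)))]
  exact Finset.sum_congr rfl fun i _ => h1 i.castSucc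

theorem b_B_zero (c : C.X 0) : C.b 0 (C.B 0 c) = 0 := by
  rw [B_apply, map_sub, hC.b_signedCyc, hC.bPrime_extraDegen_zero, hC.signedCyc_norm, sub_self]

/-- b(1 - t)σN + (1 - t)σNb = (1 - t)(b'σ + σb')N = (1 - t)N = 0. -/
theorem b_B (n : ℕ) (c : C.X (n + 1)) :
    C.b (n + 1) (C.B (n + 1) c) + C.B n (C.b n c) = 0 := by
  rw [B_apply, B_apply, map_sub, hC.b_signedCyc, hC.bPrime_extraDegen, hC.bPrime_norm, map_sub,
    hC.signedCyc_norm]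
  abel

theorem B_B (n : ℕ) (c : C.X n) : C.B (n + 1) (C.B n c) = 0 := by
  rw [B_apply, B_apply, map_sub, hC.norm_signedCyc, sub_self, map_zero, map_zero, sub_self]

theorem bB_bB (c : ∀ j, C.X j) : C.bB (C.bB c) = 0 := by
  funext j
  match j with
  | 0 => simp [bB, hC.b_b, hC.b_B_zero]
  | 1 =>
    have := hC.b_B 0 (c 1)
    simpa [bB, hC.b_b, add_assoc] using this
  | j + 2 =>
    have := hC.b_B (j + 1) (c (j + 2))
    simpa [bB, hC.b_b, hC.B_B, add_assoc] using this

end IsCyclicModule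
end CyclicData

/-- The identity morphism. -/
def GradedUModule.Hom.id {k : Type u} [CommRing k] (W : GradedUModule.{u, x} k) :
    GradedUModule.Hom W W where
  toLinearMap := LinearMap.id
  map_mem _ _ h := h

namespace CyclicData

variable {k : Type u} [CommRing k]

/-! ### Homogeneous maps on X[[u]] ⊗ W. -/

section BoxMap

variable {C C' : CyclicData.{u, v} k}

/-- A linear map of families which is homogeneous of degree `d`, on `⨁_n X[[u]]_n`. -/
def psumMap (d : ℤ) (L : (∀ j, C.X j) →ₗ[k] (∀ j, C'.X j))
    (hL : ∀ n, ∀ c ∈ C.ps n, L c ∈ C'.ps (n + d)) : C.PSum →ₗ[k] C'.PSum :=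
  DirectSum.toModule k ℤ _ fun n => C'.psOf (n + d) ∘ₗ L.restrict (hL n)

/-- In terms of families, multiplication by u is an inclusion, so every linear map of families of
fixed degree commutes with it. Sections and homotopies are therefore automatically k[u]-linear and
can be tensored with W. -/
theorem psumMap_psU (d : ℤ) (L : (∀ j, C.X j) →ₗ[k] (∀ j, C'.X j))
    (hL : ∀ n, ∀ c ∈ C.ps n, L c ∈ C'.ps (n + d)) (c : C.PSum) :
    psumMap d L hL (C.psU c) = C'.psU (psumMap d L hL c) := by
  suffices h : psumMap d L hL ∘ₗ C.psU = C'.psU ∘ₗ psumMap d L hL from LinearMap.congr_fun h c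
  refine DirectSum.linearMap_ext _ fun n => LinearMap.ext fun c => ?_
  simp only [LinearMap.comp_apply, psumMap, psU, DirectSum.toModule_lof]
  exact C'.psOf_congr (by ring) _ _ _

variable (W : GradedUModule.{u, x} k)

/-- The map `X ⊠ W → X' ⊠ W` induced by a homogeneous linear map of families. -/
def boxMap (d : ℤ) (L : (∀ j, C.X j) →ₗ[k] (∀ j, C'.X j))
    (hL : ∀ n, ∀ c ∈ C.ps n, L c ∈ C'.ps (n + d)) : C.Box W →ₗ[k] C'.Box W :=
  (TensorProduct.map (polyLinear (psumMap d L hL) (psumMap_psU d L hL))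
    (LinearMap.id : W.carrier →ₗ[k[X]] W.carrier)).restrictScalars k

variable {W}

/-- The element `c ⊗ m` of `X ⊠ W`, for a family `c` in `X[[u]]_n`. -/
def boxOf (n : ℤ) (c : ∀ j, C.X j) (hc : c ∈ C.ps n) (m : W.carrier) : C.Box W :=
  C.toPS (C.psOf n ⟨c, hc⟩) ⊗ₜ[k[X]] m

theorem boxOf_congr {n n' : ℤ} (h : n = n') {c c' : ∀ j, C.X j} (h' : c = c') (hc : c ∈ C.ps n)
    (hc' : c' ∈ C.ps n') (m : W.carrier) : boxOf n c hc m = boxOf n' c' hc' m := by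
  subst h h'; rfl

theorem boxOf_add {n : ℤ} {c c' : ∀ j, C.X j} (hc : c ∈ C.ps n) (hc' : c' ∈ C.ps n)
    (m : W.carrier) : boxOf n c hc m + boxOf n c' hc' m =
      boxOf n (c + c') ((C.ps n).add_mem hc hc') m := by
  rw [boxOf, boxOf, ← TensorProduct.add_tmul, ← map_add, ← map_add]
  rfl

theorem boxOf_zero {n : ℤ} (m : W.carrier) :
    boxOf n (0 : ∀ j, C.X j) ((C.ps n).zero_mem) m = 0 := by
  have := boxOf_add (C.ps n).zero_mem (C.ps n).zero_mem m
  rwa [boxOf_congr rfl (add_zero 0) _ (C.ps n).zero_mem, add_eq_right] at this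

theorem boxOf_sub {n : ℤ} {c c' : ∀ j, C.X j} (hc : c ∈ C.ps n) (hc' : c' ∈ C.ps n)
    (m : W.carrier) : boxOf n c hc m - boxOf n c' hc' m =
      boxOf n (c - c') ((C.ps n).sub_mem hc hc') m := by
  rw [sub_eq_iff_eq_add, boxOf_add]
  exact boxOf_congr rfl (sub_add_cancel _ _).symm _ _ m

/-- Reduces every identity on X ⊠ W to an identity of families. -/
theorem box_ext {N : Type w} [AddCommGroup N] [Module k N] {f g : C.Box W →ₗ[k] N}
    (h : ∀ n c hc m, f (boxOf n c hc m) = g (boxOf n c hc m)) : f = g := by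
  refine LinearMap.ext fun z => ?_
  induction z using TensorProduct.induction_on with
  | zero => rw [map_zero, map_zero]
  | add z z' hz hz' => rw [map_add, map_add, hz, hz']
  | tmul c m =>
    obtain ⟨c, rfl⟩ := C.toPS.surjective c
    induction c using DirectSum.induction_on with
    | zero => rw [map_zero, TensorProduct.zero_tmul, map_zero, map_zero]
    | of n c => exact h n c c.2 m
    | add c c' hc hc' => rw [map_add, TensorProduct.add_tmul, map_add, map_add, hc, hc']

theorem boxMap_boxOf (d : ℤ) (L : (∀ j, C.X j) →ₗ[k] (∀ j, C'.X j))
    (hL : ∀ n, ∀ c ∈ C.ps n, L c ∈ C'.ps (n + d)) (n : ℤ) (c : ∀ j, C.X j) (hc : c ∈ C.ps n)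
    (m : W.carrier) :
    boxMap W d L hL (boxOf n c hc m) = boxOf (n + d) (L c) (hL n c hc) m := by
  change C'.toPS (psumMap d L hL (C.psOf n ⟨c, hc⟩)) ⊗ₜ[k[X]] m = _
  rw [psumMap, DirectSum.toModule_lof]
  rfl

theorem boxDiff_boxOf (n : ℤ) (c : ∀ j, C.X j) (hc : c ∈ C.ps n) (m : W.carrier) :
    C.boxDiff W (boxOf n c hc m) = boxOf (n - 1) (C.bB c) (C.bB_mem n c hc) m := by
  change C.toPS (C.psDiff (C.psOf n ⟨c, hc⟩)) ⊗ₜ[k[X]] m = _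
  rw [psDiff, DirectSum.toModule_lof]
  rfl

theorem Hom.box_boxOf (F : Hom C C') {W' : GradedUModule.{u, x} k} (f : GradedUModule.Hom W W')
    (n : ℤ) (c : ∀ j, C.X j) (hc : c ∈ C.ps n) (m : W.carrier) :
    F.box f (boxOf n c hc m) = boxOf n (F.pi c) (F.pi_mem n c hc) (f.toLinearMap m) := by
  change C'.toPS (F.psum (C.psOf n ⟨c, hc⟩)) ⊗ₜ[k[X]] _ = _
  rw [Hom.psum, DirectSum.toModule_lof]
  rfl

theorem boxOf_mem (i j n : ℤ) (h : i + j = n) (c : ∀ j, C.X j) (hc : c ∈ C.ps i) (m : W.carrier)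
    (hm : m ∈ W.gr j) : boxOf i c hc m ∈ C.boxGr W n :=
  Submodule.subset_span ⟨i, j, ⟨c, hc⟩, ⟨m, hm⟩, h, rfl⟩

theorem boxGr_le (n : ℤ) (p : Submodule k (C.Box W))
    (h : ∀ i j c hc m, i + j = n → m ∈ W.gr j → boxOf i c hc m ∈ p) : C.boxGr W n ≤ p := by
  refine Submodule.span_le.2 ?_
  rintro _ ⟨i, j, c, m, hij, rfl⟩
  exact h i j c c.2 m hij m.2

theorem boxMap_mem (d : ℤ) (L : (∀ j, C.X j) →ₗ[k] (∀ j, C'.X j))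
    (hL : ∀ n, ∀ c ∈ C.ps n, L c ∈ C'.ps (n + d)) {n n' : ℤ} (hn : n + d = n') :
    ∀ z ∈ C.boxGr W n, boxMap W d L hL z ∈ C'.boxGr W n' := by
  refine boxGr_le n ((C'.boxGr W n').comap (boxMap W d L hL)) fun i j c hc m hij hm => ?_
  rw [Submodule.mem_comap, boxMap_boxOf]
  exact boxOf_mem (i + d) j n' (by rw [← hn, ← hij]; ring) _ _ m hm

theorem boxDiff_mem {n n' : ℤ} (hn : n - 1 = n') :
    ∀ z ∈ C.boxGr W n, C.boxDiff W z ∈ C.boxGr W n' := by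
  refine boxGr_le n ((C.boxGr W n').comap (C.boxDiff W)) fun i j c hc m hij hm => ?_
  rw [Submodule.mem_comap, boxDiff_boxOf]
  exact boxOf_mem (i - 1) j n' (by rw [← hn, ← hij]; ring) _ _ m hm

theorem IsCyclicModule.boxDiff_boxDiff (hC : C.IsCyclicModule) (z : C.Box W) :
    C.boxDiff W (C.boxDiff W z) = 0 := by
  suffices h : C.boxDiff W ∘ₗ C.boxDiff W = 0 from LinearMap.congr_fun h z
  refine box_ext fun n c hc m => ?_
  rw [LinearMap.comp_apply, boxDiff_boxOf, boxDiff_boxOf, LinearMap.zero_apply]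
  exact (boxOf_congr rfl (hC.bB_bB c) _ (Submodule.zero_mem _) m).trans (boxOf_zero m)

end BoxMap

/-! ### From contractions for b to contractions for b + uB. -/

section Perturbation

variable {C C' : CyclicData.{u, v} k}

/-- The operator of degree `1` on families given by maps `X j → X (j+1)`. -/
def shiftMap (h : ∀ n, C.X n →ₗ[k] C.X (n + 1)) : (∀ j, C.X j) →ₗ[k] (∀ j, C.X j) :=
  LinearMap.pi fun j =>
    match j with
    | 0 => 0
    | i + 1 => h i ∘ₗ LinearMap.proj i

theorem shiftMap_zero (h : ∀ n, C.X n →ₗ[k] C.X (n + 1)) (c : ∀ j, C.X j) :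
    shiftMap h c 0 = 0 := rfl

theorem shiftMap_succ (h : ∀ n, C.X n →ₗ[k] C.X (n + 1)) (c : ∀ j, C.X j) (j : ℕ) :
    shiftMap h c (j + 1) = h j (c j) := rfl

theorem shiftMap_mem (h : ∀ n, C.X n →ₗ[k] C.X (n + 1)) (n : ℤ) :
    ∀ c ∈ C.ps n, shiftMap h c ∈ C.ps (n + 1) := by
  intro c hc j hj
  cases j with
  | zero => exact absurd rfl hj
  | succ j =>
    obtain ⟨i, hi⟩ := hc j fun h0 => hj (by rw [shiftMap_succ, h0, map_zero])
    exact ⟨i, by push_cast; linarith⟩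

theorem bB_zero (c : ∀ j, C.X j) : C.bB c 0 = C.b 0 (c 1) := by
  simp [bB]

theorem bB_succ (c : ∀ j, C.X j) (j : ℕ) :
    C.bB c (j + 1) = C.b (j + 1) (c (j + 2)) + C.B j (c j) := rfl

/-- The components of `(1 + u (B h + h B))⁻¹`. -/
def perturbAux (h : ∀ n, C.X n →ₗ[k] C.X (n + 1)) : ∀ j, (∀ j, C.X j) →ₗ[k] C.X j
  | 0 => LinearMap.proj 0
  | 1 => LinearMap.proj 1
  | j + 2 => LinearMap.proj (j + 2) -
      (C.B (j + 1) ∘ₗ h j + h (j + 1) ∘ₗ C.B j) ∘ₗ perturbAux h j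

/-- The operator `(1 + u (B h + h B))⁻¹` on families. -/
def perturb (h : ∀ n, C.X n →ₗ[k] C.X (n + 1)) : (∀ j, C.X j) →ₗ[k] (∀ j, C.X j) :=
  LinearMap.pi (perturbAux h)

variable (h : ∀ n, C.X n →ₗ[k] C.X (n + 1))

/-- Since u shifts the index of a family by 2, the equation (1 + u(Bh + hB)) p = c is solved by
recursion on the index; the components 0 and 1 need no correction. -/
theorem perturb_add_two (c : ∀ j, C.X j) (j : ℕ) : perturb h c (j + 2) = c (j + 2) -
    (C.B (j + 1) (h j (perturb h c j)) + h (j + 1) (C.B j (perturb h c j))) := rfl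

theorem perturb_mem (n : ℤ) : ∀ c ∈ C.ps n, perturb h c ∈ C.ps n := by
  intro c hc j
  induction j using Nat.twoStepInduction with
  | zero => exact hc 0
  | one => exact hc 1
  | more j ih _ =>
    intro hj
    by_cases h0 : perturb h c j = 0
    · refine hc _ fun h1 => hj ?_
      rw [perturb_add_two, h0, h1]
      simp only [map_zero, add_zero, sub_zero]
    · obtain ⟨i, hi⟩ := ih h0
      exact ⟨i + 1, by push_cast; linarith⟩

/-- A `k`-linear contraction of the kernel of a morphism `F` of cyclic modules for the Hochschild
boundary. -/
structure IsKernelContraction (F : Hom C C') (h : ∀ n, C.X n →ₗ[k] C.X (n + 1)) : Prop where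
  app_eq_zero : ∀ n c, F.app (n + 1) (h n c) = 0
  b_zero : ∀ c, F.app 0 c = 0 → C.b 0 (h 0 c) = c
  b_succ : ∀ n c, F.app (n + 1) c = 0 → C.b (n + 1) (h (n + 1) c) + h n (C.b n c) = c

namespace IsKernelContraction

variable {h} {F : Hom C C'} (hF : IsKernelContraction F h)
include hF

theorem pi_shiftMap (c : ∀ j, C.X j) : F.pi (shiftMap h c) = 0 := by
  funext j
  cases j with
  | zero => exact map_zero (F.app 0)
  | succ j => exact hF.app_eq_zero j (c j)

theorem pi_perturb {c : ∀ j, C.X j} (hc : F.pi c = 0) : F.pi (perturb h c) = 0 := by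
  funext j
  induction j using Nat.twoStepInduction with
  | zero => exact congrFun hc 0
  | one => exact congrFun hc 1
  | more j ih _ =>
    change F.app (j + 2) (perturb h c (j + 2)) = 0
    rw [perturb_add_two, map_sub, map_add, hF.app_eq_zero, F.app_B, hF.app_eq_zero,
      map_zero, add_zero, sub_zero]
    exact congrFun hc (j + 2)

theorem homotopy_zero {c : ∀ j, C.X j} (hc : F.pi c = 0) :
    (C.bB (shiftMap h c) + shiftMap h (C.bB c)) 0 = c 0 := by
  rw [Pi.add_apply, bB_zero, shiftMap_zero, shiftMap_succ, add_zero]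
  exact hF.b_zero _ (congrFun hc 0)

theorem homotopy_one {c : ∀ j, C.X j} (hc : F.pi c = 0) :
    (C.bB (shiftMap h c) + shiftMap h (C.bB c)) 1 = c 1 := by
  rw [Pi.add_apply, bB_succ, shiftMap_zero, shiftMap_succ, shiftMap_succ, map_zero, add_zero,
    bB_zero]
  exact hF.b_succ 0 _ (congrFun hc 1)

/-- Writing D = b + uB, the commutator Dh + hD on ker F is 1 + u(Bh + hB): the b-part is the given
contraction and the B-part is the perturbation. -/
theorem homotopy_add_two {c : ∀ j, C.X j} (hc : F.pi c = 0) (j : ℕ) :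
    (C.bB (shiftMap h c) + shiftMap h (C.bB c)) (j + 2) =
      c (j + 2) + (C.B (j + 1) (h j (c j)) + h (j + 1) (C.B j (c j))) := by
  rw [Pi.add_apply, bB_succ, shiftMap_succ, shiftMap_succ, shiftMap_succ, bB_succ, map_add]
  conv_rhs => rw [← hF.b_succ (j + 1) (c (j + 2)) (congrFun hc (j + 2))]
  abel

theorem homotopy_perturb {c : ∀ j, C.X j} (hc : F.pi c = 0) :
    C.bB (shiftMap h (perturb h c)) + shiftMap h (C.bB (perturb h c)) = c := by
  have hc' := hF.pi_perturb hc
  funext j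
  match j with
  | 0 => exact hF.homotopy_zero hc'
  | 1 => exact hF.homotopy_one hc'
  | j + 2 => rw [hF.homotopy_add_two hc', perturb_add_two, sub_add_cancel]

/-- Injectivity of 1 + u(Bh + hB) on ker F: each component of c is determined by the component two
steps below. -/
theorem eq_zero_of_homotopy {c : ∀ j, C.X j} (hc : F.pi c = 0)
    (h0 : C.bB (shiftMap h c) + shiftMap h (C.bB c) = 0) : c = 0 := by
  funext j
  induction j using Nat.twoStepInduction with
  | zero => rw [← hF.homotopy_zero hc, h0]
  | one => rw [← hF.homotopy_one hc, h0]
  | more j ih _ =>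
    have := hF.homotopy_add_two hc j
    rw [h0, ih] at this
    simpa using this.symm

/-- Because D² = 0, the operator Q = Dh + hD commutes with D. Hence Q sends both p(Dc) and D(pc) to
Dc, where p = Q⁻¹, and injectivity of Q on ker F gives equality. -/
theorem perturb_bB (hC : C.IsCyclicModule) {c : ∀ j, C.X j} (hc : F.pi c = 0) :
    perturb h (C.bB c) = C.bB (perturb h c) := by
  have hD : ∀ c, F.pi c = 0 → F.pi (C.bB c) = 0 := fun c hc => by
    rw [F.pi_bB, hc, map_zero]
  rw [← sub_eq_zero]
  refine hF.eq_zero_of_homotopy ?_ ?_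
  · rw [map_sub, hF.pi_perturb (hD c hc), hD _ (hF.pi_perturb hc), sub_zero]
  · have h1 := hF.homotopy_perturb (hD c hc)
    have h2 := congrArg C.bB (hF.homotopy_perturb hc)
    rw [map_add, hC.bB_bB, zero_add] at h2
    rw [map_sub, map_sub, map_sub, map_sub, sub_add_sub_comm, h1, hC.bB_bB, map_zero, add_zero,
      h2, sub_self]

theorem homotopy (hC : C.IsCyclicModule) {c : ∀ j, C.X j} (hc : F.pi c = 0) :
    C.bB (shiftMap h (perturb h c)) + shiftMap h (perturb h (C.bB c)) = c := by
  rw [hF.perturb_bB hC hc, hF.homotopy_perturb hc]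

end IsKernelContraction

/-- A degreewise split surjective morphism of cyclic modules whose kernel is contractible for the
Hochschild boundary induces isomorphisms on cyclic homology with all coefficients. -/
theorem IsKernelContraction.HCMap_bijective {h : ∀ n, C.X n →ₗ[k] C.X (n + 1)} {F : Hom C C'}
    (hF : IsKernelContraction F h) (hC : C.IsCyclicModule) (s : ∀ n, C'.X n →ₗ[k] C.X n)
    (hs : ∀ n c, F.app n (s n c) = c) (W : GradedUModule.{u, x} k) (n : ℤ) :
    Function.Bijective (F.HCMap (GradedUModule.Hom.id W) n) := by
  -- A degreewise section of F; it need not commute with the differential.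
  let S : (∀ j, C'.X j) →ₗ[k] (∀ j, C.X j) := LinearMap.pi fun j => s j ∘ₗ LinearMap.proj j
  have hS : ∀ n, ∀ c ∈ C'.ps n, S c ∈ C.ps (n + 0) := fun n c hc j hj => by
    rw [add_zero]
    exact hc j fun h0 => hj (by change s j (c j) = 0; rw [h0, map_zero])
  have hFS : ∀ c, F.pi (S c) = c := fun c => funext fun j => hs j (c j)
  let hb := boxMap W 1 (shiftMap h ∘ₗ perturb h)
    (fun n c hc => shiftMap_mem h n _ (perturb_mem h n c hc))
  let sb := boxMap W 0 S hS
  let Fb := F.box (GradedUModule.Hom.id W)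
  have h1 : ∀ z, Fb (sb z) = z := by
    intro z
    suffices e : Fb ∘ₗ sb = LinearMap.id from LinearMap.congr_fun e z
    refine box_ext fun n c hc m => ?_
    rw [LinearMap.comp_apply, boxMap_boxOf, Hom.box_boxOf]
    exact boxOf_congr (add_zero n) (hFS c) _ _ m
  have h2 : ∀ z, Fb (hb z) = 0 := by
    intro z
    suffices e : Fb ∘ₗ hb = 0 from LinearMap.congr_fun e z
    refine box_ext fun n c hc m => ?_
    rw [LinearMap.comp_apply, boxMap_boxOf, Hom.box_boxOf]
    exact (boxOf_congr rfl (hF.pi_shiftMap _) _ (Submodule.zero_mem _) m).trans (boxOf_zero m)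
  -- Tensoring with W need not preserve injections, so the kernel of F on X ⊠ W is reached through
  -- the projection 1 - sF. On generators this leads back to families c - S(F c), which F kills.
  have h3 : ∀ z, C.boxDiff W (hb (z - sb (Fb z))) + hb (C.boxDiff W (z - sb (Fb z))) =
      z - sb (Fb z) := by
    intro z
    suffices e : C.boxDiff W ∘ₗ hb ∘ₗ (LinearMap.id - sb ∘ₗ Fb) +
      hb ∘ₗ C.boxDiff W ∘ₗ (LinearMap.id - sb ∘ₗ Fb) = LinearMap.id - sb ∘ₗ Fb from
      LinearMap.congr_fun e z
    refine box_ext fun n c hc m => ?_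
    have hSc : S (F.pi c) ∈ C.ps n := by
      have := hS n _ (F.pi_mem n c hc)
      rwa [add_zero] at this
    have hq : (LinearMap.id - sb ∘ₗ Fb : C.Box W →ₗ[k] C.Box W) (boxOf n c hc m) =
        boxOf n (c - S (F.pi c)) ((C.ps n).sub_mem hc hSc) m := by
      rw [← boxOf_sub hc hSc, LinearMap.sub_apply, LinearMap.id_apply, LinearMap.comp_apply,
        Hom.box_boxOf, boxMap_boxOf]
      exact congrArg _ (boxOf_congr (add_zero n) rfl _ _ m)
    have hp : F.pi (c - S (F.pi c)) = 0 := by rw [map_sub, hFS, sub_self]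
    have e := hF.homotopy hC hp
    have m1 : C.bB (shiftMap h (perturb h (c - S (F.pi c)))) ∈ C.ps n := by
      have := C.bB_mem _ _ (shiftMap_mem h n _ (perturb_mem h n _ ((C.ps n).sub_mem hc hSc)))
      rwa [add_sub_cancel_right] at this
    have m2 : shiftMap h (perturb h (C.bB (c - S (F.pi c)))) ∈ C.ps n := by
      have := shiftMap_mem h _ _ (perturb_mem h _ _ (C.bB_mem n _ ((C.ps n).sub_mem hc hSc)))
      rwa [sub_add_cancel] at this
    rw [LinearMap.add_apply, LinearMap.comp_apply, LinearMap.comp_apply, LinearMap.comp_apply,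
      LinearMap.comp_apply, hq, boxMap_boxOf, boxDiff_boxOf, boxDiff_boxOf, boxMap_boxOf]
    refine (congrArg₂ (· + ·) (boxOf_congr (add_sub_cancel_right n 1) rfl _ m1 m)
      (boxOf_congr (sub_add_cancel n 1) rfl _ m2 m)).trans ?_
    rw [boxOf_add]
    exact boxOf_congr rfl e _ _ m
  have h4 : ∀ z, Fb z = 0 → C.boxDiff W (hb z) + hb (C.boxDiff W z) = z := by
    intro z hz
    have := h3 z
    rwa [hz, map_zero, sub_zero] at this
  have hFD : ∀ z, Fb (C.boxDiff W z) = C'.boxDiff W (Fb z) := fun z => F.box_boxDiff _ z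
  have hDD : ∀ z, C.boxDiff W (C.boxDiff W z) = 0 := fun z => hC.boxDiff_boxDiff z
  constructor
  · rw [injective_iff_map_eq_zero]
    intro z hz
    obtain ⟨⟨z, hz1, hz2⟩, rfl⟩ := Submodule.mkQ_surjective _ z
    have hz1 : C.boxDiff W z = 0 := hz1
    obtain ⟨y, hy, hyz⟩ := (Submodule.Quotient.mk_eq_zero _).1 hz
    have hyz : C'.boxDiff W y = Fb z := hyz
    refine (Submodule.Quotient.mk_eq_zero _).2 ?_
    -- If F z bounds y, then z - D(s y) is a cycle in the kernel of F and so bounds.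
    have h5 := h4 (z - C.boxDiff W (sb y)) (by rw [map_sub, hFD, h1, hyz, sub_self])
    rw [map_sub (C.boxDiff W), hz1, hDD, sub_zero, map_zero, add_zero] at h5
    refine ⟨sb y + hb (z - C.boxDiff W (sb y)), ?_, ?_⟩
    · have h6 : sb y ∈ C.boxGr W (n + 1) := boxMap_mem 0 S hS (add_zero _) y hy
      exact Submodule.add_mem _ h6 (boxMap_mem 1 _ _ rfl _
        (Submodule.sub_mem _ hz2 (boxDiff_mem (add_sub_cancel_right n 1) _ h6)))
    · change C.boxDiff W _ = z
      rw [map_add, h5, add_sub_cancel]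
  · intro z'
    obtain ⟨⟨z', hz1, hz2⟩, rfl⟩ := Submodule.mkQ_surjective _ z'
    have hz1 : C'.boxDiff W z' = 0 := hz1
    -- The defect D(s z') is a cycle in the kernel of F. It is the boundary of h D(s z'), an element
    -- killed by F, whose subtraction makes s z' a cycle over z'.
    have h5 := h4 (C.boxDiff W (sb z')) (by rw [hFD, h1, hz1])
    rw [hDD, map_zero, add_zero] at h5
    have h6 : sb z' ∈ C.boxGr W n := boxMap_mem 0 S hS (add_zero _) z' hz2
    refine ⟨Submodule.Quotient.mk ⟨sb z' - hb (C.boxDiff W (sb z')), ?_, ?_⟩, ?_⟩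
    · change C.boxDiff W _ = 0
      rw [map_sub, h5, sub_self]
    · exact Submodule.sub_mem _ h6 (boxMap_mem 1 _ _ (sub_add_cancel n 1) _
        (boxDiff_mem rfl _ h6))
    · refine congrArg (Submodule.mkQ _) (Subtype.ext ?_)
      change Fb (sb z' - hb (C.boxDiff W (sb z'))) = z'
      rw [map_sub, h1, h2, sub_zero]

/-- Composition of induced maps on cyclic homology. -/
theorem HCMap_comm {C₁ C₂ C₁' C₂' : CyclicData.{u, v} k} (F : Hom C₁ C₂) (F' : Hom C₁' C₂')
    (G : Hom C₁ C₁') (G' : Hom C₂ C₂') (e : ∀ n c, F'.app n (G.app n c) = G'.app n (F.app n c))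
    {W W' : GradedUModule.{u, x} k} (f : GradedUModule.Hom W W') (n : ℤ) (z : C₁.HC W n) :
    F'.HCMap (GradedUModule.Hom.id W') n (G.HCMap f n z) =
      G'.HCMap f n (F.HCMap (GradedUModule.Hom.id W) n z) := by
  obtain ⟨z, rfl⟩ := Submodule.mkQ_surjective _ z
  refine congrArg (Submodule.mkQ _) (Subtype.ext ?_)
  suffices e : F'.box (GradedUModule.Hom.id W') ∘ₗ G.box f =
      G'.box f ∘ₗ F.box (GradedUModule.Hom.id W) from LinearMap.congr_fun e z.1
  refine box_ext fun n c hc m => ?_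
  rw [LinearMap.comp_apply, LinearMap.comp_apply, Hom.box_boxOf, Hom.box_boxOf, Hom.box_boxOf,
    Hom.box_boxOf]
  exact boxOf_congr rfl (funext fun j => e j (c j)) _ _ _

end Perturbation
end CyclicData

/-! ### Recursion along the last tensor factor. -/

section Tensor

variable {k : Type u} [CommRing k] {R : Type v} [Ring R] [Algebra k R]

/-- The linear map on `R^{⊗(n+1)}` with prescribed values on `snoc`. -/
def snocLift {n : ℕ} {M : Type w} [AddCommGroup M] [Module k M]
    (φ : (⨂[k]^n R) →ₗ[k] R →ₗ[k] M) : (⨂[k]^(n + 1) R) →ₗ[k] M :=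
  PiTensorProduct.lift (MultilinearMap.uncurryRight
    (φ.compMultilinearMap (PiTensorProduct.tprod k)))

@[simp] theorem snocLift_snoc {n : ℕ} {M : Type w} [AddCommGroup M] [Module k M]
    (φ : (⨂[k]^n R) →ₗ[k] R →ₗ[k] M) (t : ⨂[k]^n R) (a : R) :
    snocLift φ (snoc k n t a) = φ t a := by
  suffices h : snocLift φ ∘ₗ (snoc k n).flip a = φ.flip a from LinearMap.congr_fun h t
  refine PiTensorProduct.ext (MultilinearMap.ext fun x => ?_)
  simp only [LinearMap.compMultilinearMap_apply, LinearMap.comp_apply, LinearMap.flip_apply,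
    snoc_tprod, snocLift, PiTensorProduct.lift.tprod, MultilinearMap.uncurryRight_apply,
    Fin.init_snoc, Fin.snoc_last]

theorem snoc_induction {n : ℕ} {p : (⨂[k]^(n + 1) R) → Prop}
    (hadd : ∀ s t, p s → p t → p (s + t)) (hsnoc : ∀ t a, p (snoc k n t a))
    (t : ⨂[k]^(n + 1) R) : p t := by
  have h : ∀ (r : k) (a : Fin (n + 1) → R), p (r • PiTensorProduct.tprod k a) := fun r a => by
    have := hsnoc (r • PiTensorProduct.tprod k (Fin.init a)) (a (Fin.last n))
    rwa [map_smul, LinearMap.smul_apply, snoc_tprod, Fin.snoc_init_self] at this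
  induction t using PiTensorProduct.induction_on with
  | smul_tprod r a => exact h r a
  | add s t hs ht => exact hadd s t hs ht

end Tensor

/-! ### Moving H to the right: the map `collect`. -/

section CrossedChains

open Coalgebra HopfAlgebra

set_option linter.unusedSectionVars false

variable {k : Type u} [CommRing k] {H : Type v} [Ring H] [Bialgebra k H]
variable {A : Type w} [Ring A] [Algebra k A] [Module H A] [IsScalarTower k H A]

namespace CrossedProduct

variable [HModuleAlgebra k H A]

/-- The element `a ⊗ g` of `A ⋊ H`. -/
def of (a : A) (g : H) : CrossedProduct k H A := a ⊗ₜ[k] g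

theorem induction {p : CrossedProduct k H A → Prop} (h0 : p 0)
    (hadd : ∀ x y, p x → p y → p (x + y)) (hof : ∀ a g, p (of a g)) (x : CrossedProduct k H A) :
    p x :=
  TensorProduct.induction_on (motive := p) x h0 hof hadd

theorem of_mul (a : A) (g : H) (x : CrossedProduct k H A) :
    of a g * x = leftMul k H A a (rightMul k H A g x) := rfl

theorem of_mul_of_one (a : A) (g h : H) :
    (of a g : CrossedProduct k H A) * of 1 h = of a (g * h) := by
  change mulMap k H A (a ⊗ₜ g) (1 ⊗ₜ h) = a ⊗ₜ (g * h)
  rw [mulMap_tmul_tmul]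
  simp only [HModuleAlgebra.smul_one_eq (k := k) (A := A), mul_one, Algebra.algebraMap_eq_smul_one,
    mul_smul_comm, TensorProduct.smul_tmul, ← TensorProduct.tmul_sum, ← smul_mul_assoc,
    ← Finset.sum_mul, sum_counit_smul]

theorem of_one_mul (h : H) (x : CrossedProduct k H A) : of 1 h * x = rightMul k H A h x := by
  rw [of_mul]
  have h1 : leftMul k H A 1 = LinearMap.id := by
    refine TensorProduct.ext' fun a g => ?_
    change (1 * a) ⊗ₜ[k] g = _
    rw [one_mul]; rfl
  rw [h1]
  rfl

end CrossedProduct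

/-- `c ⊗ l ↦ (l | s, c)`. -/
def snocSwap (n : ℕ) (s : ⨂[k]^n A) : (A ⊗[k] H) →ₗ[k] H ⊗[k] ⨂[k]^(n + 1) A :=
  (TensorProduct.comm k (⨂[k]^(n + 1) A) H).toLinearMap ∘ₗ (snoc k n s).rTensor H

theorem snocSwap_tmul (n : ℕ) (s : ⨂[k]^n A) (c : A) (l : H) :
    snocSwap n s (c ⊗ₜ l) = l ⊗ₜ[k] snoc k n s c := rfl

variable (k H A) in
/-- The left action `h · (l | s) = (h_{(1)} l | h_{(0)} · s)` of `H` on `H ⊗ A^{⊗n}`. -/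
def chainAct (n : ℕ) : H →ₗ[k] Module.End k (H ⊗[k] ⨂[k]^n A) :=
  sweedler ((TensorProduct.mapBilinear (.id k) H (⨂[k]^n A) H (⨂[k]^n A)).flip.compl₁₂
    (diagAct k H A n) (LinearMap.mul k H))

theorem chainAct_tmul (n : ℕ) (h l : H) (s : ⨂[k]^n A) : chainAct k H A n h (l ⊗ₜ s) =
    ∑ i ∈ (ℛ k h).index, ((ℛ k h).right i * l) ⊗ₜ[k] diagAct k H A n ((ℛ k h).left i) s := by
  rw [chainAct, sweedler_apply, LinearMap.sum_apply]
  rfl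

theorem chainAct_one_tmul_zero (h : H) (s : ⨂[k]^0 A) :
    chainAct k H A 0 h (1 ⊗ₜ s) = h ⊗ₜ s := by
  rw [chainAct_tmul]
  simp only [diagAct_zero, mul_one, TensorProduct.tmul_smul, TensorProduct.smul_tmul',
    ← TensorProduct.sum_tmul, sum_counit_smul]

theorem chainAct_snocSwap (n : ℕ) (h : H) (s : ⨂[k]^n A) (x : A ⊗[k] H) :
    chainAct k H A (n + 1) h (snocSwap n s x) = ∑ i ∈ (ℛ k h).index,
      snocSwap n (diagAct k H A n ((ℛ k h).left i) s)
        (CrossedProduct.rightMul k H A ((ℛ k h).right i) x) := by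
  induction x using TensorProduct.induction_on with
  | zero => simp only [map_zero, Finset.sum_const_zero]
  | add x y hx hy => simp only [map_add, hx, hy, Finset.sum_add_distrib]
  | tmul c l =>
    have := sweedler_coassoc (((snoc k n ∘ₗ (diagAct k H A n).flip s).compl₂
      ((actMap k H A).flip c)).compr₂
        (TensorProduct.mk k H (⨂[k]^(n + 1) A) ∘ₗ LinearMap.mulRight k l).flip) h
    simp only [snocSwap_tmul, chainAct_tmul, diagAct_snoc, CrossedProduct.rightMul_tmul, map_sum,
      TensorProduct.tmul_sum]
    exact this

variable [HModuleAlgebra k H A]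

variable (k H A) in
/-- `(l | s) ⋆ (a ⊗ g) = (l_{(1)} g | s, l_{(0)} · a)`. -/
def chainMul (n : ℕ) :
    (H ⊗[k] ⨂[k]^n A) →ₗ[k] CrossedProduct k H A →ₗ[k] H ⊗[k] ⨂[k]^(n + 1) A :=
  let P : (A →ₗ[k] ⨂[k]^(n + 1) A) →ₗ[k] (A ⊗[k] H) →ₗ[k] H ⊗[k] ⨂[k]^(n + 1) A :=
    LinearMap.compRight k (TensorProduct.comm k (⨂[k]^(n + 1) A) H).toLinearMap ∘ₗ
      LinearMap.rTensorHom H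
  (TensorProduct.lift (((LinearMap.llcomp k (A ⊗[k] H) (A ⊗[k] H) (H ⊗[k] ⨂[k]^(n + 1) A)).compl₁₂
    (P ∘ₗ snoc k n) (CrossedProduct.rightMul k H A)).flip) :
      (H ⊗[k] ⨂[k]^n A) →ₗ[k] (A ⊗[k] H) →ₗ[k] H ⊗[k] ⨂[k]^(n + 1) A)

theorem chainMul_tmul (n : ℕ) (l : H) (s : ⨂[k]^n A) (x : CrossedProduct k H A) :
    chainMul k H A n (l ⊗ₜ s) x = snocSwap n s (CrossedProduct.rightMul k H A l x) := rfl

theorem chainMul_tmul_of (n : ℕ) (l g : H) (s : ⨂[k]^n A) (a : A) :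
    chainMul k H A n (l ⊗ₜ s) (.of a g) = ∑ i ∈ (ℛ k l).index,
      ((ℛ k l).right i * g) ⊗ₜ[k] snoc k n s ((ℛ k l).left i • a) := by
  rw [chainMul_tmul, CrossedProduct.of, CrossedProduct.rightMul_tmul, map_sum]
  rfl

/-- Associativity of the crossed product in disguise: l passes over x y by acting on the A-part of x
and then moving on to y. -/
theorem mulFace_last_chainMul_chainMul (n : ℕ) (z : H ⊗[k] ⨂[k]^n A) (x y : CrossedProduct k H A) :
    (mulFace k (Fin.last n)).lTensor H (chainMul k H A (n + 1) (chainMul k H A n z x) y) =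
      chainMul k H A n z (x * y) := by
  induction z using TensorProduct.induction_on with
  | zero => simp only [map_zero, LinearMap.zero_apply]
  | add z z' hz hz' => simp only [map_add, LinearMap.add_apply, hz, hz']
  | tmul l s =>
    have h1 : ∀ (c : A) (w : A ⊗[k] H), (mulFace k (Fin.last n)).lTensor H
        (snocSwap (n + 1) (snoc k n s c) w) =
          snocSwap n s (CrossedProduct.leftMul k H A c w) := by
      intro c w
      induction w using TensorProduct.induction_on with
      | zero => simp only [map_zero]
      | add w w' hw hw' => simp only [map_add, hw, hw']
      | tmul d h =>
        rw [snocSwap_tmul, LinearMap.lTensor_tmul, mulFace_last_snoc_snoc]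
        rfl
    induction x using CrossedProduct.induction with
    | h0 => simp only [map_zero, LinearMap.zero_apply, zero_mul]
    | hadd x x' hx hx' => simp only [map_add, LinearMap.add_apply, hx, hx', add_mul]
    | hof a g =>
      rw [chainMul_tmul_of, map_sum, LinearMap.sum_apply, map_sum, chainMul_tmul]
      refine Eq.trans ?_ (congrArg (snocSwap n s) (CrossedProduct.rightMul_leftMul l a
        (CrossedProduct.rightMul k H A g y)).symm)
      rw [map_sum]
      refine Finset.sum_congr rfl fun i _ => ?_
      rw [chainMul_tmul, h1]
      exact congrArg _ (congrArg _ (CrossedProduct.rightMul_mul _ _ y))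

/-- The operation ⋆ works from the right and the action of H from the left, so they commute; this is
multiplicativity of the action of H on A ⊗ H. -/
theorem chainAct_chainMul (n : ℕ) (h : H) (z : H ⊗[k] ⨂[k]^n A) (x : CrossedProduct k H A) :
    chainAct k H A (n + 1) h (chainMul k H A n z x) =
      chainMul k H A n (chainAct k H A n h z) x := by
  induction z using TensorProduct.induction_on with
  | zero => simp only [map_zero, LinearMap.zero_apply]
  | add z z' hz hz' => simp only [map_add, LinearMap.add_apply, hz, hz']
  | tmul l s =>
    rw [chainMul_tmul, chainAct_snocSwap, chainAct_tmul, map_sum, LinearMap.sum_apply]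
    refine Finset.sum_congr rfl fun i _ => ?_
    rw [chainMul_tmul]
    exact congrArg _ (CrossedProduct.rightMul_mul _ _ x).symm

/-- An operator on the A-factors that leaves the last one alone passes through ⋆. This drives every
induction along `snoc` for `collect`. -/
theorem lTensor_chainMul {m n : ℕ} (φ : (⨂[k]^m A) →ₗ[k] ⨂[k]^n A)
    (ψ : (⨂[k]^(m + 1) A) →ₗ[k] ⨂[k]^(n + 1) A)
    (h : ∀ t a, ψ (snoc k m t a) = snoc k n (φ t) a) (z : H ⊗[k] ⨂[k]^m A)
    (x : CrossedProduct k H A) :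
    ψ.lTensor H (chainMul k H A m z x) = chainMul k H A n (φ.lTensor H z) x := by
  induction z using TensorProduct.induction_on with
  | zero => simp only [map_zero, LinearMap.zero_apply]
  | add z z' hz hz' => simp only [map_add, LinearMap.add_apply, hz, hz']
  | tmul l s =>
    induction x using CrossedProduct.induction with
    | h0 => simp only [map_zero]
    | hadd x x' hx hx' => simp only [map_add, hx, hx']
    | hof a g => simp only [chainMul_tmul_of, LinearMap.lTensor_tmul, map_sum, h]

theorem chainMul_of_mul (n : ℕ) (z : H ⊗[k] ⨂[k]^n A) (x : CrossedProduct k H A) (h : H) :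
    chainMul k H A n z (x * .of 1 h) =
      (LinearMap.mulRight k h).rTensor _ (chainMul k H A n z x) := by
  induction z using TensorProduct.induction_on with
  | zero => simp only [map_zero, LinearMap.zero_apply]
  | add z z' hz hz' => simp only [map_add, LinearMap.add_apply, hz, hz']
  | tmul l s =>
    induction x using CrossedProduct.induction with
    | h0 => simp only [map_zero, zero_mul]
    | hadd x x' hx hx' => simp only [map_add, add_mul, hx, hx']
    | hof a g =>
      simp only [CrossedProduct.of_mul_of_one, chainMul_tmul_of, map_sum, LinearMap.rTensor_tmul,
        LinearMap.mulRight_apply, mul_assoc]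

theorem chainMul_one (n : ℕ) (z : H ⊗[k] ⨂[k]^n A) :
    chainMul k H A n z 1 = (insertOne k (Fin.last n)).lTensor H z := by
  induction z using TensorProduct.induction_on with
  | zero => simp only [map_zero, LinearMap.zero_apply]
  | add z z' hz hz' => simp only [map_add, LinearMap.add_apply, hz, hz']
  | tmul l s =>
    have := chainMul_tmul_of n l 1 s (1 : A)
    simp only [HModuleAlgebra.smul_one_eq (k := k) (A := A), Algebra.algebraMap_eq_smul_one,
      map_smul, mul_one, TensorProduct.tmul_smul, TensorProduct.smul_tmul',
      ← TensorProduct.sum_tmul, sum_counit_smul] at this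
    rw [LinearMap.lTensor_tmul, insertOne_last]
    exact this

variable (k H A) in
/-- `(a_0 ⊗ g_0, …, a_{n-1} ⊗ g_{n-1}) ↦ (1 | ) ⋆ (a_0 ⊗ g_0) ⋆ ⋯ ⋆ (a_{n-1} ⊗ g_{n-1})`. -/
def collect : ∀ n : ℕ, (⨂[k]^n (CrossedProduct k H A)) →ₗ[k] H ⊗[k] ⨂[k]^n A
  | 0 => PiTensorProduct.lift
      (MultilinearMap.constOfIsEmpty k _ ((1 : H) ⊗ₜ[k] PiTensorProduct.tprod k Fin.elim0))
  | n + 1 => snocLift (chainMul k H A n ∘ₗ collect n)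

theorem collect_snoc (n : ℕ) (t : ⨂[k]^n (CrossedProduct k H A)) (x : CrossedProduct k H A) :
    collect k H A (n + 1) (snoc k n t x) = chainMul k H A n (collect k H A n t) x := by
  rw [collect, snocLift_snoc]
  rfl

/-- Inner faces precede the last appended factor and commute with ⋆; the outermost one is the
associativity of ⋆. -/
theorem collect_mulFace {n : ℕ} (i : Fin n) (t : ⨂[k]^(n + 1) (CrossedProduct k H A)) :
    collect k H A n (mulFace k i t) = (mulFace k i).lTensor H (collect k H A (n + 1) t) := by
  induction n with
  | zero => exact i.elim0
  | succ n ih =>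
    induction t using snoc_induction with
    | hadd s t hs ht => simp only [map_add, hs, ht]
    | hsnoc t y =>
      refine Fin.lastCases ?_ (fun i => ?_) i
      · induction t using snoc_induction with
        | hadd s t hs ht => simp only [map_add, LinearMap.add_apply, hs, ht]
        | hsnoc t x =>
          rw [mulFace_last_snoc_snoc, collect_snoc, collect_snoc, collect_snoc,
            mulFace_last_chainMul_chainMul]
      · rw [mulFace_castSucc_snoc, collect_snoc, collect_snoc, ih,
          lTensor_chainMul _ _ (mulFace_castSucc_snoc i)]

theorem collect_insertOne {n : ℕ} (i : Fin (n + 1)) (t : ⨂[k]^n (CrossedProduct k H A)) :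
    collect k H A (n + 1) (insertOne k i t) = (insertOne k i).lTensor H (collect k H A n t) := by
  have last : ∀ (n : ℕ) (t : ⨂[k]^n (CrossedProduct k H A)),
      collect k H A (n + 1) (insertOne k (Fin.last n) t) =
        (insertOne k (Fin.last n)).lTensor H (collect k H A n t) := by
    intro n t
    rw [insertOne_last, collect_snoc, chainMul_one]
  induction n with
  | zero =>
    rw [show i = Fin.last 0 from Fin.ext (by simp)]
    exact last 0 t
  | succ n ih =>
    refine Fin.lastCases (last _ t) (fun i => ?_) i
    induction t using snoc_induction with
    | hadd s t hs ht => simp only [map_add, hs, ht]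
    | hsnoc t x =>
      rw [insertOne_castSucc_snoc, collect_snoc, collect_snoc, ih,
        lTensor_chainMul _ _ (insertOne_castSucc_snoc i)]

/-- Reads `collect` from the left: the first factor contributes a in front, and its g acts on
everything collected after it. -/
theorem collect_cons (n : ℕ) (t : ⨂[k]^n (CrossedProduct k H A)) (a : A) (g : H) :
    collect k H A (n + 1) (cons k n (.of a g) t) =
      (cons k n a).lTensor H (chainAct k H A n g (collect k H A n t)) := by
  induction n with
  | zero =>
    rw [cons_eq_snoc_zero, collect_snoc]
    induction t using PiTensorProduct.induction_on with
    | add s t hs ht => simp only [map_add, LinearMap.add_apply, hs, ht]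
    | smul_tprod r x =>
      have h1 : collect k H A 0 (PiTensorProduct.tprod k x) =
          (1 : H) ⊗ₜ[k] PiTensorProduct.tprod k Fin.elim0 := PiTensorProduct.lift.tprod _
      simp only [map_smul, LinearMap.smul_apply, h1, chainAct_one_tmul_zero]
      rw [chainMul_tmul, LinearMap.lTensor_tmul, cons_eq_snoc_zero]
      exact congrArg (r • snocSwap 0 _ ·) (CrossedProduct.rightMul_one (a ⊗ₜ[k] g))
  | succ n ih =>
    induction t using snoc_induction with
    | hadd s t hs ht => simp only [map_add, hs, ht]
    | hsnoc t x =>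
      rw [cons_snoc, collect_snoc, collect_snoc, ih, chainAct_chainMul,
        lTensor_chainMul (cons k n a) (cons k (n + 1) a) fun t b => cons_snoc n a b t]

/-- `(x_0, …, x_n) ↦ (h x_0, …, x_n)` becomes the left action of `H`. -/
theorem collect_mulFace_zero_cons (n : ℕ) (h : H) (t : ⨂[k]^(n + 1) (CrossedProduct k H A)) :
    collect k H A (n + 1) (mulFace k 0 (cons k (n + 1) (.of 1 h) t)) =
      chainAct k H A (n + 1) h (collect k H A (n + 1) t) := by
  rw [collect_mulFace, collect_cons, ← LinearMap.lTensor_comp_apply]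
  have : mulFace k 0 ∘ₗ cons k (n + 1) (1 : A) = LinearMap.id := cons_ext fun a t => by
    rw [LinearMap.comp_apply, mulFace_zero_cons_cons, one_mul, LinearMap.id_apply]
  rw [this, LinearMap.lTensor_id, LinearMap.id_apply]

end CrossedChains

/-! ### The morphism from C(A ⋊ H) to C^H(A). -/

section EquivariantMap

open Coalgebra HopfAlgebra

set_option linter.unusedSectionVars false

variable {k : Type u} [CommRing k] {H : Type v} [Ring H] [HopfAlgebra k H]
variable {A : Type w} [Ring A] [Algebra k A] [Module H A] [IsScalarTower k H A]

/-- The coinvariants glue the two ends of the chain: right multiplication by h on the H-factor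
becomes its left action. -/
theorem rTensor_mulRight_sub_chainAct_mem (n : ℕ) (h : H) (z : H ⊗[k] ⨂[k]^n A) :
    (LinearMap.mulRight k h).rTensor _ z - chainAct k H A n h z ∈ coinvRel k H A n := by
  induction z using TensorProduct.induction_on with
  | zero => simp only [map_zero, sub_zero, Submodule.zero_mem]
  | add z z' hz hz' =>
    rw [map_add, map_add, add_sub_add_comm]
    exact Submodule.add_mem _ hz hz'
  | tmul g t =>
    rw [chainAct_tmul]
    exact coinvRel_swap n g h t

variable [HModuleAlgebra k H A] (hS : Function.Bijective (antipode k (A := H)))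

/-- τ undoes the action that ⋆ put on the last factor: (l_(1) | s, l_(0)·a) goes to (l_(2) |
S⁻¹(l_(1)) l_(0)·a, s) = (l | a, s). -/
theorem twist_chainMul_of_one (n : ℕ) (z : H ⊗[k] ⨂[k]^n A) (a : A) :
    twist A hS n (chainMul k H A n z (.of a 1)) = (cons k n a).lTensor H z := by
  induction z using TensorProduct.induction_on with
  | zero => simp only [map_zero, LinearMap.zero_apply]
  | add z z' hz hz' => simp only [map_add, LinearMap.add_apply, hz, hz']
  | tmul l s =>
    have := sweedler_coassoc (((LinearMap.mul k H).flip.compl₂ (antipodeInv hS)).compr₂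
      ((TensorProduct.mk k H (⨂[k]^(n + 1) A)).flip ∘ₗ (cons k n).flip s ∘ₗ
        (actMap k H A).flip a)) l
    simp only [LinearMap.compr₂_apply, LinearMap.compl₂_apply, LinearMap.flip_apply,
      LinearMap.mul_apply'] at this
    simp only [← map_sum, ← LinearMap.sum_apply, sum_antipodeInv_right_mul] at this
    simp only [map_smul, LinearMap.smul_apply] at this
    simp only [← map_smul, ← map_sum, sum_counit_smul] at this
    simp only [chainMul_tmul_of, map_sum, twist_snoc, mul_one, ← mul_smul]
    refine this.symm.trans ?_
    rw [LinearMap.lTensor_tmul]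
    exact congrArg (fun b => l ⊗ₜ[k] cons k n b s) (one_smul H a)

/-- Let z be the collected form of t. For the last factor a ⊗ g, the chain is z ⋆ (a ⊗ 1) multiplied
by g on the right. Modulo coinvariants this is g·(z ⋆ (a ⊗ 1)) = (g·z) ⋆ (a ⊗ 1), which τ sends to
g·z with a in front: the collected form of the rotated chain. -/
theorem collect_rotate_sub_twist_mem (n : ℕ) (t : ⨂[k]^(n + 1) (CrossedProduct k H A)) :
    collect k H A (n + 1) (rotate k (n + 1) t) - twist A hS n (collect k H A (n + 1) t) ∈
      coinvRel k H A (n + 1) := by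
  induction t using snoc_induction with
  | hadd s t hs ht =>
    rw [map_add, map_add, map_add, map_add, add_sub_add_comm]
    exact Submodule.add_mem _ hs ht
  | hsnoc t x =>
    induction x using CrossedProduct.induction with
    | h0 => simp only [map_zero, sub_zero, Submodule.zero_mem]
    | hadd x y hx hy =>
      rw [map_add, map_add, map_add, map_add, map_add, add_sub_add_comm]
      exact Submodule.add_mem _ hx hy
    | hof a g =>
      have h1 := coinvRel_le_twist hS n (rTensor_mulRight_sub_chainAct_mem (n + 1) g
        (chainMul k H A n (collect k H A n t) (.of a 1)))
      rw [Submodule.mem_comap, map_sub, chainAct_chainMul, twist_chainMul_of_one,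
        ← chainMul_of_mul, CrossedProduct.of_mul_of_one, one_mul] at h1
      rw [rotate_snoc, collect_cons, collect_snoc, ← neg_sub]
      exact Submodule.neg_mem _ h1

theorem mkQ_collect_algebraFace (n : ℕ) (i : Fin (n + 2))
    (t : ⨂[k]^(n + 2) (CrossedProduct k H A)) :
    (coinvRel k H A (n + 1)).mkQ (collect k H A (n + 1) (algebraFace k _ n i t)) =
      equivariantFace k A hS n i ((coinvRel k H A (n + 2)).mkQ (collect k H A (n + 2) t)) := by
  refine Fin.lastCases ?_ (fun i => ?_) i
  · simp only [equivariantFace, algebraFace_last, Fin.lastCases_last, LinearMap.comp_apply]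
    rw [collect_mulFace]
    refine (Submodule.Quotient.eq _).2 ?_
    have := coinvRel_le_lTensor _ _ (mulFace k 0) (fun h t => diagAct_mulFace 0 h t)
      (collect_rotate_sub_twist_mem hS (n + 1) t)
    rwa [Submodule.mem_comap, map_sub] at this
  · simp only [equivariantFace, algebraFace_castSucc, Fin.lastCases_castSucc]
    exact congrArg (Submodule.mkQ _) (collect_mulFace i t)

variable (A) in
/-- The morphism of cyclic modules `C_•(A ⋊ H) → C^H_•(A)`. -/
def collectHom : (algebraCyclic k (CrossedProduct k H A)).Hom (equivariantCyclic k A hS) where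
  app n := (coinvRel k H A (n + 1)).mkQ ∘ₗ collect k H A (n + 1)
  app_face n i c := mkQ_collect_algebraFace hS n i c
  app_degen n i c := congrArg (Submodule.mkQ _) (collect_insertOne i.succ c)
  app_cyc n c := (Submodule.Quotient.eq _).2 (collect_rotate_sub_twist_mem hS n c)

end EquivariantMap

/-! ### The separability homotopy on Hochschild chains. -/

section Homotopy

variable {k : Type u} [CommRing k] {R : Type v} [Ring R] [Algebra k R]

/-- `(a_0, …, a_n), b ↦ (a_0, …, a_n b)`. -/
def mulLast (n : ℕ) : (⨂[k]^(n + 1) R) →ₗ[k] R →ₗ[k] ⨂[k]^(n + 1) R :=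
  (snoc k (n + 1)).compr₂ (mulFace k (Fin.last n))

/-- `b, (a_0, …, a_n) ↦ (b a_0, …, a_n)`. -/
def mulFirst (n : ℕ) : R →ₗ[k] (⨂[k]^(n + 1) R) →ₗ[k] ⨂[k]^(n + 1) R :=
  (cons k (n + 1)).compr₂ (mulFace k 0)

theorem mulLast_apply (n : ℕ) (t : ⨂[k]^(n + 1) R) (b : R) :
    mulLast n t b = mulFace k (Fin.last n) (snoc k (n + 1) t b) := rfl

theorem mulFirst_apply (n : ℕ) (t : ⨂[k]^(n + 1) R) (b : R) :
    mulFirst n b t = mulFace k 0 (cons k (n + 1) b t) := rfl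

theorem mulLast_snoc (n : ℕ) (t : ⨂[k]^n R) (a b : R) :
    mulLast n (snoc k n t a) b = snoc k n t (a * b) := mulFace_last_snoc_snoc t a b

theorem mulFirst_cons (n : ℕ) (t : ⨂[k]^n R) (a b : R) :
    mulFirst n b (cons k n a t) = cons k n (b * a) t := mulFace_zero_cons_cons b a t

theorem mulFirst_snoc (n : ℕ) (t : ⨂[k]^(n + 1) R) (a b : R) :
    mulFirst (n + 1) b (snoc k (n + 1) t a) = snoc k (n + 1) (mulFirst n b t) a := by
  rw [mulFirst_apply, cons_snoc]
  exact mulFace_castSucc_snoc 0 _ _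

theorem mulLast_mulLast (n : ℕ) (t : ⨂[k]^(n + 1) R) (a b : R) :
    mulLast n (mulLast n t a) b = mulLast n t (a * b) := by
  induction t using snoc_induction with
  | hadd s t hs ht => simp only [map_add, LinearMap.add_apply, hs, ht]
  | hsnoc t c => simp only [mulLast_snoc, mul_assoc]

theorem mulLast_one (n : ℕ) (t : ⨂[k]^(n + 1) R) : mulLast n t 1 = t := by
  induction t using snoc_induction with
  | hadd s t hs ht => simp only [map_add, LinearMap.add_apply, hs, ht]
  | hsnoc t c => simp only [mulLast_snoc, mul_one]

theorem mulFirst_mulFirst (n : ℕ) (t : ⨂[k]^(n + 1) R) (a b : R) :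
    mulFirst n a (mulFirst n b t) = mulFirst n (a * b) t := by
  suffices h : mulFirst n a ∘ₗ mulFirst n b = mulFirst (k := k) n (a * b) from
    LinearMap.congr_fun h t
  refine cons_ext fun c t => ?_
  simp only [LinearMap.comp_apply, mulFirst_cons, mul_assoc]

theorem mulFirst_mulLast (n : ℕ) (t : ⨂[k]^(n + 1) R) (a b : R) :
    mulFirst n a (mulLast n t b) = mulLast n (mulFirst n a t) b := by
  induction t using snoc_induction with
  | hadd s t hs ht => simp only [map_add, LinearMap.add_apply, hs, ht]
  | hsnoc t c =>
    cases n with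
    | zero =>
      rw [mulLast_snoc, ← cons_eq_snoc_zero, ← cons_eq_snoc_zero, mulFirst_cons, mulFirst_cons,
        cons_eq_snoc_zero, cons_eq_snoc_zero, mulLast_snoc, mul_assoc]
    | succ n => simp only [mulLast_snoc, mulFirst_snoc]

/-- The bar differential `(a_0, …, a_{n+1}) ↦ ∑_{i=0}^n (-1)^i (a_0, …, a_i a_{i+1}, …, a_{n+1})`. -/
def barDiff (n : ℕ) : (⨂[k]^(n + 2) R) →ₗ[k] ⨂[k]^(n + 1) R :=
  ∑ i : Fin (n + 1), (-1 : k) ^ (i : ℕ) • mulFace k i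

theorem barDiff_zero (t : ⨂[k]^1 R) (a : R) : barDiff 0 (snoc k 1 t a) = mulLast 0 t a := by
  simp only [barDiff, LinearMap.sum_apply, LinearMap.smul_apply]
  rw [Fin.sum_univ_one, Fin.val_zero, pow_zero, one_smul]
  rfl

theorem barDiff_succ (n : ℕ) (t : ⨂[k]^(n + 2) R) (a : R) :
    barDiff (n + 1) (snoc k (n + 2) t a) =
      snoc k (n + 1) (barDiff n t) a + (-1 : k) ^ (n + 1) • mulLast (n + 1) t a := by
  simp only [barDiff, LinearMap.sum_apply, LinearMap.smul_apply, map_sum, map_smul]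
  rw [Fin.sum_univ_castSucc]
  simp only [mulFace_castSucc_snoc, Fin.val_castSucc, Fin.val_last]
  rfl

theorem barDiff_mulLast (n : ℕ) (t : ⨂[k]^(n + 2) R) (a : R) :
    barDiff n (mulLast (n + 1) t a) = mulLast n (barDiff n t) a := by
  induction t using snoc_induction with
  | hadd s t hs ht => simp only [map_add, LinearMap.add_apply, hs, ht]
  | hsnoc t c =>
    cases n with
    | zero => rw [mulLast_snoc, barDiff_zero, barDiff_zero, mulLast_mulLast]
    | succ n =>
      simp only [mulLast_snoc, barDiff_succ, map_add, LinearMap.add_apply, map_smul,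
        LinearMap.smul_apply, mulLast_mulLast]

/-- The Hochschild boundary on tensor powers. -/
def hochschild (n : ℕ) : (⨂[k]^(n + 2) R) →ₗ[k] ⨂[k]^(n + 1) R :=
  barDiff n + (-1 : k) ^ (n + 1) • algebraFace k R n (Fin.last (n + 1))

theorem hochschild_apply (n : ℕ) (t : ⨂[k]^(n + 2) R) : hochschild n t =
    barDiff n t + (-1 : k) ^ (n + 1) • algebraFace k R n (Fin.last (n + 1)) t := rfl

theorem b_algebraCyclic (n : ℕ) : (algebraCyclic k R).b n = hochschild n := by
  have h : (algebraCyclic k R).bPrime n = barDiff n := by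
    refine Finset.sum_congr rfl fun i _ => ?_
    change _ • algebraFace k R n i.castSucc = _
    rw [algebraFace_castSucc]
    rfl
  refine LinearMap.ext fun t => (CyclicData.b_eq_bPrime_add _ n t).trans ?_
  rw [h]
  rfl

theorem algebraFace_last_snoc (n : ℕ) (t : ⨂[k]^(n + 1) R) (a : R) :
    algebraFace k R n (Fin.last (n + 1)) (snoc k (n + 1) t a) = mulFirst n a t := by
  rw [algebraFace_last, LinearMap.comp_apply, rotate_snoc, mulFirst_apply]

/-- The wrap-around face multiplies the last factor into the first, so g may be moved from the end
of a chain to its beginning. -/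
theorem algebraFace_last_mulLast (n : ℕ) (t : ⨂[k]^(n + 2) R) (a : R) :
    algebraFace k R n (Fin.last (n + 1)) (mulLast (n + 1) t a) =
      algebraFace k R n (Fin.last (n + 1)) (mulFirst (n + 1) a t) := by
  induction t using snoc_induction with
  | hadd s t hs ht => simp only [map_add, LinearMap.add_apply, hs, ht]
  | hsnoc t c =>
    rw [mulLast_snoc, mulFirst_snoc, algebraFace_last_snoc, algebraFace_last_snoc,
      mulFirst_mulFirst]

variable {ι : Type w} (s : Finset ι) (x y : ι → R)

/-- `(a_0, …, a_n) ↦ ∑ (a_0, …, a_n x, y)`. -/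
def splitLast (n : ℕ) : (⨂[k]^(n + 1) R) →ₗ[k] ⨂[k]^(n + 2) R :=
  ∑ i ∈ s, (snoc k (n + 1)).flip (y i) ∘ₗ (mulLast n).flip (x i)

theorem splitLast_apply (n : ℕ) (t : ⨂[k]^(n + 1) R) :
    splitLast s x y n t = ∑ i ∈ s, snoc k (n + 1) (mulLast n t (x i)) (y i) := by
  simp only [splitLast, LinearMap.sum_apply]
  rfl

theorem splitLast_mulLast (n : ℕ) (t : ⨂[k]^(n + 1) R) {g : R}
    (hg : ∑ i ∈ s, (g * x i) ⊗ₜ[k] y i = ∑ i ∈ s, x i ⊗ₜ[k] (y i * g)) :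
    splitLast s x y n (mulLast n t g) = mulLast (n + 1) (splitLast s x y n t) g := by
  have := congrArg (TensorProduct.lift (snoc k (n + 1) ∘ₗ mulLast n t)) hg
  simp only [map_sum, TensorProduct.lift.tmul, LinearMap.comp_apply] at this
  simp only [splitLast_apply, map_sum, LinearMap.sum_apply, mulLast_snoc, mulLast_mulLast]
  exact this

theorem mulFirst_splitLast (n : ℕ) (t : ⨂[k]^(n + 1) R) (a : R) :
    mulFirst (n + 1) a (splitLast s x y n t) = splitLast s x y n (mulFirst n a t) := by
  simp only [splitLast_apply, map_sum, mulFirst_snoc, mulFirst_mulLast]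

/-- `(a_0, …, a_n) ↦ ∑ (a_0 x, y' a_1 x', …, y'' a_n x''', y''')`. -/
def splitAll : ∀ n : ℕ, (⨂[k]^(n + 1) R) →ₗ[k] ⨂[k]^(n + 2) R
  | 0 => splitLast s x y 0
  | n + 1 => splitLast s x y (n + 1) ∘ₗ snocLift (mulLast (n + 1) ∘ₗ splitAll n)

theorem splitAll_zero (t : ⨂[k]^1 R) : splitAll s x y 0 t = splitLast s x y 0 t := rfl

theorem splitAll_snoc (n : ℕ) (t : ⨂[k]^(n + 1) R) (a : R) :
    splitAll s x y (n + 1) (snoc k (n + 1) t a) =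
      splitLast s x y (n + 1) (mulLast (n + 1) (splitAll s x y n t) a) := by
  rw [splitAll, LinearMap.comp_apply, snocLift_snoc]
  rfl

/-- Centrality of ∑ x ⊗ y lets g pass through the last inserted pair, from a_n g x ⊗ y to a_n x ⊗ y
g. -/
theorem splitAll_mulLast (n : ℕ) (t : ⨂[k]^(n + 1) R) {g : R}
    (hg : ∑ i ∈ s, (g * x i) ⊗ₜ[k] y i = ∑ i ∈ s, x i ⊗ₜ[k] (y i * g)) :
    splitAll s x y n (mulLast n t g) = mulLast (n + 1) (splitAll s x y n t) g := by
  cases n with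
  | zero => exact splitLast_mulLast s x y 0 t hg
  | succ n =>
    induction t using snoc_induction with
    | hadd s t hs ht => simp only [map_add, LinearMap.add_apply, hs, ht]
    | hsnoc t a =>
      rw [mulLast_snoc, splitAll_snoc, splitAll_snoc, ← splitLast_mulLast s x y _ _ hg,
        mulLast_mulLast]

/-- The operator T is balanced over the elements that commute with ∑ x ⊗ y: it does not see on which
side of a tensor sign such a g stands. -/
theorem splitAll_snoc_mulLast (n : ℕ) (t : ⨂[k]^(n + 1) R) (a : R) {g : R}
    (hg : ∑ i ∈ s, (g * x i) ⊗ₜ[k] y i = ∑ i ∈ s, x i ⊗ₜ[k] (y i * g)) :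
    splitAll s x y (n + 1) (snoc k (n + 1) (mulLast n t g) a) =
      splitAll s x y (n + 1) (snoc k (n + 1) t (g * a)) := by
  rw [splitAll_snoc, splitAll_snoc, splitAll_mulLast s x y n t hg, mulLast_mulLast]

theorem mulFirst_splitAll (n : ℕ) (t : ⨂[k]^(n + 1) R) (a : R) :
    mulFirst (n + 1) a (splitAll s x y n t) = splitAll s x y n (mulFirst n a t) := by
  induction n with
  | zero => exact mulFirst_splitLast s x y 0 t a
  | succ n ih =>
    induction t using snoc_induction with
    | hadd s t hs ht => simp only [map_add, hs, ht]
    | hsnoc t c =>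
      rw [mulFirst_snoc, splitAll_snoc, splitAll_snoc, mulFirst_splitLast, mulFirst_mulLast, ih]

/-- The homotopy `∑_i (-1)^i (a_0 x, …, y' a_i x'', y'', a_{i+1}, …, a_n)`. -/
def splitHomotopy : ∀ n : ℕ, (⨂[k]^(n + 1) R) →ₗ[k] ⨂[k]^(n + 2) R
  | 0 => splitAll s x y 0
  | n + 1 => snocLift (snoc k (n + 2) ∘ₗ splitHomotopy n) +
      (-1 : k) ^ (n + 1) • splitAll s x y (n + 1)

theorem splitHomotopy_zero (t : ⨂[k]^1 R) : splitHomotopy s x y 0 t = splitAll s x y 0 t := rfl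

theorem splitHomotopy_snoc (n : ℕ) (t : ⨂[k]^(n + 1) R) (a : R) :
    splitHomotopy s x y (n + 1) (snoc k (n + 1) t a) =
      snoc k (n + 2) (splitHomotopy s x y n t) a +
        (-1 : k) ^ (n + 1) • splitAll s x y (n + 1) (snoc k (n + 1) t a) := by
  rw [splitHomotopy, LinearMap.add_apply, snocLift_snoc]
  rfl

theorem mulFirst_splitHomotopy (n : ℕ) (t : ⨂[k]^(n + 1) R) (a : R) :
    mulFirst (n + 1) a (splitHomotopy s x y n t) = splitHomotopy s x y n (mulFirst n a t) := by
  induction n with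
  | zero => exact mulFirst_splitLast s x y 0 t a
  | succ n ih =>
    induction t using snoc_induction with
    | hadd s t hs ht => simp only [map_add, hs, ht]
    | hsnoc t c =>
      rw [mulFirst_snoc, splitHomotopy_snoc, splitHomotopy_snoc, map_add, mulFirst_snoc, ih,
        map_smul, mulFirst_splitAll, mulFirst_snoc]

/-- Only the last summand of the homotopy alters the last factor; all others commute with right
multiplication there. -/
theorem splitHomotopy_mulLast (n : ℕ) (t : ⨂[k]^(n + 1) R) (a : R) :
    splitHomotopy s x y n (mulLast n t a) = mulLast (n + 1) (splitHomotopy s x y n t) a +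
      (-1 : k) ^ n • (splitAll s x y n (mulLast n t a) -
        mulLast (n + 1) (splitAll s x y n t) a) := by
  cases n with
  | zero =>
    rw [splitHomotopy_zero, splitHomotopy_zero, pow_zero, one_smul, add_sub_cancel]
  | succ n =>
    induction t using snoc_induction with
    | hadd s t hs ht =>
      simp only [map_add, LinearMap.add_apply, hs, ht, smul_sub, smul_add]
      abel
    | hsnoc t c =>
      rw [mulLast_snoc, splitHomotopy_snoc, splitHomotopy_snoc, map_add, LinearMap.add_apply,
        mulLast_snoc, map_smul, LinearMap.smul_apply, smul_sub]
      abel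

/-- The projection `(a_0, …, a_n) ↦ ∑ (y'' a_0 x, y a_1 x', …, y' a_n x'')`. -/
def splitProj (n : ℕ) : (⨂[k]^(n + 1) R) →ₗ[k] ⨂[k]^(n + 1) R :=
  algebraFace k R n (Fin.last (n + 1)) ∘ₗ splitAll s x y n

/-- P takes the same value on t g and on g t: g leaves T on the right, wraps around, and reenters T
on the left. -/
theorem splitProj_mulLast (n : ℕ) (t : ⨂[k]^(n + 1) R) {g : R}
    (hg : ∑ i ∈ s, (g * x i) ⊗ₜ[k] y i = ∑ i ∈ s, x i ⊗ₜ[k] (y i * g)) :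
    splitProj s x y n (mulLast n t g) =
      algebraFace k R n (Fin.last (n + 1)) (splitAll s x y n (mulFirst n g t)) := by
  rw [splitProj, LinearMap.comp_apply, splitAll_mulLast s x y n t hg, algebraFace_last_mulLast,
    mulFirst_splitAll]

/-- In the summands that keep the last factor a, the face multiplies a into the front, where the
homotopy is left linear. The remaining summand is (-1)^{n+1} T, whose last face is P. -/
theorem algebraFace_last_splitHomotopy (n : ℕ) (t : ⨂[k]^(n + 2) R) :
    algebraFace k R (n + 1) (Fin.last (n + 2)) (splitHomotopy s x y (n + 1) t) =
      splitHomotopy s x y n (algebraFace k R n (Fin.last (n + 1)) t) +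
        (-1 : k) ^ (n + 1) • splitProj s x y (n + 1) t := by
  induction t using snoc_induction with
  | hadd s t hs ht =>
    simp only [map_add, hs, ht, smul_add]
    abel
  | hsnoc t a =>
    rw [splitHomotopy_snoc, map_add, map_smul, algebraFace_last_snoc, algebraFace_last_snoc,
      mulFirst_splitHomotopy]
    rfl

variable (h1 : ∑ i ∈ s, x i * y i = 1)
include h1

theorem mulLast_splitLast (n : ℕ) (t : ⨂[k]^(n + 1) R) :
    ∑ i ∈ s, mulLast n (mulLast n t (x i)) (y i) = t := by
  rw [Finset.sum_congr rfl fun i _ => mulLast_mulLast n t (x i) (y i), ← map_sum, h1, mulLast_one]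

theorem barDiff_splitLast_zero (t : ⨂[k]^1 R) : barDiff 0 (splitLast s x y 0 t) = t := by
  rw [splitLast_apply, map_sum]
  exact (Finset.sum_congr rfl fun i _ => barDiff_zero _ _).trans (mulLast_splitLast s x y h1 0 t)

/-- The last face contracts a_n x ⊗ y to a_n because ∑ x y = 1; all other faces commute with the
splitting. -/
theorem barDiff_splitLast (n : ℕ) (t : ⨂[k]^(n + 2) R) :
    barDiff (n + 1) (splitLast s x y (n + 1) t) =
      splitLast s x y n (barDiff n t) + (-1 : k) ^ (n + 1) • t := by
  rw [splitLast_apply, map_sum]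
  simp only [barDiff_succ, barDiff_mulLast, Finset.sum_add_distrib]
  rw [splitLast_apply, ← Finset.smul_sum, mulLast_splitLast s x y h1]

/-- An inner face of T(t, a) joins a_i x with y a_{i+1} x', and ∑ x y = 1 turns this into T of the
face. The last inserted pair has nothing to its right, so its face leaves T(t) multiplied by a. -/
theorem barDiff_splitAll (n : ℕ) (t : ⨂[k]^(n + 1) R) (a : R) :
    barDiff (n + 1) (splitAll s x y (n + 1) (snoc k (n + 1) t a)) =
      splitAll s x y n (barDiff n (snoc k (n + 1) t a)) +
        (-1 : k) ^ (n + 1) • mulLast (n + 1) (splitAll s x y n t) a := by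
  induction n generalizing a with
  | zero =>
    rw [splitAll_snoc, barDiff_splitLast s x y h1, barDiff_mulLast, splitAll_zero,
      barDiff_splitLast_zero s x y h1, barDiff_zero, splitAll_zero]
  | succ n ih =>
    induction t using snoc_induction with
    | hadd s t hs ht =>
      simp only [map_add, LinearMap.add_apply, hs, ht, smul_add]
      abel
    | hsnoc t c =>
      rw [splitAll_snoc, barDiff_splitLast s x y h1, barDiff_mulLast, ih, barDiff_succ, map_add,
        LinearMap.add_apply, map_add, map_add, splitAll_snoc, mulLast_snoc, splitAll_snoc, map_smul,
        map_smul, LinearMap.smul_apply, map_smul, mulLast_mulLast, splitAll_snoc]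

theorem barDiff_splitHomotopy_zero (t : ⨂[k]^1 R) : barDiff 0 (splitHomotopy s x y 0 t) = t :=
  barDiff_splitLast_zero s x y h1 t

/-- The homotopy contracts b'. By induction the part fixing the last factor already contributes t;
the T-terms produced by `barDiff_splitAll` cancel against those of `splitHomotopy_mulLast`. -/
theorem barDiff_splitHomotopy (n : ℕ) (t : ⨂[k]^(n + 2) R) :
    barDiff (n + 1) (splitHomotopy s x y (n + 1) t) + splitHomotopy s x y n (barDiff n t) = t := by
  have hp : (-1 : k) ^ (n + 1) * (-1 : k) ^ (n + 1) = 1 := by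
    rw [← pow_add, Even.neg_one_pow ⟨n + 1, rfl⟩]
  induction t using snoc_induction with
  | hadd s t hs ht =>
    rw [map_add, map_add, map_add, map_add, add_add_add_comm, hs, ht]
  | hsnoc t a =>
    rw [splitHomotopy_snoc, map_add, map_smul, barDiff_splitAll s x y h1, barDiff_succ, smul_add,
      smul_smul, hp, one_smul]
    cases n with
    | zero =>
      rw [barDiff_splitHomotopy_zero s x y h1, barDiff_zero, splitHomotopy_zero,
        splitHomotopy_zero]
      simp only [zero_add, pow_one, neg_smul, one_smul]
      abel
    | succ n =>
      have hq : (-1 : k) ^ (n + 1 + 1) * (-1 : k) ^ (n + 1) = -1 := by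
        rw [pow_succ, mul_neg_one, neg_mul, ← pow_add, Even.neg_one_pow ⟨n + 1, rfl⟩]
      have hq' : (-1 : k) ^ (n + 1) * (-1 : k) ^ (n + 1) = 1 := by
        rw [← pow_add, Even.neg_one_pow ⟨n + 1, rfl⟩]
      -- The recursive call, on a shorter chain, with a appended afterwards.
      have ih := congrArg (fun t => snoc k (n + 2) t a) (barDiff_splitHomotopy n t)
      simp only [map_add, LinearMap.add_apply] at ih
      rw [barDiff_succ, map_add (splitHomotopy s x y (n + 1)), splitHomotopy_snoc, map_smul,
        splitHomotopy_mulLast, map_add, map_smul, smul_add, smul_add, smul_smul, smul_smul, hq, hq',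
        pow_succ _ (n + 1)]
      rw [← ih]
      simp only [mul_neg_one, neg_smul, one_smul, smul_sub]
      abel

theorem hochschild_splitHomotopy_zero (t : ⨂[k]^1 R) :
    hochschild 0 (splitHomotopy s x y 0 t) = t - splitProj s x y 0 t := by
  refine (hochschild_apply 0 _).trans ?_
  rw [barDiff_splitHomotopy_zero s x y h1, sub_eq_add_neg, ← neg_one_smul k (splitProj s x y 0 t)]
  exact congrArg (fun r : k => t + r • splitProj s x y 0 t) (pow_one (-1))

/-- Passing from b' to b adds the last face, which commutes with the homotopy up to P. The signs
cancel the commuting parts and leave -P. -/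
theorem hochschild_splitHomotopy (n : ℕ) (t : ⨂[k]^(n + 2) R) :
    hochschild (n + 1) (splitHomotopy s x y (n + 1) t) + splitHomotopy s x y n (hochschild n t) =
      t - splitProj s x y (n + 1) t := by
  have hp : (-1 : k) ^ (n + 1) * (-1 : k) ^ (n + 1) = 1 := by
    rw [← pow_add, Even.neg_one_pow ⟨n + 1, rfl⟩]
  rw [hochschild_apply, hochschild_apply, algebraFace_last_splitHomotopy, eq_sub_iff_add_eq]
  refine Eq.trans ?_ (barDiff_splitHomotopy s x y h1 n t)
  simp only [map_add, map_smul, smul_add, smul_smul, pow_succ (-1 : k) (n + 1), mul_neg_one,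
    neg_smul, neg_mul, hp, one_smul]
  abel

end Homotopy

/-- The relations are identities between composites of operators and descend along any surjection
compatible with these. Applied to `collectHom`, this gives the cyclic identities of C^H(A) without
any computation with the twisted rotation. -/
theorem CyclicData.IsCyclicModule.of_surjective {k : Type u} [CommRing k]
    {C C' : CyclicData.{u, v} k} (F : CyclicData.Hom C C')
    (hF : ∀ n, Function.Surjective (F.app n)) (hC : C.IsCyclicModule) : C'.IsCyclicModule where
  face_face n i j hij c := by
    obtain ⟨c, rfl⟩ := hF _ c
    simp only [← F.app_face, hC.face_face n i j hij]
  degen_degen n i j hij c := by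
    obtain ⟨c, rfl⟩ := hF _ c
    simp only [← F.app_degen, hC.degen_degen n i j hij]
  face_degen_of_lt n i j hij c := by
    obtain ⟨c, rfl⟩ := hF _ c
    simp only [← F.app_degen, ← F.app_face, hC.face_degen_of_lt n i j hij]
  face_degen_self n i c := by
    obtain ⟨c, rfl⟩ := hF _ c
    simp only [← F.app_degen, ← F.app_face, hC.face_degen_self]
  face_degen_succ n i c := by
    obtain ⟨c, rfl⟩ := hF _ c
    simp only [← F.app_degen, ← F.app_face, hC.face_degen_succ]
  face_degen_of_gt n i j hij c := by
    obtain ⟨c, rfl⟩ := hF _ c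
    simp only [← F.app_degen, ← F.app_face, hC.face_degen_of_gt n i j hij]
  face_zero_cyc n c := by
    obtain ⟨c, rfl⟩ := hF _ c
    simp only [← F.app_cyc, ← F.app_face, hC.face_zero_cyc]
  face_succ_cyc n i c := by
    obtain ⟨c, rfl⟩ := hF _ c
    simp only [← F.app_cyc, ← F.app_face, hC.face_succ_cyc]
  degen_zero_cyc n c := by
    obtain ⟨c, rfl⟩ := hF _ c
    simp only [← F.app_cyc, ← F.app_degen, hC.degen_zero_cyc]
  degen_succ_cyc n i c := by
    obtain ⟨c, rfl⟩ := hF _ c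
    simp only [← F.app_cyc, ← F.app_degen, hC.degen_succ_cyc]
  cyc_pow n c := by
    obtain ⟨c, rfl⟩ := hF _ c
    rw [← F.app_cyc_pow, hC.cyc_pow]

/-! ### Contracting the kernel of the separability projection. -/

section Contraction

variable {k : Type u} [CommRing k] {R : Type v} [Ring R] [Algebra k R]

theorem hochschild_hochschild (n : ℕ) (t : ⨂[k]^(n + 3) R) :
    hochschild n (hochschild (n + 1) t) = 0 := by
  have h := (algebraCyclic_isCyclicModule (k := k) (R := R)).b_b n t
  rw [b_algebraCyclic, b_algebraCyclic] at h
  exact h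

variable {ι : Type w} (s : Finset ι) (x y : ι → R)

/-- The contraction `(1 - P) h`, where `P` is the projection and `h` the homotopy. -/
def splitContraction (n : ℕ) : (⨂[k]^(n + 1) R) →ₗ[k] ⨂[k]^(n + 2) R :=
  (LinearMap.id - splitProj s x y (n + 1)) ∘ₗ splitHomotopy s x y n

theorem splitContraction_apply (n : ℕ) (t : ⨂[k]^(n + 1) R) : splitContraction s x y n t =
    splitHomotopy s x y n t - splitProj s x y (n + 1) (splitHomotopy s x y n t) := rfl

variable (h1 : ∑ i ∈ s, x i * y i = 1)
include h1

/-- P = 1 - (bh + hb) commutes with b because b² = 0. -/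
theorem hochschild_splitProj (n : ℕ) (t : ⨂[k]^(n + 2) R) :
    hochschild n (splitProj s x y (n + 1) t) = splitProj s x y n (hochschild n t) := by
  have h := congrArg (hochschild n) (hochschild_splitHomotopy s x y h1 n t)
  rw [map_add, hochschild_hochschild, zero_add, map_sub] at h
  have h' : hochschild n (splitHomotopy s x y n (hochschild n t)) =
      hochschild n t - splitProj s x y n (hochschild n t) := by
    cases n with
    | zero => exact hochschild_splitHomotopy_zero s x y h1 _
    | succ n =>
      have := hochschild_splitHomotopy s x y h1 n (hochschild (n + 1) t)
      rwa [hochschild_hochschild, map_zero, add_zero] at this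
  rw [h'] at h
  exact (sub_right_injective h).symm

theorem hochschild_splitContraction_zero {t : ⨂[k]^1 R} (ht : splitProj s x y 0 t = 0) :
    hochschild 0 (splitContraction s x y 0 t) = t := by
  refine (congrArg _ (splitContraction_apply s x y 0 t)).trans ?_
  rw [map_sub]
  refine (congrArg₂ _ rfl (hochschild_splitProj s x y h1 0 _)).trans ?_
  rw [hochschild_splitHomotopy_zero s x y h1, ht, sub_zero, ht, sub_zero]

/-- The factor 1 - P forces the homotopy to take values in the kernel of `collectHom`. Since P
commutes with b, applying 1 - P to (bh + hb) t = t costs nothing when P t = 0. -/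
theorem hochschild_splitContraction {n : ℕ} {t : ⨂[k]^(n + 2) R}
    (ht : splitProj s x y (n + 1) t = 0) :
    hochschild (n + 1) (splitContraction s x y (n + 1) t) +
      splitContraction s x y n (hochschild n t) = t := by
  have h := hochschild_splitHomotopy s x y h1 n t
  rw [ht, sub_zero] at h
  have h' := congrArg (splitProj s x y (n + 1)) h
  rw [ht, map_add] at h'
  rw [splitContraction_apply, splitContraction_apply, map_sub, hochschild_splitProj s x y h1,
    sub_add_sub_comm, h, h', sub_zero]

end Contraction

/-! ### The kernel of `collectHom` and the separability projection. -/

section Spread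

open Coalgebra HopfAlgebra

variable {k : Type u} [CommRing k] {H : Type v} [Ring H] [HopfAlgebra k H]
variable {A : Type w} [Ring A] [Algebra k A] [Module H A] [IsScalarTower k H A]
variable [HModuleAlgebra k H A]

variable (k H A) in
/-- `(a_0, …, a_{n-1}) ↦ (a_0 ⊗ 1, …, a_{n-1} ⊗ 1)`. -/
def inclPow : ∀ n : ℕ, (⨂[k]^n A) →ₗ[k] ⨂[k]^n (CrossedProduct k H A)
  | 0 => PiTensorProduct.lift
      (MultilinearMap.constOfIsEmpty k _ (PiTensorProduct.tprod k Fin.elim0))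
  | n + 1 => snocLift ((snoc k n).compl₁₂ (inclPow n)
      ((TensorProduct.mk k A H).flip 1 : A →ₗ[k] CrossedProduct k H A))

theorem inclPow_snoc (n : ℕ) (t : ⨂[k]^n A) (a : A) :
    inclPow k H A (n + 1) (snoc k n t a) = snoc k n (inclPow k H A n t) (.of a 1) := by
  rw [inclPow, snocLift_snoc]
  rfl

variable (k H A) in
/-- `(g | a_0, …, a_n) ↦ (a_0 ⊗ 1, …, a_{n-1} ⊗ 1, a_n ⊗ g)`. -/
def spread (n : ℕ) : (H ⊗[k] ⨂[k]^(n + 1) A) →ₗ[k] ⨂[k]^(n + 1) (CrossedProduct k H A) :=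
  TensorProduct.lift ((mulLast n).compl₁₂ (inclPow k H A (n + 1))
    (TensorProduct.mk k A H 1 : H →ₗ[k] CrossedProduct k H A)).flip

theorem spread_tmul (n : ℕ) (g : H) (t : ⨂[k]^(n + 1) A) :
    spread k H A n (g ⊗ₜ t) = mulLast n (inclPow k H A (n + 1) t) (.of 1 g) := rfl

theorem spread_rTensor_mulRight (n : ℕ) (h : H) (z : H ⊗[k] ⨂[k]^(n + 1) A) :
    spread k H A n ((LinearMap.mulRight k h).rTensor _ z) =
      mulLast n (spread k H A n z) (.of 1 h) := by
  induction z using TensorProduct.induction_on with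
  | zero => simp only [map_zero, LinearMap.zero_apply]
  | add z z' hz hz' => simp only [map_add, LinearMap.add_apply, hz, hz']
  | tmul g t =>
    rw [LinearMap.rTensor_tmul, LinearMap.mulRight_apply, spread_tmul, spread_tmul,
      mulLast_mulLast, CrossedProduct.of_mul_of_one]

/-- `spread` inverts `collect` only up to balancing over H: the element l returns in the last slot,
in front of x, rather than where it came from. -/
theorem spread_chainMul (n : ℕ) (l : H) (s : ⨂[k]^n A) (x : CrossedProduct k H A) :
    spread k H A n (chainMul k H A n (l ⊗ₜ s) x) =
      snoc k n (inclPow k H A n s) (.of 1 l * x) := by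
  have h : ∀ w : A ⊗[k] H, spread k H A n (snocSwap n s w) =
      snoc k n (inclPow k H A n s) (w : CrossedProduct k H A) := by
    intro w
    induction w using TensorProduct.induction_on with
    | zero => exact (congrArg _ (map_zero _)).trans ((map_zero _).trans (map_zero _).symm)
    | add w w' hw hw' =>
      rw [map_add, map_add, hw, hw']
      exact ((snoc k n (inclPow k H A n s)).map_add _ _).symm
    | tmul a g =>
      rw [snocSwap_tmul, spread_tmul, inclPow_snoc, mulLast_snoc, CrossedProduct.of_mul_of_one,
        one_mul]
      rfl
  exact (h _).trans (congrArg _ (CrossedProduct.of_one_mul l x).symm)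

theorem collect_zero_tprod (x : Fin 0 → CrossedProduct k H A) :
    collect k H A 0 (PiTensorProduct.tprod k x) = 1 ⊗ₜ[k] PiTensorProduct.tprod k Fin.elim0 :=
  PiTensorProduct.lift.tprod _

theorem collect_inclPow (n : ℕ) (t : ⨂[k]^n A) :
    collect k H A n (inclPow k H A n t) = 1 ⊗ₜ[k] t := by
  induction n with
  | zero =>
    induction t using PiTensorProduct.induction_on with
    | add s t hs ht => rw [map_add, map_add, hs, ht, TensorProduct.tmul_add]
    | smul_tprod r a =>
      have h : inclPow k H A 0 (PiTensorProduct.tprod k a) =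
        PiTensorProduct.tprod k Fin.elim0 := PiTensorProduct.lift.tprod _
      rw [map_smul, map_smul, h, collect_zero_tprod, TensorProduct.tmul_smul,
        Subsingleton.elim a Fin.elim0]
  | succ n ih =>
    induction t using snoc_induction with
    | hadd s t hs ht => rw [map_add, map_add, hs, ht, TensorProduct.tmul_add]
    | hsnoc t a =>
      rw [inclPow_snoc, collect_snoc, ih, chainMul_tmul]
      exact congrArg (snocSwap n t) (CrossedProduct.rightMul_one (a ⊗ₜ[k] 1))

theorem collect_mulLast (n : ℕ) (t : ⨂[k]^(n + 1) (CrossedProduct k H A)) (h : H) :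
    collect k H A (n + 1) (mulLast n t (.of 1 h)) =
      (LinearMap.mulRight k h).rTensor _ (collect k H A (n + 1) t) := by
  induction t using snoc_induction with
  | hadd s t hs ht => simp only [map_add, LinearMap.add_apply, hs, ht]
  | hsnoc t a => rw [mulLast_snoc, collect_snoc, collect_snoc, chainMul_of_mul]

theorem collect_spread (n : ℕ) (z : H ⊗[k] ⨂[k]^(n + 1) A) :
    collect k H A (n + 1) (spread k H A n z) = z := by
  induction z using TensorProduct.induction_on with
  | zero => rw [map_zero, map_zero]
  | add z z' hz hz' => rw [map_add, map_add, hz, hz']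
  | tmul g t =>
    rw [spread_tmul, collect_mulLast, collect_inclPow, LinearMap.rTensor_tmul,
      LinearMap.mulRight_apply, one_mul]

theorem collectHom_surjective (hS : Function.Bijective (antipode k (A := H))) (n : ℕ) :
    Function.Surjective ((collectHom A hS).app n) := fun z => by
  obtain ⟨z, rfl⟩ := Submodule.mkQ_surjective _ z
  exact ⟨spread k H A n z, congrArg (Submodule.mkQ _) (collect_spread n z)⟩

/-- A single factor has nothing to be moved past, so balancing plays no role; this starts the
induction for T. -/
theorem spread_collect_zero (t : ⨂[k]^1 (CrossedProduct k H A)) :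
    spread k H A 0 (collect k H A 1 t) = t := by
  induction t using snoc_induction with
  | hadd s t hs ht => rw [map_add, map_add, hs, ht]
  | hsnoc t x =>
    rw [collect_snoc]
    induction t using PiTensorProduct.induction_on with
    | add s t hs ht => simp only [map_add, LinearMap.add_apply, hs, ht]
    | smul_tprod r a =>
      have h : inclPow k H A 0 (PiTensorProduct.tprod k Fin.elim0) =
        PiTensorProduct.tprod k a :=
        (PiTensorProduct.lift.tprod _).trans
          (congrArg (PiTensorProduct.tprod k) (Subsingleton.elim Fin.elim0 a))
      simp only [map_smul, LinearMap.smul_apply]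
      rw [collect_zero_tprod, spread_chainMul, h]
      exact congrArg (fun y => r • snoc k 0 _ y) (one_mul x)

variable {ι : Type x} (s : Finset ι)

section Balanced

variable (x y : ι → CrossedProduct k H A)
  (hg : ∀ h : H, ∑ i ∈ s, (.of 1 h * x i) ⊗ₜ[k] y i =
    ∑ i ∈ s, x i ⊗ₜ[k] (y i * .of 1 h : CrossedProduct k H A))
include hg

/-- T factors through `collect`: the chains t and `spread` of `collect` of t differ by moving
elements of H across tensor signs, which T does not see. -/
theorem splitAll_spread_collect (n : ℕ) (t : ⨂[k]^(n + 1) (CrossedProduct k H A)) :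
    splitAll s x y n (spread k H A n (collect k H A (n + 1) t)) = splitAll s x y n t := by
  induction n with
  | zero => exact congrArg _ (spread_collect_zero t)
  | succ n ih =>
    have key : ∀ (z : H ⊗[k] ⨂[k]^(n + 1) A) (c : CrossedProduct k H A),
        splitAll s x y (n + 1) (spread k H A (n + 1) (chainMul k H A (n + 1) z c)) =
          splitAll s x y (n + 1) (snoc k (n + 1) (spread k H A n z) c) := by
      intro z c
      induction z using TensorProduct.induction_on with
      | zero => simp only [map_zero, LinearMap.zero_apply]
      | add z z' hz hz' => simp only [map_add, LinearMap.add_apply, hz, hz']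
      | tmul l t =>
        rw [spread_chainMul, spread_tmul, splitAll_snoc_mulLast s x y n _ _ (hg l)]
    induction t using snoc_induction with
    | hadd s t hs ht => simp only [map_add, hs, ht]
    | hsnoc t c => rw [collect_snoc, key, splitAll_snoc, splitAll_snoc, ih]

/-- With v = `spread` (g | t), one term of the relation spreads to v h, the other is the collected
form of h v, and P takes the same value on v h and h v. -/
theorem coinvRel_le_ker_splitProj (n : ℕ) :
    coinvRel k H A (n + 1) ≤ LinearMap.ker (splitProj s x y n ∘ₗ spread k H A n) := by
  refine coinvRel_le _ _ fun g h t => ?_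
  have h1 := collect_mulFace_zero_cons n h (spread k H A n (g ⊗ₜ t))
  rw [collect_spread, chainAct_tmul] at h1
  have h2 := spread_rTensor_mulRight n h (g ⊗ₜ t : H ⊗[k] ⨂[k]^(n + 1) A)
  rw [LinearMap.rTensor_tmul, LinearMap.mulRight_apply] at h2
  rw [← h1, LinearMap.mem_ker, map_sub, LinearMap.comp_apply, LinearMap.comp_apply, h2,
    splitProj_mulLast s x y n _ (hg h), splitProj, LinearMap.comp_apply,
    splitAll_spread_collect s x y hg, sub_eq_zero]
  rfl

theorem splitProj_eq_zero (hS : Function.Bijective (antipode k (A := H))) (n : ℕ)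
    (t : ⨂[k]^(n + 1) (CrossedProduct k H A)) (ht : (collectHom A hS).app n t = 0) :
    splitProj s x y n t = 0 := by
  have h : splitProj s x y n (spread k H A n (collect k H A (n + 1) t)) = 0 :=
    coinvRel_le_ker_splitProj s x y hg n ((Submodule.Quotient.mk_eq_zero _).1 ht)
  rwa [splitProj, LinearMap.comp_apply, splitAll_spread_collect s x y hg] at h

end Balanced

variable (x y : ι → H) (h1 : ∑ i ∈ s, x i * y i = 1)
include h1

theorem collect_splitLast (n : ℕ) (t : ⨂[k]^(n + 1) (CrossedProduct k H A)) :
    collect k H A (n + 2) (splitLast s (fun i => .of 1 (x i)) (fun i => .of 1 (y i)) n t) =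
      (insertOne k (Fin.last (n + 1))).lTensor H (collect k H A (n + 1) t) := by
  have h : ∀ (z : H ⊗[k] ⨂[k]^(n + 1) A) (g : H), chainMul k H A (n + 1) z (.of 1 g) =
      (LinearMap.mulRight k g).rTensor _ ((insertOne k (Fin.last (n + 1))).lTensor H z) := by
    intro z g
    rw [← chainMul_one, ← chainMul_of_mul, one_mul]
  rw [splitLast_apply, map_sum]
  simp only [collect_snoc, collect_mulLast, h]
  generalize collect k H A (n + 1) t = z
  induction z using TensorProduct.induction_on with
  | zero => simp only [map_zero, Finset.sum_const_zero]
  | add z z' hz hz' => simp only [map_add, Finset.sum_add_distrib, hz, hz']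
  | tmul g t =>
    simp only [LinearMap.rTensor_tmul, LinearMap.lTensor_tmul, LinearMap.mulRight_apply,
      ← TensorProduct.sum_tmul, mul_assoc, ← Finset.mul_sum, h1, mul_one]

/-- Under `collect` the two halves of an inserted pair meet: x moves right onto y, ∑ x y = 1, and a
bare 1 is left as an A-factor. Every such 1 is absorbed by the next factor, except the last one. -/
theorem collect_splitAll (n : ℕ) (t : ⨂[k]^(n + 1) (CrossedProduct k H A)) :
    collect k H A (n + 2) (splitAll s (fun i => .of 1 (x i)) (fun i => .of 1 (y i)) n t) =
      (insertOne k (Fin.last (n + 1))).lTensor H (collect k H A (n + 1) t) := by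
  induction n with
  | zero => exact collect_splitLast s x y h1 0 t
  | succ n ih =>
    induction t using snoc_induction with
    | hadd s t hs ht => simp only [map_add, hs, ht]
    | hsnoc t a =>
      rw [splitAll_snoc, collect_splitLast s x y h1, mulLast_apply, collect_mulFace,
        collect_snoc, ih, collect_snoc,
        ← lTensor_chainMul _ (insertOne k (Fin.last (n + 1)).castSucc)
          (insertOne_castSucc_snoc (Fin.last (n + 1))), ← LinearMap.lTensor_comp_apply H (mulFace k _),
        mulFace_insertOne_castSucc, LinearMap.lTensor_id, LinearMap.id_apply]

/-- After `collect`, T becomes the last degeneracy, whose last face is the identity. With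
`splitProj_eq_zero` this shows that P and `collectHom` have the same kernel. -/
theorem collectHom_splitProj (hS : Function.Bijective (antipode k (A := H))) (n : ℕ)
    (t : ⨂[k]^(n + 1) (CrossedProduct k H A)) : (collectHom A hS).app n
      (splitProj s (fun i => .of 1 (x i)) (fun i => .of 1 (y i)) n t) =
        (collectHom A hS).app n t := by
  have h := collect_splitAll (A := A) s x y h1 n t
  rw [← collect_insertOne] at h
  refine (mkQ_collect_algebraFace hS n _ _).trans ?_
  rw [h, ← mkQ_collect_algebraFace]
  exact congrArg ((collectHom A hS).app n)
    (algebraCyclic_isCyclicModule.face_degen_succ n (Fin.last n) t)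

theorem collectHom_isKernelContraction (hS : Function.Bijective (antipode k (A := H)))
    (hg : ∀ h : H, ∑ i ∈ s, (h * x i) ⊗ₜ[k] y i = ∑ i ∈ s, x i ⊗ₜ[k] (y i * h)) :
    CyclicData.IsKernelContraction (collectHom A hS)
      (splitContraction s (fun i => .of 1 (x i)) (fun i => .of 1 (y i))) := by
  have h1' : ∑ i ∈ s, (.of 1 (x i) * .of 1 (y i) : CrossedProduct k H A) = 1 := by
    simp only [CrossedProduct.of_mul_of_one]
    exact (map_sum (TensorProduct.mk k A H 1) _ s).symm.trans (congrArg _ h1)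
  -- The separability idempotent of H is transported along h ↦ 1 ⊗ h; in A ⋊ H it is central only
  -- relative to H, which is all that is needed.
  have hg' : ∀ h : H, ∑ i ∈ s, (.of 1 h * .of 1 (x i) : CrossedProduct k H A) ⊗ₜ[k]
      (.of 1 (y i) : CrossedProduct k H A) =
    ∑ i ∈ s, (.of 1 (x i) : CrossedProduct k H A) ⊗ₜ[k]
      (.of 1 (y i) * .of 1 h : CrossedProduct k H A) := fun h => by
    let e : H →ₗ[k] CrossedProduct k H A := TensorProduct.mk k A H 1
    have := congrArg (TensorProduct.map e e) (hg h)
    simp only [map_sum, TensorProduct.map_tmul] at this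
    simp only [CrossedProduct.of_mul_of_one]
    exact this
  refine ⟨fun n c => ?_, fun c hc => ?_, fun n c hc => ?_⟩
  · refine (((collectHom A hS).app (n + 1)).map_sub _ _).trans (sub_eq_zero.2 ?_)
    exact (collectHom_splitProj s x y h1 hS (n + 1) _).symm
  · rw [b_algebraCyclic]
    exact hochschild_splitContraction_zero s _ _ h1' (splitProj_eq_zero s _ _ hg' hS 0 c hc)
  · rw [b_algebraCyclic, b_algebraCyclic]
    exact hochschild_splitContraction s _ _ h1' (splitProj_eq_zero s _ _ hg' hS (n + 1) c hc)

end Spread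

/-! ### Naturality of `collectHom` and the conclusion. -/

section Naturality

open Coalgebra HopfAlgebra

variable {k : Type u} [CommRing k] {H : Type v} [Ring H] [HopfAlgebra k H]
variable {A A' : Type w} [Ring A] [Algebra k A] [Module H A] [IsScalarTower k H A]
  [HModuleAlgebra k H A] [Ring A'] [Algebra k A'] [Module H A'] [IsScalarTower k H A']
  [HModuleAlgebra k H A']

theorem collect_powMap (f : A →ₐ[k] A') (hf : ∀ (h : H) (a : A), f (h • a) = h • f a) (n : ℕ)
    (t : ⨂[k]^n (CrossedProduct k H A)) :
    collect k H A' n (powMap n (CrossedProduct.map f hf).toLinearMap t) =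
      (powMap n f.toLinearMap).lTensor H (collect k H A n t) := by
  induction n with
  | zero =>
    induction t using PiTensorProduct.induction_on with
    | add s t hs ht => simp only [map_add, hs, ht]
    | smul_tprod r a =>
      simp only [map_smul]
      rw [PiTensorProduct.map_tprod, collect_zero_tprod, collect_zero_tprod,
        LinearMap.lTensor_tmul, PiTensorProduct.map_tprod]
      exact congrArg (fun b => r • (1 : H) ⊗ₜ[k] PiTensorProduct.tprod k b) (Subsingleton.elim _ _)
  | succ n ih =>
    have key : ∀ (z : H ⊗[k] ⨂[k]^n A) (x : CrossedProduct k H A),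
        chainMul k H A' n ((powMap n f.toLinearMap).lTensor H z) (CrossedProduct.map f hf x) =
          (powMap (n + 1) f.toLinearMap).lTensor H (chainMul k H A n z x) := by
      intro z x
      induction z using TensorProduct.induction_on with
      | zero => simp only [map_zero, LinearMap.zero_apply]
      | add z z' hz hz' => simp only [map_add, LinearMap.add_apply, hz, hz']
      | tmul l s =>
        induction x using CrossedProduct.induction with
        | h0 => simp only [map_zero]
        | hadd x x' hx hx' => simp only [map_add, hx, hx']
        | hof a g =>
          have : CrossedProduct.map f hf (.of a g) = .of (f a) g := rfl
          rw [this, LinearMap.lTensor_tmul, chainMul_tmul_of, chainMul_tmul_of, map_sum]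
          simp only [LinearMap.lTensor_tmul, powMap_snoc, AlgHom.toLinearMap_apply, hf]
    induction t using snoc_induction with
    | hadd s t hs ht => simp only [map_add, hs, ht]
    | hsnoc t x =>
      rw [powMap_snoc, collect_snoc, collect_snoc, ih]
      exact key _ _

theorem collectHom_algebraCyclicMap (hS : Function.Bijective (antipode k (A := H)))
    (f : A →ₐ[k] A') (hf : ∀ (h : H) (a : A), f (h • a) = h • f a) (n : ℕ)
    (c : (algebraCyclic k (CrossedProduct k H A)).X n) :
    (collectHom A' hS).app n ((algebraCyclicMap (CrossedProduct.map f hf)).app n c) =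
      (equivariantCyclicMap hS f hf).app n ((collectHom A hS).app n c) :=
  congrArg (Submodule.mkQ _) (collect_powMap f hf (n + 1) c)

end Naturality

theorem collectHom_HCMap_bijective {k : Type u} [Field k] {H : Type v} [Ring H] [HopfAlgebra k H]
    [IsSemisimpleRing H] (hS : Function.Bijective (HopfAlgebra.antipode k (A := H)))
    (A : Type w) [Ring A] [Algebra k A] [Module H A] [IsScalarTower k H A] [HModuleAlgebra k H A]
    (W : GradedUModule.{u, x} k) (n : ℤ) :
    Function.Bijective ((collectHom A hS).HCMap (GradedUModule.Hom.id W) n) := by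
  obtain ⟨ι, s, x, y, h1, hg⟩ := exists_separability k H
  -- Over a field the surjection splits degreewise; no compatibility with the operators is required
  -- of σ.
  choose σ hσ using fun n => ((collectHom A hS).app n).exists_rightInverse_of_surjective
    (LinearMap.range_eq_top.2 (collectHom_surjective hS n))
  exact (collectHom_isKernelContraction s x y h1 hS hg).HCMap_bijective
    algebraCyclic_isCyclicModule σ (fun n c => LinearMap.congr_fun (hσ n) c) W n

end HopfCyclic
end

theorem mainTheorem6 {k : Type u} [Field k] {H : Type v} [Ring H] [HopfAlgebra k H]
    [IsSemisimpleRing H] :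
    ∃ hS : Function.Bijective (HopfAlgebra.antipode k (A := H)),
      (∀ (M : Type y) [AddCommGroup M] [Module k M] [Module H M] [IsScalarTower k H M] (q : ℕ),
        Function.Exact (HopfCyclic.hopfBoundary k H M (q + 1)) (HopfCyclic.hopfBoundary k H M q)) ∧
      (∀ (A : Type w) [Ring A] [Algebra k A] [Module H A] [IsScalarTower k H A]
        [HopfCyclic.HModuleAlgebra k H A],
        (HopfCyclic.equivariantCyclic k A hS).IsCyclicModule) ∧
      ∃ Φ : ∀ (A : Type w) [Ring A] [Algebra k A] [Module H A] [IsScalarTower k H A]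
          [HopfCyclic.HModuleAlgebra k H A] (W : HopfCyclic.GradedUModule.{u, x} k) (n : ℤ),
          (HopfCyclic.algebraCyclic k (HopfCyclic.CrossedProduct k H A)).HC W n ≃ₗ[k]
            (HopfCyclic.equivariantCyclic k A hS).HC W n,
        ∀ (A A' : Type w) [Ring A] [Algebra k A] [Module H A] [IsScalarTower k H A]
          [HopfCyclic.HModuleAlgebra k H A] [Ring A'] [Algebra k A'] [Module H A']
          [IsScalarTower k H A'] [HopfCyclic.HModuleAlgebra k H A'] (f : A →ₐ[k] A')
          (hf : ∀ (h : H) (a : A), f (h • a) = h • f a)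
          (W W' : HopfCyclic.GradedUModule.{u, x} k) (φ : HopfCyclic.GradedUModule.Hom W W')
          (n : ℤ)
          (z : (HopfCyclic.algebraCyclic k (HopfCyclic.CrossedProduct k H A)).HC W n),
          Φ A' W' n ((HopfCyclic.algebraCyclicMap (HopfCyclic.CrossedProduct.map f hf)).HCMap
              φ n z) =
            (HopfCyclic.equivariantCyclicMap hS f hf).HCMap φ n (Φ A W n z) := by
  have hS := HopfCyclic.antipode_bijective k H
  -- The contraction of the Hopf complex uses l h = ε(h) l; the property h l = ε(h) l serves the
  -- antipode and the separability idempotent.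
  obtain ⟨l, hl, -, hl'⟩ := HopfCyclic.exists_integral k H
  refine ⟨hS, fun M _ _ _ _ q => HopfCyclic.hopfBoundary_exact hl hl' q, fun A _ _ _ _ _ =>
    HopfCyclic.CyclicData.IsCyclicModule.of_surjective (HopfCyclic.collectHom A hS)
      (HopfCyclic.collectHom_surjective hS) HopfCyclic.algebraCyclic_isCyclicModule,
    fun A _ _ _ _ _ W n => LinearEquiv.ofBijective _
      (HopfCyclic.collectHom_HCMap_bijective hS A W n), ?_⟩
  intro A A' _ _ _ _ _ _ _ _ _ _ f hf W W' φ n z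
  exact HopfCyclic.CyclicData.HCMap_comm (HopfCyclic.collectHom A hS)
    (HopfCyclic.collectHom A' hS) _ _ (HopfCyclic.collectHom_algebraCyclicMap hS f hf) φ n z
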